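/- **Model.** Let $a<b$. For each $n\ge 1$ let $m_1,\dots,m_n$ be nonnegative integers and $x_{i,j}\in[a,b]$ ($1\le i\le n$, $1\le j\le m_i$) be nonrandom design points (both may depend on $n$), $N_n=m_1+\cdots+m_n\to\infty$, and $$Y_{i,j}=\mu(x_{i,j})+s(x_{i,j})e_{i,j},\qquad e_{i,j}=G(\varepsilon_{i,j},\varepsilon_{i,j\pm1},\varepsilon_{i,j\pm2},\dots),$$ where $\varepsilon_{i,j}$ ($i\in\mathbb N$, $j\in\mathbb Z$) are i.i.d. random elements of a measurable space and $G$ is a real-valued measurable function. Let $e_0=G(\varepsilon_0,\varepsilon_{\pm1},\dots)$ with $(\varepsilon_j)_{j\in\mathbb Z}$ i.i.d. copies of $\varepsilon_{1,1}$, and assume that $e_0$ has median $0$ and $|e_0|$ has median $1$ (the median of $Z$ being $\inf\{z:\mathbb P(Z\le z)\ge 1/2\}$). For $T=[a,b]$ or $T=\mathbb R$, $\mathcal C^4(T)$ denotes the functions on $T$ whose derivatives of orders $0,\dots,4$ exist and are bounded on $T$ (one-sided at end points). **Assumptions.** 1. (Geometric coupling decay.) Let $(\varepsilon'_j)$ be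 an independent copy of $(\varepsilon_j)$ and $e_0(k)=G(\varepsilon_0,\varepsilon_{\pm1},\dots,\varepsilon_{\pm k},\varepsilon'_{\pm(k+1)},\varepsilon'_{\pm(k+2)},\dots)$. There are $q>0$ and $\rho\in(0,1)$ with $(\mathbb E|e_0-e_0(k)|^q)^{1/q}=O(\rho^k)$ as $k\to\infty$. 2. (Approximately uniform design.) For all large $n$ the points $x_{i,j}$ can be ordered as $a=\tilde x_0<\tilde x_1<\cdots<\tilde x_{N_n}<\tilde x_{N_n+1}=b$ (with $\tilde x_1,\dots,\tilde x_{N_n}$ the design points), and $\max_{0\le k\le N_n}|\tilde x_{k+1}-\tilde x_k-(b-a)/N_n|=O(N_n^{-2})$. 3. (Kernel.) $K\ge0$ is symmetric, $\int_{\mathbb R}K=1$, $K$ has bounded support and is differentiable on $\mathbb R$ with bounded derivative. Write $\psi_K=\frac12\int u^2K(u)\,du$ and $K_h(u)=K(u/h)$. 4. (Smoothness.) $\mu,s\in\mathcal C^4([a,b])$, $\inf_{[a,b]}s>0$; the distribution function $F_e$ of $e_0$ is differentiable with derivative (density) $f_e\in\mathcal C^4(\mathbb R)$, $f_e(0)>0$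 and $f_e(1)+f_e(-1)>0$. 5. (Bandwidth.) $b_n>0$, $b_n\to0$ and $(\log N_n)^3/(N_nb_n)\to0$. For $x\in[a,b]$ let $\hat\mu(x)$ be any minimiser over $\theta\in\mathbb R$ of $\sum_{i=1}^n\sum_{j=1}^{m_i}|Y_{i,j}-\theta|K_{b_n}(x_{i,j}-x)$. Fix $\epsilon>0$ and let $\mathcal S_\epsilon([a,b])=[a+\epsilon,b-\epsilon]$. **Theorem 4.1.** (i) (Uniform consistency.) $$\sup_{x\in\mathcal S_\epsilon([a,b])}|\hat\mu(x)-\mu(x)|=O_p\Bigl\{b_n^2+\frac{(\log N_n)^{3/2}}{(N_nb_n)^{1/2}}\Bigr\}.$$ (ii) (Uniform Bahadur representation.) Uniformly over $x\in\mathcal S_\epsilon([a,b])$, $$\hat\mu(x)-\mu(x)=\psi_K\rho_\mu(x)b_n^2+\frac{(b-a)s(x)}{f_e(0)}\,\frac{Q_{b_n}(x)}{N_nb_n}+O_p(r_n),$$ that is, the supremum over $x\in\mathcal S_\epsilon([a,b])$ of the absolute difference between $\hat\mu(x)-\mu(x)$ and the first two terms on the right is $O_p(r_n)$, where $$\rho_\mu(x)=\mu''(x)-\Bigl[\frac{\mu'(x)f_e'(0)}{f_e(0)}+2s'(x)\Bigr]\frac{\mu'(x)}{s(x)},$$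 $$Q_{b_n}(x)=-\sum_{i=1}^n\sum_{j=1}^{m_i}\bigl\{\mathbf 1_{Y_{i,j}\le\mu(x)}-\mathbb E[\mathbf 1_{Y_{i,j}\le\mu(x)}]\bigr\}K_{b_n}(x_{i,j}-x),$$ $$r_n=b_n^4+\frac{b_n^{1/2}(\log N_n)^{3/2}}{N_n^{1/2}}+\frac{(\log N_n)^{9/4}}{(N_nb_n)^{3/4}}.$$ Here $\sup_x|Z_n(x)|=O_p(\alpha_n)$ means: for every $\eta>0$ there is $C$ such that for all large $n$ the (outer) probability that $|Z_n(x)|>C\alpha_n$ for some $x$ is at most $\eta$. -/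

import Mathlib

open MeasureTheory ProbabilityTheory Filter Set Topology

noncomputable section

namespace LocScale

/-! ### The error process -/

section Errors

variable {S : Type*} [MeasurableSpace S]

/-- The law, on two-sided sequences, of i.i.d. innovations with common law `ν`. -/
def innovLaw (ν : Measure S) [IsProbabilityMeasure ν] : Measure (ℤ → S) :=
  Measure.infinitePi (fun _ : ℤ => ν)

/-- Keep the coordinates `r` with `|r| ≤ k` of the first sequence and take all other
coordinates from the second one. -/
def coupled (k : ℕ) (w w' : ℤ → S) : ℤ → S :=
  fun r => if |r| ≤ (k : ℤ) then w r else w' r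

/-- Geometric coupling decay: there are `q > 0` and `ρ ∈ (0, 1)` with
`‖e₀ - e₀(k)‖_q = O(ρ ^ k)` as `k → ∞`, where `e₀ = G(ε)`, `e₀(k)` is `G` evaluated at the
innovations coupled at lag `k`, and `ε'` is an independent copy of `ε`
(realised on the product space). -/
def GeometricCouplingDecay (ν : Measure S) [IsProbabilityMeasure ν] (G : (ℤ → S) → ℝ) : Prop :=
  ∃ q : ℝ, 0 < q ∧ ∃ ρ : ℝ, 0 < ρ ∧ ρ < 1 ∧ ∃ C : ℝ, ∀ᶠ k : ℕ in atTop,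
    eLpNorm (fun z : (ℤ → S) × (ℤ → S) => G z.1 - G (coupled k z.1 z.2))
      (ENNReal.ofReal q) ((innovLaw ν).prod (innovLaw ν)) ≤ ENNReal.ofReal (C * ρ ^ k)

/-- The distribution function `F_e` of `e₀ = G(ε)`. -/
def errorCDF (ν : Measure S) [IsProbabilityMeasure ν] (G : (ℤ → S) → ℝ) (y : ℝ) : ℝ :=
  (innovLaw ν).real {w | G w ≤ y}

/-- The error `e_{i,j} = G(ε_{i,j}, ε_{i,j±1}, ε_{i,j±2}, …)`: the filter `G` applied to the
innovations of subject `i`, centred at position `j`. -/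
def error {Ω : Type*} (G : (ℤ → S) → ℝ) (ε : ℕ → ℤ → Ω → S) (i : ℕ) (j : ℤ) (ω : Ω) : ℝ :=
  G (fun r : ℤ => ε i (j + r) ω)

end Errors

/-- The median `inf {z : P(Z ≤ z) ≥ 1/2}` of a random variable. -/
def median {Ω : Type*} [MeasurableSpace Ω] (P : Measure Ω) (Z : Ω → ℝ) : ℝ :=
  sInf {z : ℝ | 1 / 2 ≤ P.real {ω | Z ω ≤ z}}

/-! ### Regularity conditions -/

/-- Functions with bounded derivatives up to order `r` on `T` (one-sided derivatives at
boundary points): the derivatives of order `0, …, r` exist and are bounded on `T`. -/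
def BoundedDerivs (r : ℕ) (f : ℝ → ℝ) (T : Set ℝ) : Prop :=
  (∀ k < r, DifferentiableOn ℝ (iteratedDerivWithin k f T) T) ∧
    ∀ k ≤ r, ∃ C : ℝ, ∀ x ∈ T, |iteratedDerivWithin k f T x| ≤ C

/-- A symmetric nonnegative kernel with integral one, bounded support and bounded derivative. -/
structure IsKernel (K : ℝ → ℝ) : Prop where
  nonneg : ∀ u, 0 ≤ K u
  integral_eq_one : ∫ u, K u = 1
  symm : ∀ u, K (-u) = K u
  bounded_support : Bornology.IsBounded (Function.support K)
  differentiable : Differentiable ℝ K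
  bounded_deriv : ∃ C : ℝ, ∀ u, |deriv K u| ≤ C

/-- `ψ_K = (1/2) ∫ u² K(u) du`. -/
def psiK (K : ℝ → ℝ) : ℝ := (1 / 2) * ∫ u, u ^ 2 * K u

/-- The total number `N_n = m_{n,1} + ⋯ + m_{n,n}` of observations at stage `n`. -/
def totalObs (m : ℕ → ℕ → ℕ) (n : ℕ) : ℕ := ∑ i ∈ Finset.Icc 1 n, m n i

/-- The index pairs `(i, j)`, `1 ≤ i ≤ n`, `1 ≤ j ≤ m_{n,i}`. -/
def obsIndex (m : ℕ → ℕ → ℕ) (n : ℕ) : Set (ℕ × ℕ) :=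
  {p | 1 ≤ p.1 ∧ p.1 ≤ n ∧ 1 ≤ p.2 ∧ p.2 ≤ m n p.1}

/-- Approximately uniform design on `[a, b]`: the pooled design points can be ordered as
`a = t₀ < t₁ < ⋯ < t_{N_n} < t_{N_n+1} = b`, with
`max_{0 ≤ k ≤ N_n} |t_{k+1} - t_k - (b - a) / N_n| = O(N_n⁻²)`. -/
def ApproxUniformDesign (a b : ℝ) (m : ℕ → ℕ → ℕ) (x : ℕ → ℕ → ℕ → ℝ) : Prop :=
  ∃ C : ℝ, ∀ᶠ n : ℕ in atTop, ∃ (t : ℕ → ℝ) (σ : ℕ × ℕ → ℕ),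
    BijOn σ (obsIndex m n) (Icc 1 (totalObs m n)) ∧
    (∀ p ∈ obsIndex m n, x n p.1 p.2 = t (σ p)) ∧
    t 0 = a ∧ t (totalObs m n + 1) = b ∧
    (∀ k ≤ totalObs m n, t k < t (k + 1)) ∧
    ∀ k ≤ totalObs m n,
      |t (k + 1) - t k - (b - a) / (totalObs m n : ℝ)| ≤ C / (totalObs m n : ℝ) ^ 2

/-! ### Model, estimator and Bahadur terms -/

/-- The response `Y_{i,j} = μ(x_{i,j}) + s(x_{i,j}) e_{i,j}` at stage `n`. -/
def response {Ω : Type*} (μ s : ℝ → ℝ) (x : ℕ → ℕ → ℕ → ℝ) (e : ℕ → ℤ → Ω → ℝ)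
    (n i j : ℕ) (ω : Ω) : ℝ :=
  μ (x n i j) + s (x n i j) * e i (j : ℤ) ω

/-- The kernel-weighted absolute loss `∑ᵢ ∑ⱼ |Y_{i,j} - θ| K((x_{i,j} - u) / β)`
at location `u` with bandwidth `β`. -/
def ladLoss {Ω : Type*} (m : ℕ → ℕ → ℕ) (x : ℕ → ℕ → ℕ → ℝ) (Y : ℕ → ℕ → ℕ → Ω → ℝ)
    (K : ℝ → ℝ) (β : ℝ) (n : ℕ) (ω : Ω) (u θ : ℝ) : ℝ :=
  ∑ i ∈ Finset.Icc 1 n, ∑ j ∈ Finset.Icc 1 (m n i),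
    |Y n i j ω - θ| * K ((x n i j - u) / β)

/-- `muHat n ω u` is, for every `u ∈ [a, b]`, a minimiser over `θ ∈ ℝ` of the
kernel-weighted absolute loss with bandwidth `β n`. -/
def IsKernelLAD {Ω : Type*} (a b : ℝ) (m : ℕ → ℕ → ℕ) (x : ℕ → ℕ → ℕ → ℝ)
    (Y : ℕ → ℕ → ℕ → Ω → ℝ) (K : ℝ → ℝ) (β : ℕ → ℝ) (muHat : ℕ → Ω → ℝ → ℝ) : Prop :=
  ∀ n ω, ∀ u ∈ Icc a b, ∀ θ : ℝ,
    ladLoss m x Y K (β n) n ω u (muHat n ω u) ≤ ladLoss m x Y K (β n) n ω u θ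

/-- `ρ_μ = μ'' - [μ' f_e'(0) / f_e(0) + 2 s'] μ' / s`. -/
def rhoMu (μ s fe : ℝ → ℝ) (u : ℝ) : ℝ :=
  deriv (deriv μ) u - (deriv μ u * deriv fe 0 / fe 0 + 2 * deriv s u) * (deriv μ u / s u)

/-- `Q_β(u) = -∑ᵢ ∑ⱼ {1[Y_{i,j} ≤ μ(u)] - E 1[Y_{i,j} ≤ μ(u)]} K((x_{i,j} - u) / β)`. -/
def bahadurQ {Ω : Type*} [MeasurableSpace Ω] (P : Measure Ω) (m : ℕ → ℕ → ℕ)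
    (x : ℕ → ℕ → ℕ → ℝ) (Y : ℕ → ℕ → ℕ → Ω → ℝ) (μ K : ℝ → ℝ) (β : ℝ)
    (n : ℕ) (ω : Ω) (u : ℝ) : ℝ :=
  -∑ i ∈ Finset.Icc 1 n, ∑ j ∈ Finset.Icc 1 (m n i),
    ({ω' | Y n i j ω' ≤ μ u}.indicator (fun _ => (1 : ℝ)) ω
      - ∫ ω'', {ω' | Y n i j ω' ≤ μ u}.indicator (fun _ => (1 : ℝ)) ω'' ∂P)
      * K ((x n i j - u) / β)

/-- `Z_n(u) = O_p(r_n)` uniformly over `u ∈ T`, that is `sup_{u ∈ T} |Z_n(u)| = O_p(r_n)`: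
for every `η > 0` there is `C` such that, for all large `n`, the (outer) probability that
`|Z_n(u)| > C r_n` for some `u ∈ T` is at most `η`. -/
def UniformOp {Ω : Type*} [MeasurableSpace Ω] (P : Measure Ω) (T : Set ℝ)
    (Z : ℕ → Ω → ℝ → ℝ) (r : ℕ → ℝ) : Prop :=
  ∀ η : ℝ, 0 < η → ∃ C : ℝ, ∀ᶠ n : ℕ in atTop,
    P {ω | ∃ u ∈ T, C * r n < |Z n ω u|} ≤ ENNReal.ofReal η

/-- The uniform consistency rate `β² + (log N)^{3/2} / (N β)^{1/2}`. -/
def consistencyRate (N : ℕ) (β : ℝ) : ℝ :=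
  β ^ 2 + Real.log N ^ (3 / 2 : ℝ) / ((N : ℝ) * β) ^ (1 / 2 : ℝ)

/-- The Bahadur remainder rate
`β⁴ + β^{1/2} (log N)^{3/2} / N^{1/2} + (log N)^{9/4} / (N β)^{3/4}`. -/
def bahadurRate (N : ℕ) (β : ℝ) : ℝ :=
  β ^ 4 + β ^ (1 / 2 : ℝ) * Real.log N ^ (3 / 2 : ℝ) / (N : ℝ) ^ (1 / 2 : ℝ)
    + Real.log N ^ (9 / 4 : ℝ) / ((N : ℝ) * β) ^ (3 / 4 : ℝ)

end LocScale

end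

open LocScale

/-!
The estimator `muHat(u)` is a weighted median, so it is located by the sign of the score
`θ ↦ ∑ (1[Y ≤ θ] - 1/2) K((x - u)/β)`: where the score is positive, `θ` lies above every minimiser,
and where it is negative, below (`minimiser_le`, `le_minimiser`). At `θ = μ(u) + d` the score splits
into its expectation and the centred weighted empirical process `empDev`.

*Expectation.* A Taylor expansion of `F_e((μ(u) + d - μ(x)) / s(x))` in `x - u` and `d`
(`exists_expansion`), summed over the nearly equidistant design (`abs_sum_sub_integral_le`), where
the symmetry of `K` removes the odd orders, shows that the expected score is
`N β f_e(0) / ((b - a) s(u)) · (d - ψ_K ρ_μ(u) β²)` up to `O(1 + N β (β⁴ + d²))`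
(`ApproxUniformDesign.exists_score_expansion`).

*Fluctuation.* `tendsto_prob_sup_empDev` bounds increments of `empDev` with pointwise variance of
order `v` by `O_p(log N · √(N β v log N))`, uniformly in the location and the thresholds. Freezing
the innovations beyond a lag `k` of order `log N` at a well-chosen deterministic sequence changes
all errors by at most `N⁻²`, with high probability (`exists_frozen_tail_log`). The resulting array
is `k`-dependent, so it splits into `2k + 1` classes of independent terms, each with a Chernoff
bound (`prob_abs_sum_ge_of_lagWindow`); a grid of mesh `N⁻²`, monotonicity in the threshold and the
Lipschitz property of `K` give uniformity (`prob_sup_empDev_le`).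

*Conclusion.* Write `q = (log N)^{3/2} / (N β)^{1/2}`. With `v = 1` the process at `μ(u)` is
`O_p(N β q)`; with `v` of order `β² + q` its increments over `|d| = O(β² + q)` are
`O_p(N β q √(β² + q))`. Hence the score changes sign within `O_p(β⁴ + β q + q^{3/2})` of the zero of
its linearisation, which is the claimed leading term, and this error is the Bahadur rate
(`bahadur_of_bounds`). Consistency follows since the leading term is itself `O_p(β² + q)`.
-/

namespace LocScale

/-! ### An exponential inequality for finite-range dependent arrays -/

section Bernstein

variable {Ω : Type*} [MeasurableSpace Ω] {P : Measure Ω} [IsProbabilityMeasure P]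

lemma integrable_of_abs_le {X : Ω → ℝ} (hX : Measurable X) {B : ℝ} (hB : ∀ ω, |X ω| ≤ B) :
    Integrable X P :=
  Integrable.of_bound hX.aestronglyMeasurable B (ae_of_all _ hB)

lemma integrable_exp_of_abs_le {X : Ω → ℝ} (hX : Measurable X) {B : ℝ} (hB : ∀ ω, |X ω| ≤ B)
    (l : ℝ) : Integrable (fun ω => Real.exp (l * X ω)) P := by
  refine integrable_of_abs_le (B := Real.exp (|l| * B)) (by fun_prop) fun ω => ?_
  rw [abs_of_pos (Real.exp_pos _)]
  refine Real.exp_le_exp.2 ((le_abs_self _).trans ?_)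
  rw [abs_mul]
  exact mul_le_mul_of_nonneg_left (hB ω) (abs_nonneg _)

/-- For a centred variable bounded by `B` and `0 ≤ l ≤ 1 / B`, the inequality
`exp x ≤ 1 + x + x²` on `[-1, 1]` bounds the moment generating function by
`exp (l² E X²)`. -/
lemma mgf_le_exp_sq {X : Ω → ℝ} (hX : Measurable X) {B : ℝ} (hB : ∀ ω, |X ω| ≤ B)
    (h0 : ∫ ω, X ω ∂P = 0) {l : ℝ} (hl : 0 ≤ l) (hlB : l * B ≤ 1) :
    mgf X P l ≤ Real.exp (l ^ 2 * ∫ ω, X ω ^ 2 ∂P) := by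
  have hsq : Integrable (fun ω => X ω ^ 2) P := by
    refine integrable_of_abs_le (B := B ^ 2) (by fun_prop) fun ω => ?_
    rw [abs_pow]
    exact pow_le_pow_left₀ (abs_nonneg _) (hB ω) 2
  have hXi : Integrable X P := integrable_of_abs_le hX hB
  have h1 : mgf X P l ≤ ∫ ω, (1 + l * X ω + l ^ 2 * X ω ^ 2) ∂P := by
    refine integral_mono (integrable_exp_of_abs_le hX hB l)
      (((integrable_const _).add (hXi.const_mul _)).add (hsq.const_mul _)) fun ω => ?_
    have hle : |l * X ω| ≤ 1 := by
      rw [abs_mul, abs_of_nonneg hl]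
      exact (mul_le_mul_of_nonneg_left (hB ω) hl).trans hlB
    have := (abs_le.1 (Real.abs_exp_sub_one_sub_id_le hle)).2
    dsimp only
    nlinarith
  have h2 : ∫ ω, (1 + l * X ω + l ^ 2 * X ω ^ 2) ∂P = 1 + l ^ 2 * ∫ ω, X ω ^ 2 ∂P := by
    have i1 : Integrable (fun _ : Ω => (1 : ℝ)) P := integrable_const _
    have i2 : Integrable (fun ω => l * X ω) P := hXi.const_mul _
    have i3 : Integrable (fun ω => l ^ 2 * X ω ^ 2) P := hsq.const_mul _
    have i12 : Integrable (fun ω => 1 + l * X ω) P := i1.add i2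
    rw [integral_add i12 i3, integral_add i1 i2, integral_const_mul, integral_const_mul, h0]
    simp
  refine h1.trans ?_
  rw [h2]
  linarith [Real.add_one_le_exp (l ^ 2 * ∫ ω, X ω ^ 2 ∂P)]

variable {ι κ S : Type*} [MeasurableSpace S]

/-- The σ-algebra generated by the coordinates `f i`, `i ∈ W`, of a family of random elements. -/
abbrev windowSigma (f : ι → Ω → S) (W : Set ι) : MeasurableSpace Ω :=
  ⨆ i ∈ W, MeasurableSpace.comap (f i) inferInstance

/-- Sums of centred bounded variables that depend on disjoint blocks of an independent family:
the moment generating function factorises, one block at a time. -/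
lemma mgf_sum_le_of_disjoint {f : ι → Ω → S} (hf : ∀ i, Measurable (f i)) (hind : iIndepFun f P)
    {W : κ → Set ι} {X : κ → Ω → ℝ} {s : Finset κ}
    (hW : (s : Set κ).PairwiseDisjoint W)
    (hX : ∀ p ∈ s, Measurable[windowSigma f (W p)] (X p)) {B : ℝ}
    (hB : ∀ p ∈ s, ∀ ω, |X p ω| ≤ B) (h0 : ∀ p ∈ s, ∫ ω, X p ω ∂P = 0)
    {l : ℝ} (hl : 0 ≤ l) (hlB : l * B ≤ 1) :
    mgf (fun ω => ∑ p ∈ s, X p ω) P l ≤ Real.exp (l ^ 2 * ∑ p ∈ s, ∫ ω, X p ω ^ 2 ∂P) := by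
  classical
  have hle : ∀ i, MeasurableSpace.comap (f i) inferInstance ≤ (inferInstance : MeasurableSpace Ω) :=
    fun i => (hf i).comap_le
  have hmono : ∀ V : Set ι, windowSigma f V ≤ (inferInstance : MeasurableSpace Ω) :=
    fun V => iSup₂_le fun i _ => hle i
  induction s using Finset.induction_on with
  | empty => simp [mgf]
  | insert p s hp ih =>
    have ih' := ih (hW.subset (by simp)) (fun q hq => hX q (Finset.mem_insert_of_mem hq))
      (fun q hq => hB q (Finset.mem_insert_of_mem hq))
      (fun q hq => h0 q (Finset.mem_insert_of_mem hq))
    have hpm := hX p (Finset.mem_insert_self _ _)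
    have hXm : ∀ q ∈ insert p s, Measurable (X q) := fun q hq => (hX q hq).mono (hmono _) le_rfl
    have hsumW : Measurable[windowSigma f (⋃ q ∈ s, W q)] (fun ω => ∑ q ∈ s, X q ω) := by
      refine Finset.measurable_fun_sum s fun q hq => ?_
      refine (hX q (Finset.mem_insert_of_mem hq)).mono ?_ le_rfl
      exact biSup_mono fun i hi => mem_biUnion hq hi
    have hdis : Disjoint (W p) (⋃ q ∈ s, W q) := by
      rw [Set.disjoint_iUnion₂_right]
      intro q hq
      refine hW (by simp) (by simp [hq]) ?_
      rintro rfl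
      exact hp hq
    have hI : IndepFun (X p) (fun ω => ∑ q ∈ s, X q ω) P := by
      have := indep_iSup_of_disjoint hle hind hdis
      exact indep_of_indep_of_le_left (indep_of_indep_of_le_right this hsumW.comap_le) hpm.comap_le
    have hsumm : Measurable (fun ω => ∑ q ∈ s, X q ω) := hsumW.mono (hmono _) le_rfl
    have hpm' := hXm p (Finset.mem_insert_self _ _)
    have e1 : (fun ω => ∑ q ∈ insert p s, X q ω) = X p + fun ω => ∑ q ∈ s, X q ω := by
      ext ω; simp [Finset.sum_insert hp]
    have m1 : Measurable fun ω => Real.exp (l * X p ω) := by fun_prop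
    have m2 : Measurable fun ω => Real.exp (l * ∑ q ∈ s, X q ω) := (hsumm.const_mul l).exp
    rw [e1, hI.mgf_add m1.aestronglyMeasurable m2.aestronglyMeasurable, Finset.sum_insert hp,
      mul_add, Real.exp_add]
    refine mul_le_mul ?_ ih' mgf_nonneg (Real.exp_pos _).le
    exact mgf_le_exp_sq hpm' (hB p (Finset.mem_insert_self _ _))
      (h0 p (Finset.mem_insert_self _ _)) hl hlB

/-- Chernoff bound for one block-independent class, both tails. -/
lemma prob_abs_sum_ge_of_disjoint {f : ι → Ω → S} (hf : ∀ i, Measurable (f i))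
    (hind : iIndepFun f P) {W : κ → Set ι} {X : κ → Ω → ℝ} {s : Finset κ}
    (hW : (s : Set κ).PairwiseDisjoint W)
    (hX : ∀ p ∈ s, Measurable[windowSigma f (W p)] (X p)) {B : ℝ}
    (hB : ∀ p ∈ s, ∀ ω, |X p ω| ≤ B) (h0 : ∀ p ∈ s, ∫ ω, X p ω ∂P = 0)
    {l : ℝ} (hl : 0 ≤ l) (hlB : l * B ≤ 1) {V : ℝ} (hV : ∑ p ∈ s, ∫ ω, X p ω ^ 2 ∂P ≤ V) (z : ℝ) :
    P.real {ω | z ≤ |∑ p ∈ s, X p ω|} ≤ 2 * Real.exp (-l * z + l ^ 2 * V) := by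
  have hmono : ∀ V : Set ι, windowSigma f V ≤ (inferInstance : MeasurableSpace Ω) :=
    fun V => iSup₂_le fun i _ => (hf i).comap_le
  have key : ∀ Y : κ → Ω → ℝ, (∀ p ∈ s, Measurable[windowSigma f (W p)] (Y p)) →
      (∀ p ∈ s, ∀ ω, |Y p ω| ≤ B) → (∀ p ∈ s, ∫ ω, Y p ω ∂P = 0) →
      (∑ p ∈ s, ∫ ω, Y p ω ^ 2 ∂P ≤ V) →
      P.real {ω | z ≤ ∑ p ∈ s, Y p ω} ≤ Real.exp (-l * z + l ^ 2 * V) := by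
    intro Y hY hYB hY0 hYV
    have hYm : Measurable fun ω => ∑ p ∈ s, Y p ω :=
      Finset.measurable_fun_sum s fun q hq => (hY q hq).mono (hmono _) le_rfl
    have hYb : ∀ ω, |∑ p ∈ s, Y p ω| ≤ ∑ _p ∈ s, B := fun ω =>
      (Finset.abs_sum_le_sum_abs _ _).trans (Finset.sum_le_sum fun p hp => hYB p hp ω)
    refine (measure_ge_le_exp_mul_mgf z hl (integrable_exp_of_abs_le hYm hYb l)).trans ?_
    rw [Real.exp_add]
    refine mul_le_mul_of_nonneg_left ?_ (Real.exp_pos _).le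
    refine (mgf_sum_le_of_disjoint hf hind hW hY hYB hY0 hl hlB).trans ?_
    exact Real.exp_le_exp.2 (mul_le_mul_of_nonneg_left hYV (sq_nonneg l))
  have h1 := key X hX hB h0 hV
  have h2 := key (fun p ω => -X p ω) (fun p hp => (hX p hp).neg)
    (fun p hp ω => by simpa using hB p hp ω)
    (fun p hp => by rw [integral_neg, h0 p hp, neg_zero]) (by simpa using hV)
  calc P.real {ω | z ≤ |∑ p ∈ s, X p ω|}
      ≤ P.real ({ω | z ≤ ∑ p ∈ s, X p ω} ∪ {ω | z ≤ ∑ p ∈ s, -X p ω}) := by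
        refine measureReal_mono fun ω hω => ?_
        have : z ≤ |∑ p ∈ s, X p ω| := hω
        rcases le_abs.1 this with h | h
        · exact Or.inl h
        · refine Or.inr ?_
          simpa only [mem_ofPred_eq, Finset.sum_neg_distrib] using h
    _ ≤ _ := (measureReal_union_le _ _).trans (by linarith)

/-- The block of innovations of subject `p.1` within distance `k` of position `p.2`. -/
def lagWindow (k : ℕ) (p : ℕ × ℕ) : Set (ℕ × ℤ) := {q | q.1 = p.1 ∧ |q.2 - p.2| ≤ k}

/-- Exponential inequality for `k`-dependent arrays: split the positions into the `2k+1`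
residue classes, inside which the blocks are disjoint, and take a union bound. The variance
budget `V` of the whole sum is used for every class, which costs a factor `√(2k+1)` but needs
nothing about how the variances are spread over the classes. -/
lemma prob_abs_sum_ge_of_lagWindow {ε : ℕ × ℤ → Ω → S} (hε : ∀ q, Measurable (ε q))
    (hind : iIndepFun ε P) (k : ℕ) {X : ℕ × ℕ → Ω → ℝ} {s : Finset (ℕ × ℕ)}
    (hX : ∀ p ∈ s, Measurable[windowSigma ε (lagWindow k p)] (X p)) {B : ℝ}
    (hB : ∀ p ∈ s, ∀ ω, |X p ω| ≤ B) (h0 : ∀ p ∈ s, ∫ ω, X p ω ∂P = 0)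
    {l : ℝ} (hl : 0 ≤ l) (hlB : l * B ≤ 1) {V : ℝ} (hV : ∑ p ∈ s, ∫ ω, X p ω ^ 2 ∂P ≤ V) (z : ℝ) :
    P.real {ω | (2 * k + 1 : ℕ) * z ≤ |∑ p ∈ s, X p ω|} ≤
      (2 * k + 1 : ℕ) * (2 * Real.exp (-l * z + l ^ 2 * V)) := by
  classical
  set c : ℕ → Finset (ℕ × ℕ) := fun r => s.filter fun p => p.2 % (2 * k + 1) = r with hc
  have hsum : ∀ ω, ∑ p ∈ s, X p ω = ∑ r ∈ Finset.range (2 * k + 1), ∑ p ∈ c r, X p ω := by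
    intro ω
    refine (Finset.sum_fiberwise_of_maps_to (fun p _ => ?_) _).symm
    exact Finset.mem_range.2 (Nat.mod_lt _ (by omega))
  have hcs : ∀ r, c r ⊆ s := fun r => Finset.filter_subset _ _
  have hcls : ∀ r, P.real {ω | z ≤ |∑ p ∈ c r, X p ω|} ≤ 2 * Real.exp (-l * z + l ^ 2 * V) := by
    intro r
    refine prob_abs_sum_ge_of_disjoint hε hind (W := lagWindow k) ?_ (fun p hp => hX p (hcs r hp))
      (fun p hp => hB p (hcs r hp)) (fun p hp => h0 p (hcs r hp)) hl hlB ?_ z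
    · intro p hp q hq hpq
      rw [Function.onFun, Set.disjoint_left]
      rintro ⟨i, j⟩ ⟨h1, h2⟩ ⟨h3, h4⟩
      simp only [hc, Finset.coe_filter, mem_ofPred_eq] at hp hq h1 h2 h3 h4
      apply hpq
      refine Prod.ext (h1 ▸ h3) ?_
      -- positions in one class differ by a multiple of `2k+1`, while sharing a window forces
      -- them to be at distance at most `2k`
      have hmod : ((2 * k + 1 : ℕ) : ℤ) ∣ (p.2 : ℤ) - q.2 := by
        have : p.2 ≡ q.2 [MOD (2 * k + 1)] := by rw [Nat.ModEq, hp.2, hq.2]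
        exact (Nat.modEq_iff_dvd.1 this.symm)
      have hlt : |(p.2 : ℤ) - q.2| < ((2 * k + 1 : ℕ) : ℤ) := by
        rw [abs_le] at h2 h4
        rw [abs_lt]; push_cast; constructor <;> linarith [h2.1, h2.2, h4.1, h4.2]
      have := Int.eq_zero_of_abs_lt_dvd hmod hlt
      omega
    · exact (Finset.sum_le_sum_of_subset_of_nonneg (hcs r) fun p _ _ =>
        integral_nonneg fun ω => sq_nonneg _).trans hV
  have hsub : {ω | (2 * k + 1 : ℕ) * z ≤ |∑ p ∈ s, X p ω|} ⊆
      ⋃ r ∈ Finset.range (2 * k + 1), {ω | z ≤ |∑ p ∈ c r, X p ω|} := by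
    intro ω hω
    by_contra hcon
    simp only [mem_iUnion, mem_ofPred_eq, not_exists, not_le] at hcon
    have : |∑ p ∈ s, X p ω| < ∑ r ∈ Finset.range (2 * k + 1), z := by
      rw [hsum]
      refine (Finset.abs_sum_le_sum_abs _ _).trans_lt ?_
      exact Finset.sum_lt_sum_of_nonempty (by simp) fun r hr => hcon r hr
    simp only [Finset.sum_const, Finset.card_range, nsmul_eq_mul] at this
    exact absurd hω (not_le.2 this)
  refine (measureReal_mono hsub (measure_ne_top _ _)).trans
    ((measureReal_biUnion_finset_le _ _).trans ?_)
  refine (Finset.sum_le_sum fun r _ => hcls r).trans ?_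
  simp

end Bernstein

/-! ### Finite-range approximation of the errors -/

section Coupling

variable {Ω S : Type*} [MeasurableSpace Ω] [MeasurableSpace S] {P : Measure Ω}
  [IsProbabilityMeasure P] {ν : Measure S} [IsProbabilityMeasure ν]

instance : IsProbabilityMeasure (innovLaw ν) := by unfold innovLaw; infer_instance

lemma measurable_coupled (k : ℕ) :
    Measurable fun z : (ℤ → S) × (ℤ → S) => coupled k z.1 z.2 := by
  refine measurable_pi_lambda _ fun r => ?_
  unfold coupled
  split_ifs <;> fun_prop

lemma measurable_coupled_left (k : ℕ) (w' : ℤ → S) :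
    Measurable fun w : ℤ → S => coupled k w w' :=
  (measurable_coupled k).comp (measurable_id.prodMk measurable_const)

/-- The innovations of one subject, recentred at any position, have the law of an i.i.d.
two-sided sequence. -/
lemma map_shift_eq_innovLaw {ε : ℕ → ℤ → Ω → S} (hε_meas : ∀ i j, Measurable (ε i j))
    (hε_law : ∀ i j, P.map (ε i j) = ν) (hε_indep : iIndepFun (fun p : ℕ × ℤ => ε p.1 p.2) P)
    (i : ℕ) (j : ℤ) : P.map (fun ω (r : ℤ) => ε i (j + r) ω) = innovLaw ν := by
  have hinj : Function.Injective fun r : ℤ => ((i, j + r) : ℕ × ℤ) := fun r r' h => by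
    simpa using h
  have h := hε_indep.precomp hinj
  have := (iIndepFun_iff_map_fun_eq_infinitePi_map (fun r => hε_meas i (j + r))).1 h
  rw [innovLaw]
  convert this using 2
  ext1 r
  exact (hε_law i (j + r)).symm

lemma measurable_shift {ε : ℕ → ℤ → Ω → S} (hε_meas : ∀ i j, Measurable (ε i j))
    (i : ℕ) (j : ℤ) : Measurable fun ω (r : ℤ) => ε i (j + r) ω :=
  measurable_pi_lambda _ fun r => hε_meas i (j + r)

lemma measurable_error {G : (ℤ → S) → ℝ} (hG : Measurable G) {ε : ℕ → ℤ → Ω → S}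
    (hε_meas : ∀ i j, Measurable (ε i j)) (i : ℕ) (j : ℤ) : Measurable (error G ε i j) :=
  hG.comp (measurable_shift hε_meas i j)

/-- Probabilities of events about the innovations seen from one position. -/
lemma prob_shift {ε : ℕ → ℤ → Ω → S} (hε_meas : ∀ i j, Measurable (ε i j))
    (hε_law : ∀ i j, P.map (ε i j) = ν) (hε_indep : iIndepFun (fun p : ℕ × ℤ => ε p.1 p.2) P)
    (i : ℕ) (j : ℤ) {A : Set (ℤ → S)} (hA : MeasurableSet A) :
    P.real {ω | (fun r : ℤ => ε i (j + r) ω) ∈ A} = (innovLaw ν).real A := by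
  rw [← map_shift_eq_innovLaw hε_meas hε_law hε_indep i j,
    map_measureReal_apply (measurable_shift hε_meas i j) hA]
  rfl

/-- Fixing the far innovations at a suitable deterministic sequence `w'` turns `G` into a filter
of finite range `k` that is still geometrically close to `G`: by Fubini, some `w'` does at least
as well as the average over the independent copy. -/
lemma exists_frozen_tail {G : (ℤ → S) → ℝ} (hG : Measurable G) (h : GeometricCouplingDecay ν G) :
    ∃ q : ℝ, 0 < q ∧ ∃ ρ : ℝ, 0 < ρ ∧ ρ < 1 ∧ ∃ C : ℝ, 0 < C ∧ ∀ᶠ k : ℕ in atTop,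
      ∀ t : ℝ, 0 < t → ∃ w' : ℤ → S,
        (innovLaw ν).real {w | t ≤ |G w - G (coupled k w w')|} ≤ (C * ρ ^ k / t) ^ q := by
  obtain ⟨q, hq, ρ, hρ0, hρ1, C, hC⟩ := h
  refine ⟨q, hq, ρ, hρ0, hρ1, |C| + 1, by positivity, ?_⟩
  filter_upwards [hC] with k hk t ht
  set g : (ℤ → S) × (ℤ → S) → ℝ := fun z => G z.1 - G (coupled k z.1 z.2) with hg
  have hgm : Measurable g := (hG.comp measurable_fst).sub (hG.comp (measurable_coupled k))
  set M := (innovLaw ν).prod (innovLaw ν)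
  have hq0 : ENNReal.ofReal q ≠ 0 := by simpa using hq
  have hb : M {z | t ≤ |g z|} ≤ ENNReal.ofReal (((|C| + 1) * ρ ^ k / t) ^ q) := by
    have h1 := mul_meas_ge_le_pow_eLpNorm' M hq0 ENNReal.ofReal_ne_top
      hgm.aestronglyMeasurable (ENNReal.ofReal t)
    rw [ENNReal.toReal_ofReal hq.le] at h1
    have e1 : {z | ENNReal.ofReal t ≤ ‖g z‖ₑ} = {z | t ≤ |g z|} := by
      ext z
      simp only [mem_ofPred_eq]
      rw [Real.enorm_eq_ofReal_abs, ENNReal.ofReal_le_ofReal_iff (abs_nonneg _)]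
    rw [e1] at h1
    have h2 : eLpNorm g (ENNReal.ofReal q) M ^ q ≤ ENNReal.ofReal (((|C| + 1) * ρ ^ k) ^ q) := by
      rw [← ENNReal.ofReal_rpow_of_nonneg (by positivity) hq.le]
      refine ENNReal.rpow_le_rpow (hk.trans (ENNReal.ofReal_le_ofReal ?_)) hq.le
      exact mul_le_mul_of_nonneg_right (by linarith [le_abs_self C]) (by positivity)
    rw [Real.div_rpow (by positivity) ht.le, ENNReal.ofReal_div_of_pos (by positivity),
      ENNReal.le_div_iff_mul_le (Or.inl (by simpa using Real.rpow_pos_of_pos ht q))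
        (Or.inl ENNReal.ofReal_ne_top), mul_comm, ← ENNReal.ofReal_rpow_of_nonneg ht.le hq.le]
    exact h1.trans h2
  have hms : MeasurableSet {z | t ≤ |g z|} := measurableSet_le measurable_const hgm.abs
  rw [Measure.prod_apply_symm hms] at hb
  obtain ⟨w', hw'⟩ := exists_le_lintegral (μ := innovLaw ν)
    (f := fun y => innovLaw ν ((fun x => (x, y)) ⁻¹' {z | t ≤ |g z|}))
    (measurable_measure_prodMk_right hms).aemeasurable
  refine ⟨w', ?_⟩
  exact ENNReal.toReal_le_of_le_ofReal (by positivity) (hw'.trans hb)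

/-- With range of order `log N`, the finite-range filter agrees with `G` up to `N⁻²` outside an
event of probability `O(N⁻²)`. -/
lemma exists_frozen_tail_log {G : (ℤ → S) → ℝ} (hG : Measurable G)
    (h : GeometricCouplingDecay ν G) :
    ∃ B : ℝ, 0 < B ∧ ∃ C : ℝ, 0 < C ∧ ∀ᶠ N : ℕ in atTop, ∃ (k : ℕ) (w' : ℤ → S),
      (k : ℝ) ≤ B * Real.log N ∧
      (innovLaw ν).real {w | ((N : ℝ) ^ 2)⁻¹ ≤ |G w - G (coupled k w w')|} ≤ C / (N : ℝ) ^ 2 := by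
  obtain ⟨q, hq, ρ, hρ0, hρ1, C, hC, hk⟩ := exists_frozen_tail hG h
  have hlρ : 0 < -Real.log ρ := by linarith [Real.log_neg hρ0 hρ1]
  -- chosen so that `ρ ^ (A log N) = N ^ (-2 - 2 / q)`
  set A : ℝ := (2 / q + 2) / (-Real.log ρ) with hA
  have hA0 : 0 < A := by positivity
  have hlog : Tendsto (fun N : ℕ => Real.log N) atTop atTop :=
    Real.tendsto_log_atTop.comp tendsto_natCast_atTop_atTop
  have hkt : Tendsto (fun N : ℕ => ⌈A * Real.log N⌉₊) atTop atTop :=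
    tendsto_nat_ceil_atTop.comp (hlog.const_mul_atTop hA0)
  refine ⟨A + 1, by positivity, C ^ q, by positivity, ?_⟩
  filter_upwards [hkt.eventually hk, hlog.eventually_ge_atTop 1, eventually_gt_atTop 0]
    with N hN hL hN0
  have hN0' : (0 : ℝ) < N := by exact_mod_cast hN0
  obtain ⟨w', hw'⟩ := hN (((N : ℝ) ^ 2)⁻¹) (by positivity)
  refine ⟨_, w', ?_, hw'.trans ?_⟩
  · have := (Nat.ceil_lt_add_one (by positivity : 0 ≤ A * Real.log N)).le
    nlinarith
  · have h1 : ρ ^ ⌈A * Real.log N⌉₊ ≤ (N : ℝ) ^ (-(2 / q + 2)) := by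
      rw [← Real.rpow_natCast, Real.rpow_def_of_pos hρ0, Real.rpow_def_of_pos hN0']
      refine Real.exp_le_exp.2 ?_
      have h2 := Nat.le_ceil (A * Real.log N)
      have h3 : A * (-Real.log ρ) = 2 / q + 2 := by
        rw [hA, div_mul_cancel₀ _ hlρ.ne']
      nlinarith
    have h4 : C * ρ ^ ⌈A * Real.log N⌉₊ / ((N : ℝ) ^ 2)⁻¹ ≤ C * (N : ℝ) ^ (-(2 / q)) := by
      rw [div_inv_eq_mul, mul_assoc]
      refine mul_le_mul_of_nonneg_left ?_ hC.le
      refine (mul_le_mul_of_nonneg_right h1 (by positivity)).trans (le_of_eq ?_)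
      rw [← Real.rpow_natCast, ← Real.rpow_add hN0']
      congr 1; push_cast; ring
    refine (Real.rpow_le_rpow (by positivity) h4 hq.le).trans (le_of_eq ?_)
    rw [Real.mul_rpow hC.le (by positivity), ← Real.rpow_mul hN0'.le,
      div_eq_mul_inv (C ^ q)]
    congr 1
    rw [show -(2 / q) * q = -((2 : ℕ) : ℝ) by push_cast; field_simp, Real.rpow_neg hN0'.le,
      Real.rpow_natCast]

/-- An error built from a filter of range `k` depends only on the innovations in the window. -/
lemma measurable_error_coupled {Ω S : Type*} [MeasurableSpace S] {G : (ℤ → S) → ℝ}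
    (hG : Measurable G) (ε : ℕ → ℤ → Ω → S) (k : ℕ) (w' : ℤ → S) (p : ℕ × ℕ) :
    Measurable[windowSigma (fun q : ℕ × ℤ => ε q.1 q.2) (lagWindow k p)]
      (error (fun w => G (coupled k w w')) ε p.1 p.2) := by
  refine hG.comp ?_
  refine @measurable_pi_lambda _ _ _ (_) _ _ fun r => ?_
  unfold coupled
  split_ifs with hr
  · have hmem : ((p.1, (p.2 : ℤ) + r) : ℕ × ℤ) ∈ lagWindow k p := by
      simp [lagWindow, hr]
    refine Measurable.mono (comap_measurable (ε p.1 (p.2 + r))) ?_ le_rfl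
    exact le_iSup₂ (f := fun (q : ℕ × ℤ) (_ : q ∈ lagWindow k p) =>
      MeasurableSpace.comap (ε q.1 q.2) inferInstance) _ hmem
  · exact @measurable_const _ _ _ (_) _

end Coupling

/-! ### Sums over an approximately uniform design -/

section Design

lemma mul_sub_le_sub_of_gap {t : ℕ → ℝ} {N : ℕ} {g : ℝ} (hgap : ∀ k ≤ N, g ≤ t (k + 1) - t k)
    {j k : ℕ} (hjk : j ≤ k) (hk : k ≤ N + 1) : ((k : ℝ) - j) * g ≤ t k - t j := by
  induction k, hjk using Nat.le_induction with
  | base => simp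
  | succ k hjk ih =>
    have := ih (by omega)
    have := hgap k (by omega)
    push_cast
    linarith

/-- Points with gaps at least `g` are at most `(r - l) / g + 1` in number in `[l, r]`. -/
lemma card_filter_mem_Icc_le {t : ℕ → ℝ} {N : ℕ} {g : ℝ} (hg : 0 < g)
    (hgap : ∀ k ≤ N, g ≤ t (k + 1) - t k) {l r : ℝ} (hlr : l ≤ r) :
    (((Finset.range (N + 1)).filter fun k => t k ∈ Icc l r).card : ℝ) ≤ (r - l) / g + 1 := by
  set s := (Finset.range (N + 1)).filter fun k => t k ∈ Icc l r with hs
  rcases s.eq_empty_or_nonempty with h | h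
  · rw [h]
    simp only [Finset.card_empty, Nat.cast_zero]
    have : 0 ≤ (r - l) / g := div_nonneg (by linarith) hg.le
    linarith
  · have hm := s.min'_mem h
    have hM := s.max'_mem h
    set m := s.min' h
    set M := s.max' h
    have hmM : m ≤ M := s.min'_le _ hM
    have hsub : s ⊆ Finset.Icc m M := fun k hk =>
      Finset.mem_Icc.2 ⟨s.min'_le _ hk, s.le_max' _ hk⟩
    have hcard : (s.card : ℝ) ≤ (M : ℝ) - m + 1 := by
      have := Finset.card_le_card hsub
      rw [Nat.card_Icc] at this
      have h2 : s.card + m ≤ M + 1 := by omega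
      have h3 : (s.card : ℝ) + m ≤ M + 1 := by exact_mod_cast h2
      linarith
    rw [hs, Finset.mem_filter, Finset.mem_range] at hm hM
    have := mul_sub_le_sub_of_gap hgap hmM (by omega)
    have h4 : (M : ℝ) - m ≤ (r - l) / g := by
      rw [le_div_iff₀ hg]
      linarith [hm.2.1, hM.2.2]
    linarith

/-- Kernel-type sums over an approximately uniform design, compared with the integral: for a
Lipschitz function with compact support the error is bounded, because only `O(N β)` cells meet
the support and each contributes `O(1 / (N β))`. -/
lemma abs_sum_sub_integral_le {a b C Λ B M : ℝ} (hab : a < b) (hC : 0 ≤ C) (hΛ : 0 ≤ Λ)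
    (hB : 0 ≤ B) (hM : 0 < M) {φ : ℝ → ℝ} (hφL : ∀ x y, |φ x - φ y| ≤ Λ * |x - y|)
    (hφB : ∀ x, |φ x| ≤ B) (hφ0 : ∀ x, M ≤ |x| → φ x = 0) :
    ∃ D : ℝ, 0 ≤ D ∧ ∀ (N : ℕ) (t : ℕ → ℝ) (β u : ℝ), 0 < β → β ≤ 1 → 1 ≤ (N : ℝ) * β →
      2 * C / (b - a) ≤ N → t 0 = a → t (N + 1) = b →
      (∀ k ≤ N, |t (k + 1) - t k - (b - a) / N| ≤ C / (N : ℝ) ^ 2) →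
      a + M * β ≤ u → u ≤ b - M * β →
      |∑ k ∈ Finset.Icc 1 N, φ ((t k - u) / β) - (N * β) / (b - a) * ∫ v, φ v| ≤ D := by
  have hba : 0 < b - a := by linarith
  refine ⟨(4 * M / (b - a) + 13) * (3 * (b - a) * (3 * (b - a)) * Λ + C * B) / (b - a),
    by positivity, ?_⟩
  intro N t β u hβ hβ1 hNβ hNC ht0 htN hgap hau hub
  have hN : (0 : ℝ) < N := by
    by_contra hcon
    nlinarith
  set h : ℝ := (b - a) / N with hh
  have hhpos : 0 < h := by positivity
  have hCN : C / (N : ℝ) ^ 2 ≤ h / 2 := by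
    rw [hh, div_div, div_le_div_iff₀ (by positivity) (by positivity)]
    rw [div_le_iff₀ hba] at hNC
    nlinarith
  have hgl : ∀ k ≤ N, h / 2 ≤ t (k + 1) - t k := fun k hk => by
    have := (abs_le.1 (hgap k hk)).1; linarith
  have hgu : ∀ k ≤ N, t (k + 1) - t k ≤ 3 * h := fun k hk => by
    have := (abs_le.1 (hgap k hk)).2; linarith
  set ψ : ℝ → ℝ := fun y => φ ((y - u) / β) with hψ
  have hφc : Continuous φ := by
    refine (LipschitzWith.of_dist_le_mul (K := ⟨Λ, hΛ⟩) fun x y => ?_).continuous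
    exact hφL x y
  have hψc : Continuous ψ := by fun_prop
  have hψL : ∀ x y, |ψ x - ψ y| ≤ Λ / β * |x - y| := fun x y => by
    refine (hφL _ _).trans (le_of_eq ?_)
    rw [← sub_div, abs_div, abs_of_pos hβ]
    ring_nf
  have hψ0 : ∀ y, M * β ≤ |y - u| → ψ y = 0 := fun y hy => by
    refine hφ0 _ ?_
    rwa [abs_div, abs_of_pos hβ, le_div_iff₀ hβ]
  have hint : β * ∫ v, φ v = ∑ k ∈ Finset.range (N + 1), ∫ y in (t k)..(t (k + 1)), ψ y := by
    rw [intervalIntegral.sum_integral_adjacent_intervals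
      (fun k _ => hψc.intervalIntegrable _ _), ht0, htN]
    have h1 : ∫ y, ψ y = β * ∫ v, φ v := by
      have h2 : ∫ y, ψ y = ∫ y, φ (y / β) :=
        integral_sub_right_eq_self (fun y => φ (y / β)) u
      rw [h2, Measure.integral_comp_div, abs_of_pos hβ, smul_eq_mul]
    rw [← h1, intervalIntegral.integral_of_le hab.le]
    refine (setIntegral_eq_integral_of_forall_compl_eq_zero fun y hy => hψ0 y ?_).symm
    rw [mem_Ioc, not_and_or, not_lt, not_le] at hy
    rcases hy with hy | hy
    · rw [abs_of_nonpos (by nlinarith)]; linarith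
    · rw [abs_of_nonneg (by nlinarith)]; linarith
  set A := (Finset.range (N + 1)).filter fun k => t k ∈ Icc (u - M * β - 3 * h) (u + M * β)
    with hA
  have hcard : (A.card : ℝ) ≤ (4 * M / (b - a) + 13) * (N * β) := by
    have h1 := card_filter_mem_Icc_le (by positivity : 0 < h / 2) hgl
      (by nlinarith : u - M * β - 3 * h ≤ u + M * β)
    refine h1.trans ?_
    have h2 : (u + M * β - (u - M * β - 3 * h)) / (h / 2) = 4 * M / (b - a) * (N * β) + 6 := by
      rw [hh]; field_simp; ring
    rw [h2]
    nlinarith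
  have hcell : ∀ k ∈ Finset.range (N + 1), |(∫ y in (t k)..(t (k + 1)), ψ y) - h * ψ (t k)| ≤
      if k ∈ A then (3 * (b - a) * (3 * (b - a)) * Λ + C * B) / (N ^ 2 * β) else 0 := by
    intro k hk
    have hkN : k ≤ N := by simpa [Nat.lt_succ_iff] using hk
    have hle : t k ≤ t (k + 1) := by linarith [hgl k hkN]
    split_ifs with hkA
    · have e : (∫ y in (t k)..(t (k + 1)), ψ y) - h * ψ (t k) =
          (∫ y in (t k)..(t (k + 1)), (ψ y - ψ (t k))) + (t (k + 1) - t k - h) * ψ (t k) := by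
        rw [intervalIntegral.integral_sub (hψc.intervalIntegrable _ _)
          (intervalIntegrable_const), intervalIntegral.integral_const, smul_eq_mul]
        ring
      have h1 : ‖∫ y in (t k)..(t (k + 1)), (ψ y - ψ (t k))‖ ≤
          (Λ / β * (3 * h)) * |t (k + 1) - t k| := by
        refine intervalIntegral.norm_integral_le_of_norm_le_const fun y hy => ?_
        rw [uIoc_of_le hle] at hy
        refine (hψL _ _).trans (mul_le_mul_of_nonneg_left ?_ (by positivity))
        rw [abs_of_nonneg (by linarith [hy.1])]
        linarith [hy.2, hgu k hkN]
      have h2 : |(t (k + 1) - t k - h) * ψ (t k)| ≤ C / (N : ℝ) ^ 2 * B := by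
        rw [abs_mul]
        exact mul_le_mul (hgap k hkN) (hφB _) (abs_nonneg _) (by positivity)
      rw [abs_of_nonneg (by linarith : 0 ≤ t (k + 1) - t k), Real.norm_eq_abs] at h1
      have h3 : (Λ / β * (3 * h)) * (t (k + 1) - t k) ≤ (Λ / β * (3 * h)) * (3 * h) :=
        mul_le_mul_of_nonneg_left (hgu k hkN) (by positivity)
      have h4 : C / (N : ℝ) ^ 2 * B ≤ C * B / (N ^ 2 * β) := by
        rw [div_mul_eq_mul_div]
        refine div_le_div_of_nonneg_left (by positivity) (by positivity) ?_
        exact mul_le_of_le_one_right (by positivity) hβ1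
      have h5 : (Λ / β * (3 * h)) * (3 * h) = 3 * (b - a) * (3 * (b - a)) * Λ / (N ^ 2 * β) := by
        rw [hh]; field_simp
      rw [e, add_div]
      exact (abs_add_le _ _).trans (by linarith)
    · -- no point of the cell lies in the support
      have hout : ∀ y ∈ Icc (t k) (t (k + 1)), ψ y = 0 := by
        intro y hy
        refine hψ0 y ?_
        by_contra hcon
        rw [not_le, abs_lt] at hcon
        refine hkA (Finset.mem_filter.2 ⟨hk, ?_, ?_⟩)
        · linarith [hy.2, hgu k hkN, hcon.1]
        · linarith [hy.1, hcon.2]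
      rw [hout _ (left_mem_Icc.2 hle), intervalIntegral.integral_congr (g := fun _ => (0 : ℝ))]
      · simp
      · intro y hy
        rw [uIcc_of_le hle] at hy
        exact hout y hy
  have hsum : ∑ k ∈ Finset.Icc 1 N, ψ (t k) = ∑ k ∈ Finset.range (N + 1), ψ (t k) := by
    rw [Finset.range_eq_Ico, Finset.sum_eq_sum_Ico_succ_bot (by omega), ht0, hψ0 a]
    · rw [zero_add]; rfl
    · rw [abs_of_nonpos (by nlinarith)]; linarith
  have htot : |h * ∑ k ∈ Finset.Icc 1 N, ψ (t k) - β * ∫ v, φ v| ≤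
      A.card * ((3 * (b - a) * (3 * (b - a)) * Λ + C * B) / (N ^ 2 * β)) := by
    rw [hsum, hint, Finset.mul_sum, abs_sub_comm, ← Finset.sum_sub_distrib]
    refine (Finset.abs_sum_le_sum_abs _ _).trans ((Finset.sum_le_sum hcell).trans ?_)
    rw [← Finset.sum_filter, Finset.sum_const, nsmul_eq_mul]
    gcongr
    exact fun k hk => (Finset.mem_filter.1 hk).2
  have e : ∑ k ∈ Finset.Icc 1 N, ψ (t k) - (N * β) / (b - a) * ∫ v, φ v =
      (h * ∑ k ∈ Finset.Icc 1 N, ψ (t k) - β * ∫ v, φ v) / h := by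
    rw [hh]; field_simp
  rw [e, abs_div, abs_of_pos hhpos, div_le_iff₀ hhpos]
  refine htot.trans ((mul_le_mul_of_nonneg_right hcard (by positivity)).trans (le_of_eq ?_))
  rw [hh]; field_simp

end Design

/-! ### Sums over the observations -/

section ObsSums

/-- The index pairs `(i, j)`, `1 ≤ i ≤ n`, `1 ≤ j ≤ m n i`, as a finite set. -/
def obsFinset (m : ℕ → ℕ → ℕ) (n : ℕ) : Finset (ℕ × ℕ) :=
  (Finset.Icc 1 n).biUnion fun i => (Finset.Icc 1 (m n i)).image fun j => (i, j)

lemma mem_obsFinset {m : ℕ → ℕ → ℕ} {n : ℕ} {p : ℕ × ℕ} :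
    p ∈ obsFinset m n ↔ p.1 ∈ Finset.Icc 1 n ∧ p.2 ∈ Finset.Icc 1 (m n p.1) := by
  simp only [obsFinset, Finset.mem_biUnion, Finset.mem_image]
  constructor
  · rintro ⟨i, hi, j, hj, rfl⟩
    exact ⟨hi, hj⟩
  · rintro ⟨h1, h2⟩
    exact ⟨p.1, h1, p.2, h2, rfl⟩

lemma coe_obsFinset (m : ℕ → ℕ → ℕ) (n : ℕ) : (obsFinset m n : Set (ℕ × ℕ)) = obsIndex m n := by
  ext p
  rw [Finset.mem_coe, mem_obsFinset, Finset.mem_Icc, Finset.mem_Icc]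
  simp [obsIndex, and_assoc]

lemma sum_obs (m : ℕ → ℕ → ℕ) (n : ℕ) (f : ℕ → ℕ → ℝ) :
    ∑ i ∈ Finset.Icc 1 n, ∑ j ∈ Finset.Icc 1 (m n i), f i j =
      ∑ p ∈ obsFinset m n, f p.1 p.2 :=
  (Finset.sum_finset_product _ (Finset.Icc 1 n) (fun i => Finset.Icc 1 (m n i))
    (fun _ => mem_obsFinset) (f := fun p => f p.1 p.2)).symm

lemma card_obsFinset (m : ℕ → ℕ → ℕ) (n : ℕ) : (obsFinset m n).card = totalObs m n := by
  rw [Finset.card_eq_sum_ones,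
    Finset.sum_finset_product _ (Finset.Icc 1 n) (fun i => Finset.Icc 1 (m n i))
      (fun _ => mem_obsFinset) (f := fun _ => 1)]
  simp [totalObs]

/-- The pooled design, listed in increasing order, from which sums over observations are
sums over `1, …, N`. -/
lemma ApproxUniformDesign.exists_ordered {a b : ℝ} {m : ℕ → ℕ → ℕ}
    {x : ℕ → ℕ → ℕ → ℝ} (h : ApproxUniformDesign a b m x) (hN : Tendsto (totalObs m) atTop atTop) :
    ∃ C : ℝ, 0 ≤ C ∧ ∀ᶠ n : ℕ in atTop, 2 * C / (b - a) ≤ totalObs m n ∧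
      (∀ p ∈ obsFinset m n, x n p.1 p.2 ∈ Icc a b) ∧
      ∃ t : ℕ → ℝ, t 0 = a ∧ t (totalObs m n + 1) = b ∧
      (∀ k ≤ totalObs m n, |t (k + 1) - t k - (b - a) / totalObs m n| ≤
        C / (totalObs m n : ℝ) ^ 2) ∧
      ∀ f : ℝ → ℝ, ∑ p ∈ obsFinset m n, f (x n p.1 p.2) =
        ∑ k ∈ Finset.Icc 1 (totalObs m n), f (t k) := by
  obtain ⟨C, hC⟩ := h
  refine ⟨|C|, abs_nonneg _, ?_⟩
  have hN' : Tendsto (fun n => (totalObs m n : ℝ)) atTop atTop :=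
    tendsto_natCast_atTop_atTop.comp hN
  filter_upwards [hC, hN'.eventually_ge_atTop (2 * |C| / (b - a))] with n hn hnC
  obtain ⟨t, σ, hσ, hx, ht0, htN, hlt, hgap⟩ := hn
  have hmono : ∀ j k, j ≤ k → k ≤ totalObs m n + 1 → t j ≤ t k := fun j k hjk hk => by
    have := mul_sub_le_sub_of_gap (t := t) (g := 0) (N := totalObs m n)
      (fun k hk => by linarith [hlt k hk]) hjk hk
    linarith
  rw [← coe_obsFinset] at hσ hx
  refine ⟨hnC, fun p hp => ?_, t, ht0, htN, fun k hk => (hgap k hk).trans ?_, fun f => ?_⟩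
  · have h1 := hσ.mapsTo hp
    rw [hx p hp]
    exact ⟨ht0 ▸ hmono 0 _ (Nat.zero_le _) (h1.2.trans (Nat.le_succ _)),
      htN ▸ hmono _ _ (h1.2.trans (Nat.le_succ _)) le_rfl⟩
  · exact div_le_div_of_nonneg_right (le_abs_self C) (by positivity)
  · refine Finset.sum_bij (fun p _ => σ p) (fun p hp => ?_) (fun p hp q hq => hσ.injOn hp hq)
      (fun k hk => ?_) (fun p hp => by rw [hx p hp])
    · exact Finset.mem_Icc.2 (hσ.mapsTo hp)
    · obtain ⟨p, hp, hpk⟩ := hσ.surjOn (Finset.mem_Icc.1 hk : k ∈ Icc 1 (totalObs m n))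
      exact ⟨p, hp, hpk⟩

variable {a b : ℝ} {m : ℕ → ℕ → ℕ} {x : ℕ → ℕ → ℕ → ℝ} {β : ℕ → ℝ}

/-- Kernel-type sums over the observations equal `N β / (b - a) ∫ φ` up to a bounded error,
uniformly over locations away from the end points. -/
lemma ApproxUniformDesign.sum_eq_integral (hab : a < b) (h : ApproxUniformDesign a b m x)
    (hN : Tendsto (totalObs m) atTop atTop) (hβ_pos : ∀ n, 0 < β n) (hβ : Tendsto β atTop (𝓝 0))
    (hNβ : ∀ᶠ n in atTop, 1 ≤ (totalObs m n : ℝ) * β n) {δ : ℝ} (hδ : 0 < δ)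
    {φ : ℝ → ℝ} {Λ B M : ℝ} (hΛ : 0 ≤ Λ) (hB : 0 ≤ B) (hM : 0 < M)
    (hφL : ∀ x y, |φ x - φ y| ≤ Λ * |x - y|) (hφB : ∀ x, |φ x| ≤ B)
    (hφ0 : ∀ x, M ≤ |x| → φ x = 0) :
    ∃ D : ℝ, 0 ≤ D ∧ ∀ᶠ n in atTop, ∀ u ∈ Icc (a + δ) (b - δ),
      |∑ p ∈ obsFinset m n, φ ((x n p.1 p.2 - u) / β n)
        - (totalObs m n * β n) / (b - a) * ∫ v, φ v| ≤ D := by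
  obtain ⟨C, hC0, hC⟩ := h.exists_ordered hN
  obtain ⟨D, hD, hmain⟩ := abs_sum_sub_integral_le hab hC0 hΛ hB hM hφL hφB hφ0
  refine ⟨D, hD, ?_⟩
  have hMβ : Tendsto (fun n => M * β n) atTop (𝓝 0) := by simpa using hβ.const_mul M
  filter_upwards [hC, hNβ, hβ.eventually_le_const one_pos, hMβ.eventually_le_const hδ]
    with n hn h1 h2 h3 u hu
  obtain ⟨hnC, -, t, ht0, htN, hgap, hsum⟩ := hn
  rw [hsum fun y => φ ((y - u) / β n)]
  exact hmain _ t _ u (hβ_pos n) h2 h1 hnC ht0 htN hgap (by linarith [hu.1]) (by linarith [hu.2])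

/-- At most a constant times `N β` design points lie within distance `M β` of any given point. -/
lemma ApproxUniformDesign.card_near_le (hab : a < b) (h : ApproxUniformDesign a b m x)
    (hN : Tendsto (totalObs m) atTop atTop) (hβ_pos : ∀ n, 0 < β n)
    (hNβ : ∀ᶠ n in atTop, 1 ≤ (totalObs m n : ℝ) * β n) {M : ℝ} (hM : 0 < M) :
    ∃ D : ℝ, 0 < D ∧ ∀ᶠ n in atTop, ∀ u : ℝ,
      ∑ p ∈ obsFinset m n, (if |x n p.1 p.2 - u| ≤ M * β n then (1 : ℝ) else 0) ≤
        D * (totalObs m n * β n) := by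
  have hba : 0 < b - a := by linarith
  obtain ⟨C, hC0, hC⟩ := h.exists_ordered hN
  refine ⟨4 * M / (b - a) + 1, by positivity, ?_⟩
  filter_upwards [hC, hNβ] with n hn h1 u
  obtain ⟨hnC, -, t, ht0, htN, hgap, hsum⟩ := hn
  rw [hsum fun y => if |y - u| ≤ M * β n then (1 : ℝ) else 0]
  set N := totalObs m n
  have hβn := hβ_pos n
  have hNpos : (0 : ℝ) < N := by
    by_contra hcon
    nlinarith
  have hCN : C / (N : ℝ) ^ 2 ≤ (b - a) / N / 2 := by
    rw [div_div, div_le_div_iff₀ (by positivity) (by positivity)]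
    rw [div_le_iff₀ hba] at hnC
    nlinarith
  have hgl : ∀ k ≤ N, (b - a) / N / 2 ≤ t (k + 1) - t k := fun k hk => by
    have := (abs_le.1 (hgap k hk)).1; linarith
  have hMβ : 0 < M * β n := by positivity
  have hcard := card_filter_mem_Icc_le (by positivity) hgl
    (by linarith : u - M * β n ≤ u + M * β n)
  calc ∑ k ∈ Finset.Icc 1 N, (if |t k - u| ≤ M * β n then (1 : ℝ) else 0)
      ≤ ∑ k ∈ Finset.range (N + 1), (if |t k - u| ≤ M * β n then (1 : ℝ) else 0) := by
        refine Finset.sum_le_sum_of_subset_of_nonneg (fun k hk => ?_) fun k _ _ => ?_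
        · rw [Finset.mem_Icc] at hk
          exact Finset.mem_range.2 (by omega)
        · split_ifs <;> norm_num
    _ = (((Finset.range (N + 1)).filter fun k =>
          t k ∈ Icc (u - M * β n) (u + M * β n)).card : ℝ) := by
        rw [Finset.sum_boole]
        congr 2
        refine Finset.filter_congr fun k _ => ?_
        rw [abs_le, mem_Icc]
        constructor <;> rintro ⟨h1, h2⟩ <;> constructor <;> linarith
    _ ≤ _ := hcard
    _ = 4 * M / (b - a) * (N * β n) + 1 := by field_simp; ring
    _ ≤ _ := by linarith

end ObsSums

/-! ### Taylor expansion with one-sided derivatives -/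

section Taylor

/-- Integrating a bound `C |y - u|^k` on the derivative, without the factor `1 / (k + 1)`. -/
lemma abs_le_pow_succ_of_deriv {T : Set ℝ} (hT : Convex ℝ T) {R R' : ℝ → ℝ}
    (hR : ∀ y ∈ T, HasDerivWithinAt R (R' y) T y) {u x : ℝ} (hu : u ∈ T) (hx : x ∈ T)
    (h0 : R u = 0) {C : ℝ} {k : ℕ} (hb : ∀ y ∈ T, |R' y| ≤ C * |y - u| ^ k) :
    |R x| ≤ C * |x - u| ^ (k + 1) := by
  have hsub : uIcc u x ⊆ T := by
    rw [← segment_eq_uIcc]; exact hT.segment_subset hu hx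
  have hle : ∀ y ∈ uIcc u x, |y - u| ≤ |x - u| := fun y hy => by
    exact abs_sub_left_of_mem_uIcc hy
  have hC : ∀ y ∈ uIcc u x, ‖R' y‖ ≤ C * |x - u| ^ k := fun y hy => by
    rcases eq_or_ne x u with rfl | hne
    · rw [uIcc_self, mem_singleton_iff] at hy
      subst hy
      exact hb _ hx
    · have hC0 : 0 ≤ C := by
        have := (abs_nonneg _).trans (hb x hx)
        exact nonneg_of_mul_nonneg_left this (pow_pos (abs_pos.2 (sub_ne_zero.2 hne)) k)
      exact (hb y (hsub hy)).trans
        (mul_le_mul_of_nonneg_left (pow_le_pow_left₀ (abs_nonneg _) (hle y hy) k) hC0)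
  have := (convex_uIcc u x).norm_image_sub_le_of_norm_hasDerivWithin_le
    (fun y hy => (hR y (hsub hy)).mono hsub) hC left_mem_uIcc right_mem_uIcc
  rw [h0, sub_zero, Real.norm_eq_abs, Real.norm_eq_abs] at this
  rwa [pow_succ, ← mul_assoc]

/-- Third-order Taylor expansion, with a crude constant in the remainder; the derivatives are
supplied as a chain `f₀, f₁, f₂, f₃, f₄`. -/
lemma abs_sub_taylor_le {T : Set ℝ} (hT : Convex ℝ T) {f0 f1 f2 f3 f4 : ℝ → ℝ}
    (h0 : ∀ y ∈ T, HasDerivWithinAt f0 (f1 y) T y) (h1 : ∀ y ∈ T, HasDerivWithinAt f1 (f2 y) T y)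
    (h2 : ∀ y ∈ T, HasDerivWithinAt f2 (f3 y) T y) (h3 : ∀ y ∈ T, HasDerivWithinAt f3 (f4 y) T y)
    {C : ℝ} (hC : ∀ y ∈ T, |f4 y| ≤ C) {u x : ℝ} (hu : u ∈ T) (hx : x ∈ T) :
    |f0 x - (f0 u + f1 u * (x - u) + f2 u / 2 * (x - u) ^ 2 + f3 u / 6 * (x - u) ^ 3)| ≤
      C * (x - u) ^ 4 := by
  have hid : ∀ y, HasDerivWithinAt (fun y : ℝ => y - u) 1 T y := fun y =>
    (hasDerivWithinAt_id y T).sub_const u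
  have b3 : ∀ y ∈ T, |f3 y - f3 u| ≤ C * |y - u| ^ 1 := fun y hy =>
    abs_le_pow_succ_of_deriv hT (R := fun y => f3 y - f3 u) (R' := f4) (k := 0)
      (fun z hz => (h3 z hz).sub_const _) hu hy (sub_self _) (fun z hz => by simpa using hC z hz)
  have b2 : ∀ y ∈ T, |f2 y - (f2 u + f3 u * (y - u))| ≤ C * |y - u| ^ 2 := fun y hy =>
    abs_le_pow_succ_of_deriv hT (R := fun y => f2 y - (f2 u + f3 u * (y - u)))
      (R' := fun y => f3 y - f3 u) (k := 1)
      (fun z hz => by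
        refine ((h2 z hz).sub (((hid z).const_mul (f3 u)).const_add (f2 u))).congr_deriv ?_
        ring)
      hu hy (by simp) b3
  have b1 : ∀ y ∈ T, |f1 y - (f1 u + f2 u * (y - u) + f3 u / 2 * (y - u) ^ 2)| ≤
      C * |y - u| ^ 3 := fun y hy =>
    abs_le_pow_succ_of_deriv hT
      (R := fun y => f1 y - (f1 u + f2 u * (y - u) + f3 u / 2 * (y - u) ^ 2))
      (R' := fun y => f2 y - (f2 u + f3 u * (y - u))) (k := 2)
      (fun z hz => by
        refine ((h1 z hz).sub ((((hid z).const_mul (f2 u)).const_add (f1 u)).add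
          (((hid z).pow 2).const_mul (f3 u / 2)))).congr_deriv ?_
        push_cast; ring)
      hu hy (by simp) b2
  have b0 : |f0 x - (f0 u + f1 u * (x - u) + f2 u / 2 * (x - u) ^ 2 + f3 u / 6 * (x - u) ^ 3)| ≤
      C * |x - u| ^ 4 :=
    abs_le_pow_succ_of_deriv hT
      (R := fun y => f0 y - (f0 u + f1 u * (y - u) + f2 u / 2 * (y - u) ^ 2
        + f3 u / 6 * (y - u) ^ 3))
      (R' := fun y => f1 y - (f1 u + f2 u * (y - u) + f3 u / 2 * (y - u) ^ 2)) (k := 3)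
      (fun z hz => by
        refine ((h0 z hz).sub (((((hid z).const_mul (f1 u)).const_add (f0 u)).add
          (((hid z).pow 2).const_mul (f2 u / 2))).add
          (((hid z).pow 3).const_mul (f3 u / 6)))).congr_deriv ?_
        push_cast; ring)
      hu hx (by simp) b1
  rwa [show |x - u| ^ 4 = (x - u) ^ 4 from Even.pow_abs (by decide) _] at b0

lemma BoundedDerivs.hasDerivWithinAt {r : ℕ} {f : ℝ → ℝ} {T : Set ℝ} (h : BoundedDerivs r f T)
    {k : ℕ} (hk : k < r) {y : ℝ} (hy : y ∈ T) :
    HasDerivWithinAt (iteratedDerivWithin k f T) (iteratedDerivWithin (k + 1) f T y) T y := by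
  rw [iteratedDerivWithin_succ]
  exact (h.1 k hk y hy).hasDerivWithinAt

lemma BoundedDerivs.exists_taylor {f : ℝ → ℝ} {T : Set ℝ} (hT : Convex ℝ T)
    (h : BoundedDerivs 4 f T) :
    ∃ C : ℝ, ∀ u ∈ T, ∀ x ∈ T,
      |f x - (f u + iteratedDerivWithin 1 f T u * (x - u)
        + iteratedDerivWithin 2 f T u / 2 * (x - u) ^ 2
        + iteratedDerivWithin 3 f T u / 6 * (x - u) ^ 3)| ≤ C * (x - u) ^ 4 := by
  obtain ⟨C, hC⟩ := h.2 4 le_rfl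
  refine ⟨C, fun u hu x hx => ?_⟩
  have := abs_sub_taylor_le hT (fun y hy => h.hasDerivWithinAt (k := 0) (by norm_num) hy)
    (fun y hy => h.hasDerivWithinAt (k := 1) (by norm_num) hy)
    (fun y hy => h.hasDerivWithinAt (k := 2) (by norm_num) hy)
    (fun y hy => h.hasDerivWithinAt (k := 3) (by norm_num) hy) hC hu hx
  simpa only [iteratedDerivWithin_zero] using this

end Taylor

/-! ### Calculus of uniform third-order expansions -/

section Jets

open Asymptotics

/-- A uniform third-order expansion of `g (u, t)` in powers of `t`, over the parameter set `D`:
the coefficients are bounded functions of `u`, and the remainder is `O(t⁴)` uniformly on `D`. -/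
structure IsJet (D : Set (ℝ × ℝ)) (g : ℝ × ℝ → ℝ) (c0 c1 c2 c3 : ℝ → ℝ) : Prop where
  bdd0 : (fun p : ℝ × ℝ => c0 p.1) =O[𝓟 D] fun _ => (1 : ℝ)
  bdd1 : (fun p : ℝ × ℝ => c1 p.1) =O[𝓟 D] fun _ => (1 : ℝ)
  bdd2 : (fun p : ℝ × ℝ => c2 p.1) =O[𝓟 D] fun _ => (1 : ℝ)
  bdd3 : (fun p : ℝ × ℝ => c3 p.1) =O[𝓟 D] fun _ => (1 : ℝ)
  rem : (fun p => g p - (c0 p.1 + c1 p.1 * p.2 + c2 p.1 * p.2 ^ 2 + c3 p.1 * p.2 ^ 3))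
    =O[𝓟 D] fun p => p.2 ^ 4

variable {D : Set (ℝ × ℝ)}

lemma isBigO_one_mul {l : Filter (ℝ × ℝ)} {f g : ℝ × ℝ → ℝ} (hf : f =O[l] fun _ => (1 : ℝ))
    (hg : g =O[l] fun _ => (1 : ℝ)) : (fun p => f p * g p) =O[l] fun _ => (1 : ℝ) := by
  simpa using hf.mul hg

lemma isBigO_pow_mul_bdd {l : Filter (ℝ × ℝ)} {f g h : ℝ × ℝ → ℝ} (hf : f =O[l] h)
    (hg : g =O[l] fun _ => (1 : ℝ)) : (fun p => f p * g p) =O[l] h := by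
  simpa using hf.mul hg

namespace IsJet

variable {g g' : ℝ × ℝ → ℝ} {c0 c1 c2 c3 d0 d1 d2 d3 : ℝ → ℝ}

lemma poly (b0 : (fun p : ℝ × ℝ => c0 p.1) =O[𝓟 D] fun _ => (1 : ℝ))
    (b1 : (fun p : ℝ × ℝ => c1 p.1) =O[𝓟 D] fun _ => (1 : ℝ))
    (b2 : (fun p : ℝ × ℝ => c2 p.1) =O[𝓟 D] fun _ => (1 : ℝ))
    (b3 : (fun p : ℝ × ℝ => c3 p.1) =O[𝓟 D] fun _ => (1 : ℝ)) :
    IsJet D (fun p => c0 p.1 + c1 p.1 * p.2 + c2 p.1 * p.2 ^ 2 + c3 p.1 * p.2 ^ 3) c0 c1 c2 c3 :=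
  ⟨b0, b1, b2, b3, by simpa using isBigO_zero _ _⟩

lemma poly_bdd (hD : (fun p : ℝ × ℝ => p.2) =O[𝓟 D] fun _ => (1 : ℝ)) (h : IsJet D g c0 c1 c2 c3) :
    (fun p : ℝ × ℝ => c0 p.1 + c1 p.1 * p.2 + c2 p.1 * p.2 ^ 2 + c3 p.1 * p.2 ^ 3)
      =O[𝓟 D] fun _ => (1 : ℝ) := by
  have h2 := hD.pow 2
  have h3 := hD.pow 3
  simp only [one_pow] at h2 h3
  exact ((h.bdd0.add (isBigO_one_mul h.bdd1 hD)).add (isBigO_one_mul h.bdd2 h2)).add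
    (isBigO_one_mul h.bdd3 h3)

lemma bdd (hD : (fun p : ℝ × ℝ => p.2) =O[𝓟 D] fun _ => (1 : ℝ)) (h : IsJet D g c0 c1 c2 c3) :
    g =O[𝓟 D] fun _ => (1 : ℝ) := by
  have h4 := hD.pow 4
  simp only [one_pow] at h4
  have := (h.rem.trans h4).add (h.poly_bdd hD)
  simpa using this

lemma add (h : IsJet D g c0 c1 c2 c3) (h' : IsJet D g' d0 d1 d2 d3) :
    IsJet D (fun p => g p + g' p) (fun u => c0 u + d0 u) (fun u => c1 u + d1 u)
      (fun u => c2 u + d2 u) (fun u => c3 u + d3 u) :=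
  ⟨h.bdd0.add h'.bdd0, h.bdd1.add h'.bdd1, h.bdd2.add h'.bdd2, h.bdd3.add h'.bdd3,
    (h.rem.add h'.rem).congr_left fun p => by ring⟩

lemma const_mul (a : ℝ) (h : IsJet D g c0 c1 c2 c3) :
    IsJet D (fun p => a * g p) (fun u => a * c0 u) (fun u => a * c1 u)
      (fun u => a * c2 u) (fun u => a * c3 u) :=
  ⟨h.bdd0.const_mul_left a, h.bdd1.const_mul_left a, h.bdd2.const_mul_left a,
    h.bdd3.const_mul_left a, (h.rem.const_mul_left a).congr_left fun p => by ring⟩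

lemma mul (hD : (fun p : ℝ × ℝ => p.2) =O[𝓟 D] fun _ => (1 : ℝ))
    (h : IsJet D g c0 c1 c2 c3) (h' : IsJet D g' d0 d1 d2 d3) :
    IsJet D (fun p => g p * g' p) (fun u => c0 u * d0 u) (fun u => c0 u * d1 u + c1 u * d0 u)
      (fun u => c0 u * d2 u + c1 u * d1 u + c2 u * d0 u)
      (fun u => c0 u * d3 u + c1 u * d2 u + c2 u * d1 u + c3 u * d0 u) := by
  have m {f f' : ℝ × ℝ → ℝ} (hf : f =O[𝓟 D] fun _ => (1 : ℝ)) (hf' : f' =O[𝓟 D] fun _ => (1 : ℝ)) :=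
    isBigO_one_mul hf hf'
  refine ⟨m h.bdd0 h'.bdd0, (m h.bdd0 h'.bdd1).add (m h.bdd1 h'.bdd0),
    ((m h.bdd0 h'.bdd2).add (m h.bdd1 h'.bdd1)).add (m h.bdd2 h'.bdd0),
    (((m h.bdd0 h'.bdd3).add (m h.bdd1 h'.bdd2)).add (m h.bdd2 h'.bdd1)).add
      (m h.bdd3 h'.bdd0), ?_⟩
  have h2 := hD.pow 2
  simp only [one_pow] at h2
  have hE : (fun p : ℝ × ℝ => (c1 p.1 * d3 p.1 + c2 p.1 * d2 p.1 + c3 p.1 * d1 p.1)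
      + (c2 p.1 * d3 p.1 + c3 p.1 * d2 p.1) * p.2 + c3 p.1 * d3 p.1 * p.2 ^ 2)
      =O[𝓟 D] fun _ => (1 : ℝ) :=
    ((((m h.bdd1 h'.bdd3).add (m h.bdd2 h'.bdd2)).add (m h.bdd3 h'.bdd1)).add
      (m ((m h.bdd2 h'.bdd3).add (m h.bdd3 h'.bdd2)) hD)).add (m (m h.bdd3 h'.bdd3) h2)
  have r1 := isBigO_pow_mul_bdd h.rem (h'.bdd hD)
  have r2 := isBigO_pow_mul_bdd h'.rem (h.poly_bdd hD)
  have r3 := isBigO_pow_mul_bdd (isBigO_refl (fun p : ℝ × ℝ => p.2 ^ 4) (𝓟 D)) hE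
  exact ((r1.add r2).add r3).congr_left fun p => by ring

lemma congr (h : IsJet D g c0 c1 c2 c3) (hg : ∀ p ∈ D, g p = g' p)
    (h0 : ∀ p ∈ D, c0 p.1 = d0 p.1) (h1 : ∀ p ∈ D, c1 p.1 = d1 p.1)
    (h2 : ∀ p ∈ D, c2 p.1 = d2 p.1) : IsJet D g' d0 d1 d2 c3 := by
  have e {f f' : ℝ × ℝ → ℝ} (hf : ∀ p ∈ D, f p = f' p) : f =ᶠ[𝓟 D] f' :=
    eventually_principal.2 hf
  refine ⟨h.bdd0.congr' (e h0) (e fun _ _ => rfl), h.bdd1.congr' (e h1) (e fun _ _ => rfl),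
    h.bdd2.congr' (e h2) (e fun _ _ => rfl), h.bdd3,
    h.rem.congr' (e fun p hp => ?_) (e fun _ _ => rfl)⟩
  rw [hg p hp, h0 p hp, h1 p hp, h2 p hp]

lemma of_sub (h : IsJet D g c0 c1 c2 c3)
    (hg : (fun p => g' p - g p) =O[𝓟 D] fun p => p.2 ^ 4) : IsJet D g' c0 c1 c2 c3 :=
  ⟨h.bdd0, h.bdd1, h.bdd2, h.bdd3, (hg.add h.rem).congr_left fun p => by ring⟩

/-- The reciprocal of a function bounded away from zero; the leading coefficient is then
invertible as well. -/
lemma inv (hD : (fun p : ℝ × ℝ => p.2) =O[𝓟 D] fun _ => (1 : ℝ))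
    (h : IsJet D g c0 c1 c2 c3) (hg : ∀ p ∈ D, g p ≠ 0)
    (hgi : (fun p => (g p)⁻¹) =O[𝓟 D] fun _ => (1 : ℝ)) (hc : ∀ p ∈ D, c0 p.1 ≠ 0)
    (hci : (fun p : ℝ × ℝ => (c0 p.1)⁻¹) =O[𝓟 D] fun _ => (1 : ℝ)) :
    ∃ r2 r3 : ℝ → ℝ, IsJet D (fun p => (g p)⁻¹) (fun u => (c0 u)⁻¹)
      (fun u => -(c1 u * (c0 u)⁻¹ * (c0 u)⁻¹)) r2 r3 := by
  set r1 : ℝ → ℝ := fun u => -(c1 u * (c0 u)⁻¹ * (c0 u)⁻¹) with hr1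
  set r2 : ℝ → ℝ := fun u => -((c1 u * r1 u + c2 u * (c0 u)⁻¹) * (c0 u)⁻¹) with hr2
  set r3 : ℝ → ℝ := fun u => -((c1 u * r2 u + c2 u * r1 u + c3 u * (c0 u)⁻¹) * (c0 u)⁻¹) with hr3
  have b1 : (fun p : ℝ × ℝ => r1 p.1) =O[𝓟 D] fun _ => (1 : ℝ) :=
    (isBigO_one_mul (isBigO_one_mul h.bdd1 hci) hci).neg_left
  have b2 : (fun p : ℝ × ℝ => r2 p.1) =O[𝓟 D] fun _ => (1 : ℝ) :=
    (isBigO_one_mul ((isBigO_one_mul h.bdd1 b1).add (isBigO_one_mul h.bdd2 hci)) hci).neg_left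
  have b3 : (fun p : ℝ × ℝ => r3 p.1) =O[𝓟 D] fun _ => (1 : ℝ) :=
    (isBigO_one_mul (((isBigO_one_mul h.bdd1 b2).add (isBigO_one_mul h.bdd2 b1)).add
      (isBigO_one_mul h.bdd3 hci)) hci).neg_left
  refine ⟨r2, r3, hci, b1, b2, b3, ?_⟩
  have hprod := (h.mul hD (poly (c0 := fun u => (c0 u)⁻¹) hci b1 b2 b3)).rem
  have := isBigO_pow_mul_bdd hprod.neg_left hgi
  refine this.congr' (eventually_principal.2 fun p hp => ?_) EventuallyEq.rfl
  have hgp := hg p hp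
  have hcp := hc p hp
  have e0 : c0 p.1 * (c0 p.1)⁻¹ = 1 := mul_inv_cancel₀ hcp
  have e1 : c0 p.1 * r1 p.1 + c1 p.1 * (c0 p.1)⁻¹ = 0 := by
    rw [hr1]; dsimp only; field_simp; ring
  have e2 : c0 p.1 * r2 p.1 + c1 p.1 * r1 p.1 + c2 p.1 * (c0 p.1)⁻¹ = 0 := by
    rw [hr2]; dsimp only; field_simp; ring
  have e3 : c0 p.1 * r3 p.1 + c1 p.1 * r2 p.1 + c2 p.1 * r1 p.1 + c3 p.1 * (c0 p.1)⁻¹ = 0 := by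
    rw [hr3]; dsimp only; field_simp; ring
  dsimp only
  rw [e0, e1, e2, e3]
  field_simp
  ring

/-- Composition with a function that has a fourth-order expansion at `0`. -/
lemma comp (hD : (fun p : ℝ × ℝ => p.2) =O[𝓟 D] fun _ => (1 : ℝ))
    {h : ℝ × ℝ → ℝ} {h1 h2 h3 : ℝ → ℝ} (hh : IsJet D h (fun _ => 0) h1 h2 h3)
    {Φ : ℝ → ℝ} {φ0 φ1 φ2 φ3 C : ℝ}
    (hΦ : ∀ y, |Φ y - (φ0 + φ1 * y + φ2 * y ^ 2 + φ3 * y ^ 3)| ≤ C * y ^ 4) :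
    ∃ e3 : ℝ → ℝ, IsJet D (fun p => Φ (h p)) (fun _ => φ0) (fun u => φ1 * h1 u)
      (fun u => φ1 * h2 u + φ2 * h1 u ^ 2) e3 := by
  have hc : ∀ c : ℝ, (fun _ : ℝ × ℝ => c) =O[𝓟 D] fun _ => (1 : ℝ) := fun c =>
    isBigO_const_const c one_ne_zero _
  have j2 := hh.mul hD hh
  have j3 := j2.mul hD hh
  have j0 := poly (D := D) (c0 := fun _ => φ0) (c1 := fun _ => 0) (c2 := fun _ => 0)
    (c3 := fun _ => 0) (hc _) (hc _) (hc _) (hc _)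
  have j := ((j0.add (hh.const_mul φ1)).add (j2.const_mul φ2)).add (j3.const_mul φ3)
  have hht : h =O[𝓟 D] fun p => p.2 := by
    have e1 : (fun p : ℝ × ℝ => p.2 ^ 4) =O[𝓟 D] fun p => p.2 := by
      have := hD.pow 3
      simp only [one_pow] at this
      exact (isBigO_pow_mul_bdd (isBigO_refl (fun p : ℝ × ℝ => p.2) _) this).congr_left
        fun p => by ring
    have e2 : (fun p : ℝ × ℝ => h1 p.1 + h2 p.1 * p.2 + h3 p.1 * p.2 ^ 2) =O[𝓟 D]
        fun _ => (1 : ℝ) := by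
      have := hD.pow 2
      simp only [one_pow] at this
      exact (hh.bdd1.add (isBigO_one_mul hh.bdd2 hD)).add (isBigO_one_mul hh.bdd3 this)
    have e3 := isBigO_pow_mul_bdd (isBigO_refl (fun p : ℝ × ℝ => p.2) (𝓟 D)) e2
    exact ((hh.rem.trans e1).add e3).congr_left fun p => by ring
  have hrem : (fun p => Φ (h p) - (φ0 + φ1 * h p + φ2 * h p ^ 2 + φ3 * h p ^ 3)) =O[𝓟 D]
      fun p => p.2 ^ 4 := by
    refine IsBigO.trans (IsBigO.of_bound C (Eventually.of_forall fun p => ?_)) (hht.pow 4)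
    rw [Real.norm_eq_abs, Real.norm_eq_abs, abs_of_nonneg (by positivity : 0 ≤ h p ^ 4)]
    exact hΦ _
  have j' := j.of_sub (g' := fun p => Φ (h p)) (hrem.congr_left fun p => by ring)
  exact ⟨_, j'.congr (fun _ _ => rfl) (fun _ _ => by ring) (fun _ _ => by ring)
    fun _ _ => by ring⟩

/-- Forgetting the two highest orders. -/
lemma rem_two (hD : (fun p : ℝ × ℝ => p.2) =O[𝓟 D] fun _ => (1 : ℝ)) (h : IsJet D g c0 c1 c2 c3) :
    (fun p => g p - (c0 p.1 + c1 p.1 * p.2)) =O[𝓟 D] fun p => p.2 ^ 2 := by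
  have h2 := hD.pow 2
  simp only [one_pow] at h2
  have e1 : (fun p : ℝ × ℝ => p.2 ^ 4) =O[𝓟 D] fun p => p.2 ^ 2 :=
    (isBigO_pow_mul_bdd (isBigO_refl (fun p : ℝ × ℝ => p.2 ^ 2) _) h2).congr_left
      fun p => by ring
  have e2 := isBigO_pow_mul_bdd (isBigO_refl (fun p : ℝ × ℝ => p.2 ^ 2) (𝓟 D))
    (h.bdd2.add (isBigO_one_mul h.bdd3 hD))
  exact ((h.rem.trans e1).add e2).congr_left fun p => by ring

end IsJet

end Jets

/-! ### Expansion of the distribution function of a response -/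

section Expansion

open Asymptotics

lemma isBigO_one_of_abs_le {D : Set (ℝ × ℝ)} {f : ℝ × ℝ → ℝ} {C : ℝ} (h : ∀ p ∈ D, |f p| ≤ C) :
    f =O[𝓟 D] fun _ => (1 : ℝ) :=
  IsBigO.of_bound C (eventually_principal.2 fun p hp => by simpa using h p hp)

lemma exists_abs_le_of_isBigO_one {D : Set (ℝ × ℝ)} {f : ℝ × ℝ → ℝ}
    (h : f =O[𝓟 D] fun _ => (1 : ℝ)) : ∃ C : ℝ, ∀ p ∈ D, |f p| ≤ C := by
  obtain ⟨C, hC⟩ := isBigO_principal.1 h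
  exact ⟨C, fun p hp => by simpa using hC p hp⟩

/-- Pairs `(u, t)` with `u` interior and `u + t` in `[a, b]`. -/
def offsetDomain (a b : ℝ) : Set (ℝ × ℝ) := {p | p.1 ∈ Ioo a b ∧ p.1 + p.2 ∈ Icc a b}

lemma offset_bdd (a b : ℝ) :
    (fun p : ℝ × ℝ => p.2) =O[𝓟 (offsetDomain a b)] fun _ => (1 : ℝ) := by
  refine isBigO_one_of_abs_le (C := b - a) fun p hp => ?_
  obtain ⟨⟨h1, h2⟩, h3, h4⟩ := hp
  rw [abs_le]; constructor <;> linarith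

lemma BoundedDerivs.isJet {f : ℝ → ℝ} {a b : ℝ} (h : BoundedDerivs 4 f (Icc a b)) :
    IsJet (offsetDomain a b) (fun p => f (p.1 + p.2)) f (iteratedDerivWithin 1 f (Icc a b))
      (fun u => iteratedDerivWithin 2 f (Icc a b) u / 2)
      (fun u => iteratedDerivWithin 3 f (Icc a b) u / 6) := by
  have hb : ∀ k ≤ 4, (fun p : ℝ × ℝ => iteratedDerivWithin k f (Icc a b) p.1)
      =O[𝓟 (offsetDomain a b)] fun _ => (1 : ℝ) := fun k hk => by
    obtain ⟨C, hC⟩ := h.2 k hk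
    exact isBigO_one_of_abs_le fun p hp => hC _ (Ioo_subset_Icc_self hp.1)
  obtain ⟨C, hC⟩ := h.exists_taylor (convex_Icc a b)
  refine ⟨by simpa using hb 0 (by norm_num), hb 1 (by norm_num), ?_, ?_, ?_⟩
  · exact ((hb 2 (by norm_num)).const_mul_left 2⁻¹).congr_left fun p => by ring
  · exact ((hb 3 (by norm_num)).const_mul_left 6⁻¹).congr_left fun p => by ring
  · refine IsBigO.of_bound C (eventually_principal.2 fun p hp => ?_)
    have := hC p.1 (Ioo_subset_Icc_self hp.1) (p.1 + p.2) hp.2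
    rw [add_sub_cancel_left] at this
    rwa [Real.norm_eq_abs, Real.norm_eq_abs, abs_of_nonneg (by positivity : 0 ≤ p.2 ^ 4)]

/-- In the interior the first two one-sided derivatives are the ordinary ones. -/
lemma iteratedDerivWithin_Icc_eq {f : ℝ → ℝ} {a b u : ℝ} (hu : u ∈ Ioo a b) :
    iteratedDerivWithin 1 f (Icc a b) u = deriv f u ∧
      iteratedDerivWithin 2 f (Icc a b) u = deriv (deriv f) u := by
  have h1 : ∀ y ∈ Ioo a b, iteratedDerivWithin 1 f (Icc a b) y = deriv f y := fun y hy => by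
    rw [iteratedDerivWithin_one, derivWithin_of_mem_nhds (Icc_mem_nhds hy.1 hy.2)]
  refine ⟨h1 u hu, ?_⟩
  rw [iteratedDerivWithin_succ, derivWithin_of_mem_nhds (Icc_mem_nhds hu.1 hu.2)]
  refine Filter.EventuallyEq.deriv_eq ?_
  filter_upwards [isOpen_Ioo.mem_nhds hu] with y hy using h1 y hy

/-- The distribution function of `(μ(u) + d - μ(x)) / s(x)`, as `x` moves away from `u` and `d`
away from `0`. The coefficient of `(x - u)²` carries the bias `ρ_μ`; those of the odd powers do
not matter, being annihilated by the symmetry of the kernel. -/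
lemma exists_expansion {a b : ℝ} {μ s fe F : ℝ → ℝ}
    (hμ : BoundedDerivs 4 μ (Icc a b)) (hs : BoundedDerivs 4 s (Icc a b))
    (hs_pos : ∃ c : ℝ, 0 < c ∧ ∀ u ∈ Icc a b, c ≤ s u)
    (hF : ∀ y, HasDerivAt F (fe y) y) (hfe : BoundedDerivs 4 fe univ)
    (hF0 : F 0 = 1 / 2) (hfe0 : 0 < fe 0) :
    ∃ C : ℝ, 0 ≤ C ∧ ∃ c1 c2 c3 e1 : ℝ → ℝ, ∀ u ∈ Ioo a b,
      |c1 u| ≤ C ∧ |c2 u| ≤ C ∧ |c3 u| ≤ C ∧ |e1 u| ≤ C ∧ |fe 0 / s u| ≤ C ∧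
      c2 u = -(fe 0 / (2 * s u)) * rhoMu μ s fe u ∧
      ∀ x ∈ Icc a b, ∀ d : ℝ,
        |F ((μ u + d - μ x) / s x) - 1 / 2 - (c1 u * (x - u) + c2 u * (x - u) ^ 2
          + c3 u * (x - u) ^ 3 + d * (fe 0 / s u + e1 u * (x - u)))| ≤
        C * ((x - u) ^ 4 + |d| * (x - u) ^ 2 + d ^ 2) := by
  obtain ⟨c, hc, hsc⟩ := hs_pos
  set D := offsetDomain a b with hDdef
  have hD := offset_bdd a b
  have jμ := hμ.isJet
  have js := hs.isJet
  have hsx : ∀ p ∈ D, c ≤ s (p.1 + p.2) := fun p hp => hsc _ hp.2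
  have hsu : ∀ p ∈ D, c ≤ s p.1 := fun p hp => hsc _ (Ioo_subset_Icc_self hp.1)
  have hinv : ∀ y, c ≤ y → |y⁻¹| ≤ c⁻¹ := fun y hy => by
    rw [abs_of_pos (inv_pos.2 (hc.trans_le hy))]
    exact inv_anti₀ hc hy
  obtain ⟨r2, r3, jr⟩ := js.inv hD (fun p hp => (hc.trans_le (hsx p hp)).ne')
    (isBigO_one_of_abs_le fun p hp => hinv _ (hsx p hp))
    (fun p hp => (hc.trans_le (hsu p hp)).ne')
    (isBigO_one_of_abs_le fun p hp => hinv _ (hsu p hp))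
  -- the standardised increment `(μ(u) - μ(u + t)) / s(u + t)`
  have j0 : (fun _ : ℝ × ℝ => (0 : ℝ)) =O[𝓟 D] fun _ => (1 : ℝ) := isBigO_zero _ _
  have jA := (IsJet.poly (D := D) (c0 := μ) (c1 := fun _ => 0) (c2 := fun _ => 0)
    (c3 := fun _ => 0) jμ.bdd0 j0 j0 j0).add (jμ.const_mul (-1))
  have jh' := (jA.mul hD jr).congr (g' := fun p => (μ p.1 - μ (p.1 + p.2)) / s (p.1 + p.2))
    (d0 := fun _ => 0) (d1 := fun u => -deriv μ u / s u)
    (d2 := fun u => -deriv (deriv μ) u / (2 * s u) + deriv μ u * deriv s u / s u ^ 2)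
    (fun p _ => by rw [div_eq_mul_inv]; ring) (fun p _ => by ring)
    (fun p hp => by
      rw [(iteratedDerivWithin_Icc_eq (f := μ) hp.1).1, div_eq_mul_inv]; ring)
    (fun p hp => by
      rw [(iteratedDerivWithin_Icc_eq (f := μ) hp.1).1,
        (iteratedDerivWithin_Icc_eq (f := s) hp.1).1,
        (iteratedDerivWithin_Icc_eq (f := μ) hp.1).2]
      have := (hc.trans_le (hsu p hp)).ne'
      field_simp; ring)
  -- expansions of `F` and of its density at `0`
  have hfed : ∀ k < 4, ∀ y, HasDerivWithinAt (iteratedDerivWithin k fe univ)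
      (iteratedDerivWithin (k + 1) fe univ y) univ y := fun k hk y =>
    hfe.hasDerivWithinAt hk (mem_univ y)
  obtain ⟨C3, hC3⟩ := hfe.2 3 (by norm_num)
  have hfe1 : iteratedDerivWithin 1 fe univ 0 = deriv fe 0 := by
    rw [iteratedDerivWithin_univ, iteratedDeriv_one]
  have tF : ∀ y, |F y - (1 / 2 + fe 0 * y + deriv fe 0 / 2 * y ^ 2
      + iteratedDerivWithin 2 fe univ 0 / 6 * y ^ 3)| ≤ C3 * y ^ 4 := fun y => by
    have := abs_sub_taylor_le convex_univ (f0 := F) (f1 := iteratedDerivWithin 0 fe univ)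
      (fun z _ => by rw [iteratedDerivWithin_zero]; exact (hF z).hasDerivWithinAt)
      (fun z _ => hfed 0 (by norm_num) z) (fun z _ => hfed 1 (by norm_num) z)
      (fun z _ => hfed 2 (by norm_num) z) hC3 (mem_univ 0) (mem_univ y)
    rw [hF0, zero_add, hfe1, iteratedDerivWithin_zero, sub_zero] at this
    exact this
  obtain ⟨C4, hC4⟩ := hfe.exists_taylor convex_univ
  have tf : ∀ y, |fe y - (fe 0 + deriv fe 0 * y + iteratedDerivWithin 2 fe univ 0 / 2 * y ^ 2
      + iteratedDerivWithin 3 fe univ 0 / 6 * y ^ 3)| ≤ C4 * y ^ 4 := fun y => by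
    have := hC4 0 (mem_univ _) y (mem_univ _)
    rwa [sub_zero, hfe1] at this
  obtain ⟨g3, jF⟩ := jh'.comp hD tF
  obtain ⟨k3, jf⟩ := jh'.comp hD tf
  have jfs := (jf.mul hD jr).rem_two hD
  -- the second-order remainder of `F`, uniform over the line
  obtain ⟨C1, hC1⟩ := hfe.2 1 (by norm_num)
  have tF2 : ∀ y e : ℝ, |F (y + e) - F y - fe y * e| ≤ C1 * e ^ 2 := fun y e => by
    have b1 : ∀ z ∈ (univ : Set ℝ), |fe z - fe y| ≤ C1 * |z - y| ^ 1 := fun z _ =>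
      abs_le_pow_succ_of_deriv convex_univ (R := fun z => fe z - fe y)
        (R' := iteratedDerivWithin 1 fe univ) (k := 0)
        (fun w _ => by
          have := hfed 0 (by norm_num) w
          rw [iteratedDerivWithin_zero] at this
          exact this.sub_const _) (mem_univ y) (mem_univ z) (sub_self _)
        (fun w hw => by simpa using hC1 w hw)
    have := abs_le_pow_succ_of_deriv convex_univ
      (R := fun z => F z - F y - fe y * (z - y)) (R' := fun z => fe z - fe y) (k := 1)
      (fun w _ => ((((hF w).hasDerivWithinAt).sub_const _).sub
        (((hasDerivWithinAt_id w univ).sub_const y).const_mul (fe y))).congr_deriv (by ring))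
      (mem_univ y) (mem_univ (y + e)) (by simp) b1
    simpa using this
  obtain ⟨B1, hB1⟩ := exists_abs_le_of_isBigO_one jF.bdd1
  obtain ⟨B2, hB2⟩ := exists_abs_le_of_isBigO_one jF.bdd2
  obtain ⟨B3, hB3⟩ := exists_abs_le_of_isBigO_one jF.bdd3
  obtain ⟨B4, hB4⟩ := exists_abs_le_of_isBigO_one (jf.mul hD jr).bdd1
  obtain ⟨R1, hR1⟩ := isBigO_principal.1 jF.rem
  obtain ⟨R2, hR2⟩ := isBigO_principal.1 jfs
  have hC1' : 0 ≤ C1 := (abs_nonneg _).trans (hC1 0 (mem_univ _))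
  set C := |B1| + |B2| + |B3| + |B4| + fe 0 / c + |R1| + |R2| + C1 / c ^ 2 with hCdef
  have hfc : 0 < fe 0 / c := by positivity
  have hCc : 0 ≤ C1 / c ^ 2 := by positivity
  have n1 := abs_nonneg B1
  have n2 := abs_nonneg B2
  have n3 := abs_nonneg B3
  have n4 := abs_nonneg B4
  have n5 := abs_nonneg R1
  have n6 := abs_nonneg R2
  refine ⟨C, by positivity, fun u => fe 0 * (-deriv μ u / s u),
    fun u => fe 0 * (-deriv (deriv μ) u / (2 * s u) + deriv μ u * deriv s u / s u ^ 2)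
      + deriv fe 0 / 2 * (-deriv μ u / s u) ^ 2, g3,
    fun u => fe 0 * -(iteratedDerivWithin 1 s (Icc a b) u * (s u)⁻¹ * (s u)⁻¹)
      + deriv fe 0 * (-deriv μ u / s u) * (s u)⁻¹, fun u hu => ?_⟩
  have huc : c ≤ s u := hsc u (Ioo_subset_Icc_self hu)
  have hupos : 0 < s u := hc.trans_le huc
  have hu0 : ((u, 0) : ℝ × ℝ) ∈ D := ⟨hu, by simpa using Ioo_subset_Icc_self hu⟩
  refine ⟨(hB1 _ hu0).trans (by linarith [le_abs_self B1]),
    (hB2 _ hu0).trans (by linarith [le_abs_self B2]),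
    (hB3 _ hu0).trans (by linarith [le_abs_self B3]),
    (hB4 _ hu0).trans (by linarith [le_abs_self B4]), ?_, ?_, ?_⟩
  · rw [abs_of_pos (by positivity)]
    have : fe 0 / s u ≤ fe 0 / c := div_le_div_of_nonneg_left hfe0.le hc huc
    linarith
  · rw [rhoMu]
    field_simp
    ring
  · intro x hx d
    have hp : ((u, x - u) : ℝ × ℝ) ∈ D := ⟨hu, by simpa using hx⟩
    have hxc := hsc x hx
    have hxpos : 0 < s x := hc.trans_le hxc
    have r1 := hR1 _ hp
    have r2 := hR2 _ hp
    simp only [Real.norm_eq_abs, add_sub_cancel] at r1 r2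
    have r3 := tF2 ((μ u - μ x) / s x) (d / s x)
    rw [← add_div, show μ u - μ x + d = μ u + d - μ x by ring] at r3
    rw [abs_of_nonneg (by positivity : 0 ≤ (x - u) ^ 4)] at r1
    rw [abs_of_nonneg (by positivity : 0 ≤ (x - u) ^ 2)] at r2
    have r3' : C1 * (d / s x) ^ 2 ≤ C1 / c ^ 2 * d ^ 2 := by
      rw [div_pow, div_mul_eq_mul_div, mul_div_assoc]
      refine mul_le_mul_of_nonneg_left ?_ hC1'
      exact div_le_div_of_nonneg_left (sq_nonneg d) (by positivity)
        (pow_le_pow_left₀ hc.le hxc 2)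
    have r2' := mul_le_mul_of_nonneg_left r2 (abs_nonneg d)
    rw [← abs_mul] at r2'
    have k1 : R1 * (x - u) ^ 4 ≤ C * (x - u) ^ 4 :=
      mul_le_mul_of_nonneg_right (by linarith [le_abs_self R1]) (by positivity)
    have k2 : |d| * (R2 * (x - u) ^ 2) ≤ C * (|d| * (x - u) ^ 2) := by
      have : R2 * (|d| * (x - u) ^ 2) ≤ C * (|d| * (x - u) ^ 2) :=
        mul_le_mul_of_nonneg_right (by linarith [le_abs_self R2]) (by positivity)
      linarith
    have k3 : C1 / c ^ 2 * d ^ 2 ≤ C * d ^ 2 :=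
      mul_le_mul_of_nonneg_right (by linarith) (by positivity)
    have tri := abs_add_three (F ((μ u + d - μ x) / s x) - F ((μ u - μ x) / s x)
      - fe ((μ u - μ x) / s x) * (d / s x)) _ _ |>.trans (add_le_add_three r3 r1 r2')
    refine le_trans (le_of_eq ?_) (tri.trans (by linarith))
    congr 1
    rw [div_eq_mul_inv d]
    ring

end Expansion

/-! ### Lipschitz bumps and the kernel -/

section Kernel

/-- A bounded Lipschitz function vanishing outside `(-M, M)`. -/
structure IsLipBump (M Λ B : ℝ) (φ : ℝ → ℝ) : Prop where
  lip_nonneg : 0 ≤ Λ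
  bound_nonneg : 0 ≤ B
  radius_pos : 0 < M
  lip : ∀ x y, |φ x - φ y| ≤ Λ * |x - y|
  bound : ∀ x, |φ x| ≤ B
  zero : ∀ x, M ≤ |x| → φ x = 0

/-- The class of bumps is stable under multiplication by the variable, so that the moments of the
kernel are covered. -/
lemma IsLipBump.id_mul {M Λ B : ℝ} {φ : ℝ → ℝ} (h : IsLipBump M Λ B φ) :
    IsLipBump M (M * Λ + B) (M * B) (fun v => v * φ v) := by
  obtain ⟨hΛ, hB, hM, hL, hBd, h0⟩ := h
  have key : ∀ x y, |x| ≤ M → |x * φ x - y * φ y| ≤ (M * Λ + B) * |x - y| := fun x y hx => by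
    have e : x * φ x - y * φ y = x * (φ x - φ y) + (x - y) * φ y := by ring
    rw [e]
    refine (abs_add_le _ _).trans ?_
    rw [abs_mul, abs_mul]
    have h1 := mul_le_mul hx (hL x y) (abs_nonneg _) hM.le
    have h2 := mul_le_mul_of_nonneg_left (hBd y) (abs_nonneg (x - y))
    linarith
  refine ⟨by positivity, by positivity, hM, fun x y => ?_, fun x => ?_, fun x hx => ?_⟩
  · rcases le_total |x| M with hx | hx
    · exact key x y hx
    · rcases le_total |y| M with hy | hy
      · rw [abs_sub_comm, abs_sub_comm x]
        exact key y x hy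
      · rw [h0 x hx, h0 y hy]
        simp only [mul_zero, sub_self, abs_zero]
        positivity
  · rcases le_total |x| M with hx | hx
    · rw [abs_mul]
      exact mul_le_mul hx (hBd x) (abs_nonneg _) hM.le
    · rw [h0 x hx]
      simp only [mul_zero, abs_zero]
      positivity
  · rw [h0 x hx, mul_zero]

lemma IsKernel.isLipBump {K : ℝ → ℝ} (hK : IsKernel K) : ∃ M Λ B : ℝ, IsLipBump M Λ B K := by
  obtain ⟨Λ, hΛ⟩ := hK.bounded_deriv
  obtain ⟨R, hR⟩ := hK.bounded_support.subset_closedBall 0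
  have hΛ0 : 0 ≤ Λ := (abs_nonneg _).trans (hΛ 0)
  have hL : ∀ x y, |K x - K y| ≤ Λ * |x - y| := fun x y =>
    convex_univ.norm_image_sub_le_of_norm_deriv_le (fun z _ => hK.differentiable z)
      (fun z _ => hΛ z) (mem_univ y) (mem_univ x)
  have h0 : ∀ x, |R| + 1 ≤ |x| → K x = 0 := fun x hx => by
    by_contra hne
    have := hR hne
    rw [mem_closedBall_zero_iff, Real.norm_eq_abs] at this
    linarith [le_abs_self R]
  have hM : 0 < |R| + 1 := by positivity
  refine ⟨|R| + 1, Λ, Λ * (2 * (|R| + 1)), hΛ0, by positivity, hM, hL, fun x => ?_, h0⟩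
  rcases le_total |x| (|R| + 1) with hx | hx
  · have h1 := hL x (|R| + 1)
    rw [h0 (|R| + 1) (le_abs_self _), sub_zero] at h1
    refine h1.trans (mul_le_mul_of_nonneg_left ?_ hΛ0)
    rw [abs_le] at hx ⊢
    constructor <;> linarith [hx.1, hx.2]
  · rw [h0 x hx, abs_zero]
    positivity

lemma integral_odd_eq_zero {φ : ℝ → ℝ} (h : ∀ v, φ (-v) = -φ v) : ∫ v, φ v = 0 := by
  have h1 := integral_neg_eq_self φ volume
  simp only [h, integral_neg] at h1
  linarith

end Kernel

/-! ### The distribution function at the median -/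

section Median

variable {S : Type*} [MeasurableSpace S] {ν : Measure S} [IsProbabilityMeasure ν]

lemma errorCDF_mono (G : (ℤ → S) → ℝ) : Monotone (errorCDF ν G) := fun _ _ h =>
  measureReal_mono fun _ hw => le_trans hw h

/-- A continuous distribution function equals `1/2` at the median. -/
lemma errorCDF_zero {G : (ℤ → S) → ℝ} (hG : Measurable G) (hmed : median (innovLaw ν) G = 0)
    (hc : Continuous (errorCDF ν G)) : errorCDF ν G 0 = 1 / 2 := by
  have hprob : IsProbabilityMeasure ((innovLaw ν).map G) :=
    Measure.isProbabilityMeasure_map hG.aemeasurable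
  have hcdf : ∀ y, errorCDF ν G y = cdf ((innovLaw ν).map G) y := fun y => by
    rw [cdf_eq_real, map_measureReal_apply hG measurableSet_Iic]
    rfl
  have htop : Tendsto (errorCDF ν G) atTop (𝓝 1) :=
    (tendsto_cdf_atTop _).congr fun y => (hcdf y).symm
  have hbot : Tendsto (errorCDF ν G) atBot (𝓝 0) :=
    (tendsto_cdf_atBot _).congr fun y => (hcdf y).symm
  set A : Set ℝ := {z : ℝ | 1 / 2 ≤ errorCDF ν G z} with hA
  have hA0 : sInf A = 0 := hmed
  have hne : A.Nonempty := (htop.eventually_const_le (by norm_num : (1 / 2 : ℝ) < 1)).exists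
  obtain ⟨z0, hz0⟩ := (hbot.eventually_lt_const (by norm_num : (0 : ℝ) < 1 / 2)).exists
  have hbdd : BddBelow A := ⟨z0, fun z hz => by
    by_contra hlt
    have h1 := errorCDF_mono (ν := ν) G (not_le.1 hlt).le
    have h2 : 1 / 2 ≤ errorCDF ν G z := hz
    linarith⟩
  have hclosed : IsClosed A := isClosed_le continuous_const hc
  have hmem : (0 : ℝ) ∈ A := hA0 ▸ hclosed.csInf_mem hne hbdd
  refine le_antisymm ?_ hmem
  by_contra hgt
  rw [not_le] at hgt
  have hnear : ∀ᶠ z in 𝓝 (0 : ℝ), 1 / 2 < errorCDF ν G z :=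
    hc.continuousAt.eventually_const_lt hgt
  have hleft : ∀ᶠ z in 𝓝[<] (0 : ℝ), 1 / 2 < errorCDF ν G z := hnear.filter_mono nhdsWithin_le_nhds
  obtain ⟨z, hz, hz0'⟩ := (hleft.and self_mem_nhdsWithin).exists
  have := csInf_le hbdd (show z ∈ A from hz.le)
  rw [hA0] at this
  exact absurd hz0' (not_lt.2 this)

end Median

/-! ### The expected score -/

section ExpectedScore

lemma quartic_le {M β d v : ℝ} (hv : |v| ≤ M) :
    (β * v) ^ 4 + |d| * (β * v) ^ 2 + d ^ 2 ≤ (M ^ 4 + M ^ 2 + 1) * 2 * (β ^ 4 + d ^ 2) := by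
  have t2 : v ^ 2 ≤ M ^ 2 := by
    rw [← sq_abs v]; exact pow_le_pow_left₀ (abs_nonneg _) hv 2
  have t4 : v ^ 4 ≤ M ^ 4 := by
    rw [← Even.pow_abs (by decide : Even 4) v]
    exact pow_le_pow_left₀ (abs_nonneg _) hv 4
  have a1 : (β * v) ^ 4 ≤ M ^ 4 * β ^ 4 := by
    rw [mul_pow, mul_comm]
    exact mul_le_mul_of_nonneg_right t4 (by positivity)
  have q1 : |d| * β ^ 2 ≤ β ^ 4 + d ^ 2 := by
    have q := sq_nonneg (|d| - β ^ 2)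
    have q' := sq_nonneg (|d| + β ^ 2)
    have e := sq_abs d
    have e2 : (β ^ 2) ^ 2 = β ^ 4 := by ring
    linarith
  have a2 : |d| * (β * v) ^ 2 ≤ M ^ 2 * (β ^ 4 + d ^ 2) := by
    have q2 : |d| * (β * v) ^ 2 ≤ |d| * β ^ 2 * M ^ 2 := by
      rw [mul_pow, ← mul_assoc]
      exact mul_le_mul_of_nonneg_left t2 (by positivity)
    have q3 := mul_le_mul_of_nonneg_right q1 (by positivity : 0 ≤ M ^ 2)
    linarith
  have p1 : 0 ≤ β ^ 4 := by positivity
  have p2 : 0 ≤ M ^ 4 * d ^ 2 := by positivity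
  have p3 : 0 ≤ M ^ 4 * β ^ 4 := by positivity
  have p4 : 0 ≤ M ^ 2 * (β ^ 4 + d ^ 2) := by positivity
  have p5 := sq_nonneg d
  linarith

lemma abs_mul_mul_le {C D c y z : ℝ} (hC : 0 ≤ C) (hc : |c| ≤ C) (hy : |y| ≤ 1) (hz : |z| ≤ D) :
    |c * (y * z)| ≤ C * D := by
  rw [abs_mul, abs_mul]
  have : |y| * |z| ≤ D := (mul_le_of_le_one_left (abs_nonneg z) hy).trans hz
  exact mul_le_mul hc this (by positivity) hC

lemma abs_add_six_le {x1 x2 x3 x4 x5 x6 y1 y2 y3 y4 y5 y6 : ℝ} (h1 : |x1| ≤ y1) (h2 : |x2| ≤ y2)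
    (h3 : |x3| ≤ y3) (h4 : |x4| ≤ y4) (h5 : |x5| ≤ y5) (h6 : |x6| ≤ y6) :
    |x1 + x2 + x3 + x4 + x5 + x6| ≤ y1 + y2 + y3 + y4 + y5 + y6 := by
  rw [abs_le] at *
  constructor <;> linarith [h1.1, h1.2, h2.1, h2.2, h3.1, h3.2, h4.1, h4.2, h5.1, h5.2, h6.1, h6.2]

variable {a b : ℝ} {m : ℕ → ℕ → ℕ} {x : ℕ → ℕ → ℕ → ℝ} {β : ℕ → ℝ}

/-- The expected kernel-weighted sign score, to the order needed for the Bahadur expansion: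
linear in the displacement `d` with the bias `ψ_K ρ_μ β²` as its zero. -/
lemma ApproxUniformDesign.exists_score_expansion (hab : a < b) (h : ApproxUniformDesign a b m x)
    (hN : Tendsto (totalObs m) atTop atTop) (hβ_pos : ∀ n, 0 < β n) (hβ : Tendsto β atTop (𝓝 0))
    (hNβ : ∀ᶠ n in atTop, 1 ≤ (totalObs m n : ℝ) * β n) {δ : ℝ} (hδ : 0 < δ)
    {K : ℝ → ℝ} (hK : IsKernel K) {μ s fe F : ℝ → ℝ}
    (hμ : BoundedDerivs 4 μ (Icc a b)) (hs : BoundedDerivs 4 s (Icc a b))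
    (hs_pos : ∃ c : ℝ, 0 < c ∧ ∀ u ∈ Icc a b, c ≤ s u)
    (hF : ∀ y, HasDerivAt F (fe y) y) (hfe : BoundedDerivs 4 fe univ)
    (hF0 : F 0 = 1 / 2) (hfe0 : 0 < fe 0) :
    ∃ D : ℝ, 0 ≤ D ∧ ∀ᶠ n in atTop, ∀ u ∈ Icc (a + δ) (b - δ), ∀ d : ℝ, |d| ≤ 1 →
      |∑ p ∈ obsFinset m n, (F ((μ u + d - μ (x n p.1 p.2)) / s (x n p.1 p.2)) - 1 / 2)
          * K ((x n p.1 p.2 - u) / β n)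
        - (totalObs m n * β n) / (b - a) * (fe 0 / s u)
          * (d - psiK K * rhoMu μ s fe u * β n ^ 2)| ≤
      D * (1 + totalObs m n * β n * (β n ^ 4 + d ^ 2)) := by
  have hba : 0 < b - a := by linarith
  obtain ⟨C, hC0, c1, c2, c3, e1, hexp⟩ := exists_expansion hμ hs hs_pos hF hfe hF0 hfe0
  obtain ⟨M, Λ, B, hL0⟩ := hK.isLipBump
  have hL1 := hL0.id_mul
  have hL2 := hL1.id_mul
  have hL3 := hL2.id_mul
  have riem : ∀ {Λ B : ℝ} {φ : ℝ → ℝ}, IsLipBump M Λ B φ → ∃ D : ℝ, 0 ≤ D ∧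
      ∀ᶠ n in atTop, ∀ u ∈ Icc (a + δ) (b - δ),
      |∑ p ∈ obsFinset m n, φ ((x n p.1 p.2 - u) / β n)
        - (totalObs m n * β n) / (b - a) * ∫ v, φ v| ≤ D := fun hφ =>
    h.sum_eq_integral hab hN hβ_pos hβ hNβ hδ hφ.lip_nonneg hφ.bound_nonneg hφ.radius_pos
      hφ.lip hφ.bound hφ.zero
  obtain ⟨D0, hD0, h0⟩ := riem hL0
  obtain ⟨D1, hD1, h1⟩ := riem hL1
  obtain ⟨D2, hD2, h2⟩ := riem hL2
  obtain ⟨D3, hD3, h3⟩ := riem hL3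
  rw [hK.integral_eq_one] at h0
  rw [integral_odd_eq_zero fun v => by rw [hK.symm]; ring] at h1
  rw [integral_odd_eq_zero fun v => by rw [hK.symm]; ring] at h3
  have hψ : ∫ v, v * (v * K v) = 2 * psiK K := by
    rw [psiK, ← mul_assoc, show (2 : ℝ) * (1 / 2) = 1 by norm_num, one_mul]
    exact integral_congr_ae (ae_of_all _ fun v => by ring)
  rw [hψ] at h2
  have hMp := hL0.radius_pos
  set E : ℝ := C * (M ^ 4 + M ^ 2 + 1) * 2 with hE
  have hE0 : 0 ≤ E := by positivity
  refine ⟨C * D1 + C * D2 + C * D3 + C * D0 + C * D1 + E * (1 / (b - a)) + E * D0,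
    by positivity, ?_⟩
  obtain ⟨C', -, hdes⟩ := h.exists_ordered hN
  filter_upwards [h0, h1, h2, h3, hdes, hNβ, hβ.eventually_le_const one_pos]
    with n h0 h1 h2 h3 hdes hNβ hβ1 u hu d hd
  have hxin := hdes.2.1
  have huI : u ∈ Ioo a b := ⟨by linarith [hu.1], by linarith [hu.2]⟩
  obtain ⟨b1, b2, b3, b4, b5, hc2, hx⟩ := hexp u huI
  replace h0 := h0 u hu
  replace h1 := h1 u hu
  replace h2 := h2 u hu
  replace h3 := h3 u hu
  have hβn := hβ_pos n
  set V : ℝ := totalObs m n * β n with hV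
  set I := obsFinset m n
  set t : ℕ × ℕ → ℝ := fun p => (x n p.1 p.2 - u) / β n with ht
  set R : ℕ × ℕ → ℝ := fun p => F ((μ u + d - μ (x n p.1 p.2)) / s (x n p.1 p.2)) - 1 / 2
    - (c1 u * (x n p.1 p.2 - u) + c2 u * (x n p.1 p.2 - u) ^ 2
          + c3 u * (x n p.1 p.2 - u) ^ 3 + d * (fe 0 / s u + e1 u * (x n p.1 p.2 - u))) with hR
  have hxt : ∀ p, x n p.1 p.2 - u = β n * t p := fun p => by
    rw [ht]; field_simp
  set S0 := ∑ p ∈ I, K (t p) with hS0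
  set S1 := ∑ p ∈ I, t p * K (t p) with hS1
  set S2 := ∑ p ∈ I, t p * (t p * K (t p)) with hS2
  set S3 := ∑ p ∈ I, t p * (t p * (t p * K (t p))) with hS3
  have hdecomp : ∑ p ∈ I, (F ((μ u + d - μ (x n p.1 p.2)) / s (x n p.1 p.2)) - 1 / 2) * K (t p) =
      c1 u * β n * S1 + c2 u * β n ^ 2 * S2 + c3 u * β n ^ 3 * S3 + d * (fe 0 / s u) * S0
        + d * e1 u * β n * S1 + ∑ p ∈ I, R p * K (t p) := by
    rw [hS0, hS1, hS2, hS3]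
    simp only [Finset.mul_sum, ← Finset.sum_add_distrib]
    refine Finset.sum_congr rfl fun p _ => ?_
    rw [hR]
    dsimp only
    rw [hxt p]
    ring
  have hS0le : S0 ≤ V / (b - a) + D0 := by
    have := (abs_le.1 h0).2
    rw [mul_one] at this
    linarith
  have hRle : |∑ p ∈ I, R p * K (t p)| ≤ E * (β n ^ 4 + d ^ 2) * S0 := by
    refine (Finset.abs_sum_le_sum_abs _ _).trans ?_
    rw [hS0, Finset.mul_sum]
    refine Finset.sum_le_sum fun p hp => ?_
    rw [abs_mul, abs_of_nonneg (hK.nonneg _)]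
    rcases le_total M |t p| with hM | hM
    · rw [hL0.zero _ hM]; simp
    · refine mul_le_mul_of_nonneg_right ?_ (hK.nonneg _)
      refine (hx _ (hxin p hp) d).trans ?_
      rw [hE, hxt p]
      have := mul_le_mul_of_nonneg_left (quartic_le (β := β n) (d := d) hM) hC0
      linarith
  have hfin : ∑ p ∈ I, (F ((μ u + d - μ (x n p.1 p.2)) / s (x n p.1 p.2)) - 1 / 2) * K (t p)
      - V / (b - a) * (fe 0 / s u) * (d - psiK K * rhoMu μ s fe u * β n ^ 2) =
      c1 u * (β n * S1) + c2 u * (β n ^ 2 * (S2 - V / (b - a) * (2 * psiK K)))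
        + c3 u * (β n ^ 3 * S3) + fe 0 / s u * (d * (S0 - V / (b - a) * 1))
        + e1 u * (d * β n * S1) + ∑ p ∈ I, R p * K (t p) := by
    have : c2 u * 2 = -(fe 0 / s u) * rhoMu μ s fe u := by
      rw [hc2, mul_comm (2 : ℝ) (s u), ← div_div]; ring
    rw [hdecomp]
    linear_combination (β n ^ 2 * (V / (b - a)) * psiK K) * this
  rw [mul_zero, sub_zero] at h1 h3
  have hβ0 := hβn.le
  have hb1 : |β n| ≤ 1 := by rwa [abs_of_pos hβn]
  have hb2 : |β n ^ 2| ≤ 1 := by rw [abs_pow]; exact pow_le_one₀ (abs_nonneg _) hb1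
  have hb3 : |β n ^ 3| ≤ 1 := by rw [abs_pow]; exact pow_le_one₀ (abs_nonneg _) hb1
  have hdb : |d * β n| ≤ 1 := by
    rw [abs_mul]; exact mul_le_one₀ hd (abs_nonneg _) hb1
  have T1 := abs_mul_mul_le hC0 b1 hb1 h1
  have T2 := abs_mul_mul_le hC0 b2 hb2 h2
  have T3 := abs_mul_mul_le hC0 b3 hb3 h3
  have T4 := abs_mul_mul_le hC0 b5 hd h0
  have T5 := abs_mul_mul_le hC0 b4 hdb h1
  have hRle' : E * (β n ^ 4 + d ^ 2) * S0 ≤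
      E * (1 / (b - a)) * (V * (β n ^ 4 + d ^ 2)) + E * D0 * (V * (β n ^ 4 + d ^ 2)) := by
    have q0 : 0 ≤ E * (β n ^ 4 + d ^ 2) := by positivity
    refine (mul_le_mul_of_nonneg_left hS0le q0).trans ?_
    have : E * (β n ^ 4 + d ^ 2) * D0 ≤ E * (β n ^ 4 + d ^ 2) * D0 * V :=
      le_mul_of_one_le_right (by positivity) hNβ
    have e : E * (β n ^ 4 + d ^ 2) * (V / (b - a) + D0) =
      E * (1 / (b - a)) * (V * (β n ^ 4 + d ^ 2)) + E * (β n ^ 4 + d ^ 2) * D0 := by ring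
    rw [e]; linarith
  rw [hfin]
  refine (abs_add_six_le T1 T2 T3 T4 T5 (hRle.trans hRle')).trans ?_
  have hW : 0 ≤ V * (β n ^ 4 + d ^ 2) := by positivity
  have hbig : 0 ≤ (C * D1 + C * D2 + C * D3 + C * D0 + C * D1) * (V * (β n ^ 4 + d ^ 2)) := by
    positivity
  have hbig2 : 0 ≤ E * (1 / (b - a)) + E * D0 := by positivity
  linarith

end ExpectedScore

/-! ### Weighted medians -/

section WeightedMedian

variable {ι : Type*}

/-- The step `1[y ≤ θ]`. -/
noncomputable def stepInd (y θ : ℝ) : ℝ := if y ≤ θ then 1 else 0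

lemma stepInd_mono (y : ℝ) : Monotone (stepInd y) := fun θ θ' h => by
  unfold stepInd
  split_ifs with h1 h2 <;> linarith

lemma stepInd_nonneg (y θ : ℝ) : 0 ≤ stepInd y θ := by
  unfold stepInd; split_ifs <;> norm_num

lemma stepInd_le_one (y θ : ℝ) : stepInd y θ ≤ 1 := by
  unfold stepInd; split_ifs <;> norm_num

/-- If more than half of the weight lies at or below `θ`, a weighted median is at most `θ`. -/
lemma minimiser_le {I : Finset ι} {w y : ι → ℝ} (hw : ∀ p ∈ I, 0 ≤ w p) {θ θ0 : ℝ}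
    (hmin : ∑ p ∈ I, |y p - θ0| * w p ≤ ∑ p ∈ I, |y p - θ| * w p)
    (hS : 0 < ∑ p ∈ I, (stepInd (y p) θ - 1 / 2) * w p) : θ0 ≤ θ := by
  by_contra hlt
  rw [not_le] at hlt
  have : (2 * (θ0 - θ)) * ∑ p ∈ I, (stepInd (y p) θ - 1 / 2) * w p ≤
      ∑ p ∈ I, |y p - θ0| * w p - ∑ p ∈ I, |y p - θ| * w p := by
    rw [← Finset.sum_sub_distrib, Finset.mul_sum]
    refine Finset.sum_le_sum fun p hp => ?_
    rw [← sub_mul, ← mul_assoc]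
    refine mul_le_mul_of_nonneg_right ?_ (hw p hp)
    unfold stepInd
    split_ifs with h
    · rw [abs_of_nonpos (by linarith), abs_of_nonpos (by linarith)]; linarith
    · have := abs_sub_abs_le_abs_sub (y p - θ) (y p - θ0)
      rw [show y p - θ - (y p - θ0) = θ0 - θ by ring, abs_of_pos (by linarith : 0 < θ0 - θ)] at this
      linarith
  have h2 : 0 < (2 * (θ0 - θ)) * ∑ p ∈ I, (stepInd (y p) θ - 1 / 2) * w p :=
    mul_pos (by linarith) hS
  linarith

/-- If less than half of the weight lies at or below `θ`, a weighted median is at least `θ`. -/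
lemma le_minimiser {I : Finset ι} {w y : ι → ℝ} (hw : ∀ p ∈ I, 0 ≤ w p) {θ θ0 : ℝ}
    (hmin : ∑ p ∈ I, |y p - θ0| * w p ≤ ∑ p ∈ I, |y p - θ| * w p)
    (hS : ∑ p ∈ I, (stepInd (y p) θ - 1 / 2) * w p < 0) : θ ≤ θ0 := by
  by_contra hlt
  rw [not_le] at hlt
  have : (2 * (θ0 - θ)) * ∑ p ∈ I, (stepInd (y p) θ - 1 / 2) * w p ≤
      ∑ p ∈ I, |y p - θ0| * w p - ∑ p ∈ I, |y p - θ| * w p := by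
    rw [← Finset.sum_sub_distrib, Finset.mul_sum]
    refine Finset.sum_le_sum fun p hp => ?_
    rw [← sub_mul, ← mul_assoc]
    refine mul_le_mul_of_nonneg_right ?_ (hw p hp)
    unfold stepInd
    split_ifs with h
    · have := abs_sub_abs_le_abs_sub (y p - θ) (y p - θ0)
      rw [show y p - θ - (y p - θ0) = -(θ - θ0) by ring, abs_neg,
        abs_of_pos (by linarith : 0 < θ - θ0)] at this
      linarith
    · rw [abs_of_nonneg (by linarith), abs_of_nonneg (by linarith)]; linarith
  have h2 : 0 < (2 * (θ0 - θ)) * ∑ p ∈ I, (stepInd (y p) θ - 1 / 2) * w p :=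
    mul_pos_of_neg_of_neg (by linarith) hS
  linarith

end WeightedMedian

/-! ### The weighted empirical process -/

section EmpiricalProcess

variable {Ω S : Type*} [MeasurableSpace Ω] [MeasurableSpace S] {P : Measure Ω}

/-- The weighted empirical distribution function at `θ`, centred at its expectation. -/
noncomputable def empDev (P : Measure Ω) (I : Finset (ℕ × ℕ)) (w : ℕ × ℕ → ℝ) (Y : ℕ × ℕ → Ω → ℝ)
    (θ : ℝ) (ω : Ω) : ℝ :=
  ∑ p ∈ I, w p * (stepInd (Y p ω) θ - P.real {ω' | Y p ω' ≤ θ})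

lemma integral_stepInd {Z : Ω → ℝ} (hZ : Measurable Z) (θ : ℝ) :
    ∫ ω, stepInd (Z ω) θ ∂P = P.real {ω | Z ω ≤ θ} := by
  have hm : MeasurableSet {ω | Z ω ≤ θ} := measurableSet_le hZ measurable_const
  rw [← integral_indicator_one hm]
  refine integral_congr_ae (ae_of_all _ fun ω => ?_)
  simp only [stepInd, indicator, mem_ofPred_eq, Pi.one_apply]

lemma measurable_stepInd (θ : ℝ) : Measurable fun y => stepInd y θ :=
  Measurable.ite measurableSet_Iic measurable_const measurable_const

lemma abs_stepInd_sub_prob_le [IsProbabilityMeasure P] (y θ : ℝ) (A : Set Ω) :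
    |stepInd y θ - P.real A| ≤ 1 := by
  have h1 := stepInd_nonneg y θ
  have h2 := stepInd_le_one y θ
  have h3 : 0 ≤ P.real A := measureReal_nonneg
  have h4 : P.real A ≤ 1 := measureReal_le_one
  rw [abs_le]; constructor <;> linarith

/-- Second moment of the centred difference `1[Z ≤ θ'] - c 1[Z ≤ θ]`. -/
lemma integral_sq_stepInd_le [IsProbabilityMeasure P] {Z : Ω → ℝ} (hZ : Measurable Z)
    {c : ℝ} (hc0 : 0 ≤ c) (hc1 : c ≤ 1)
    (θ θ' : ℝ) :
    ∫ ω, ((stepInd (Z ω) θ' - P.real {ω' | Z ω' ≤ θ'})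
      - c * (stepInd (Z ω) θ - P.real {ω' | Z ω' ≤ θ})) ^ 2 ∂P ≤
      (1 - c) + |P.real {ω' | Z ω' ≤ θ'} - P.real {ω' | Z ω' ≤ θ}| := by
  have hm : ∀ t, Measurable fun ω => stepInd (Z ω) t := fun t => (measurable_stepInd t).comp hZ
  have hb : ∀ t ω, |stepInd (Z ω) t| ≤ 1 := fun t ω => by
    rw [abs_of_nonneg (stepInd_nonneg _ _)]; exact stepInd_le_one _ _
  have hi : ∀ t, Integrable (fun ω => stepInd (Z ω) t) P := fun t =>
    integrable_of_abs_le (hm t) (hb t)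
  set ξ : Ω → ℝ := fun ω => stepInd (Z ω) θ' - c * stepInd (Z ω) θ with hξ
  have hξm : Measurable ξ := (hm θ').sub ((hm θ).const_mul c)
  have hξb : ∀ ω, |ξ ω| ≤ 1 := fun ω => by
    have h1 := stepInd_nonneg (Z ω) θ'
    have h2 := stepInd_le_one (Z ω) θ'
    have h3 := mul_nonneg hc0 (stepInd_nonneg (Z ω) θ)
    have h4 := mul_le_one₀ hc1 (stepInd_nonneg (Z ω) θ) (stepInd_le_one (Z ω) θ)
    rw [abs_le]; constructor <;> simp only [hξ] <;> linarith
  have hξE : ∫ ω, ξ ω ∂P = P.real {ω' | Z ω' ≤ θ'} - c * P.real {ω' | Z ω' ≤ θ} := by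
    rw [hξ, integral_sub (hi θ') ((hi θ).const_mul c), integral_const_mul, integral_stepInd hZ,
      integral_stepInd hZ]
  have hvar : ∫ ω, ((stepInd (Z ω) θ' - P.real {ω' | Z ω' ≤ θ'})
      - c * (stepInd (Z ω) θ - P.real {ω' | Z ω' ≤ θ})) ^ 2 ∂P ≤ ∫ ω, ξ ω ^ 2 ∂P := by
    have h1 : variance ξ P ≤ ∫ ω, ξ ω ^ 2 ∂P := by
      simpa using variance_le_expectation_sq (μ := P) hξm.aestronglyMeasurable
    rw [variance_eq_integral hξm.aemeasurable, hξE] at h1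
    refine le_trans (le_of_eq (integral_congr_ae (ae_of_all _ fun ω => ?_))) h1
    simp only [hξ]; ring
  refine hvar.trans ?_
  have hpt : ∀ ω, ξ ω ^ 2 ≤ (1 - c) + |stepInd (Z ω) θ' - stepInd (Z ω) θ| := fun ω => by
    simp only [hξ, stepInd]
    split_ifs <;> norm_num <;> nlinarith
  have hdiff : ∫ ω, |stepInd (Z ω) θ' - stepInd (Z ω) θ| ∂P =
      |P.real {ω' | Z ω' ≤ θ'} - P.real {ω' | Z ω' ≤ θ}| := by
    rw [← integral_stepInd hZ θ', ← integral_stepInd hZ θ, ← integral_sub (hi θ') (hi θ)]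
    rcases le_total θ θ' with h | h
    · have h1 : ∀ ω, 0 ≤ stepInd (Z ω) θ' - stepInd (Z ω) θ := fun ω =>
        sub_nonneg.2 (stepInd_mono _ h)
      rw [abs_of_nonneg (integral_nonneg h1)]
      exact integral_congr_ae (ae_of_all _ fun ω => abs_of_nonneg (h1 ω))
    · have h1 : ∀ ω, stepInd (Z ω) θ' - stepInd (Z ω) θ ≤ 0 := fun ω =>
        sub_nonpos.2 (stepInd_mono _ h)
      rw [abs_of_nonpos (integral_nonpos h1), ← integral_neg]
      exact integral_congr_ae (ae_of_all _ fun ω => abs_of_nonpos (h1 ω))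
  have hdi : Integrable (fun ω => |stepInd (Z ω) θ' - stepInd (Z ω) θ|) P :=
    ((hi θ').sub (hi θ)).abs
  have hci : Integrable (fun _ : Ω => 1 - c) P := integrable_const _
  calc ∫ ω, ξ ω ^ 2 ∂P ≤ ∫ ω, ((1 - c) + |stepInd (Z ω) θ' - stepInd (Z ω) θ|) ∂P := by
        refine integral_mono (integrable_of_abs_le (B := 1) (hξm.pow_const 2) fun ω => ?_)
          (hci.add hdi) hpt
        rw [abs_pow]
        exact pow_le_one₀ (abs_nonneg _) (hξb ω)
    _ = _ := by
        rw [integral_add hci hdi, hdiff]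
        simp

/-- Tail bound for one increment of the empirical process of a `k`-dependent array. With `L = log N`
the exponent `8` leaves room for a union bound over `O(N⁶)` grid points. -/
lemma prob_empDev_ge [IsProbabilityMeasure P] {ε : ℕ × ℤ → Ω → S}
    (hε : ∀ q, Measurable (ε q))
    (hind : iIndepFun ε P) (k : ℕ) {Y : ℕ × ℕ → Ω → ℝ} {I : Finset (ℕ × ℕ)}
    (hY : ∀ p ∈ I, Measurable[windowSigma ε (lagWindow k p)] (Y p)) {w : ℕ × ℕ → ℝ} {B : ℝ}
    (hw : ∀ p ∈ I, |w p| ≤ B) {c : ℝ} (hc0 : 0 ≤ c) (hc1 : c ≤ 1) {θ θ' V L : ℝ} (hL : 0 < L)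
    (hV : ∑ p ∈ I, w p ^ 2 * ((1 - c)
      + |P.real {ω' | Y p ω' ≤ θ'} - P.real {ω' | Y p ω' ≤ θ}|) ≤ V)
    (hBV : (2 * B) ^ 2 * L ≤ V) (hVpos : 0 < V) :
    P.real {ω | (2 * k + 1 : ℕ) * (9 * √(V * L)) ≤
        |empDev P I w Y θ' ω - c * empDev P I w Y θ ω|} ≤
      (2 * k + 1 : ℕ) * (2 * Real.exp (-8 * L)) := by
  have hmono : ∀ W : Set (ℕ × ℤ), windowSigma ε W ≤ (inferInstance : MeasurableSpace Ω) :=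
    fun W => iSup₂_le fun i _ => (hε i).comap_le
  have hYm : ∀ p ∈ I, Measurable (Y p) := fun p hp => (hY p hp).mono (hmono _) le_rfl
  set X : ℕ × ℕ → Ω → ℝ := fun p ω => w p * ((stepInd (Y p ω) θ' - P.real {ω' | Y p ω' ≤ θ'})
    - c * (stepInd (Y p ω) θ - P.real {ω' | Y p ω' ≤ θ})) with hX
  have hsum : ∀ ω, empDev P I w Y θ' ω - c * empDev P I w Y θ ω = ∑ p ∈ I, X p ω := fun ω => by
    rw [empDev, empDev, Finset.mul_sum, ← Finset.sum_sub_distrib]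
    exact Finset.sum_congr rfl fun p _ => by rw [hX]; ring
  have hB0 : ∀ p ∈ I, ∀ ω, |X p ω| ≤ 2 * B := fun p hp ω => by
    rw [hX, abs_mul]
    have h1 := abs_stepInd_sub_prob_le (P := P) (Y p ω) θ' {ω' | Y p ω' ≤ θ'}
    have h2 := abs_stepInd_sub_prob_le (P := P) (Y p ω) θ {ω' | Y p ω' ≤ θ}
    have h3 : |c * (stepInd (Y p ω) θ - P.real {ω' | Y p ω' ≤ θ})| ≤ 1 := by
      rw [abs_mul, abs_of_nonneg hc0]
      exact mul_le_one₀ hc1 (abs_nonneg _) h2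
    have h4 := (abs_sub _ _).trans (add_le_add h1 h3)
    have := mul_le_mul (hw p hp) h4 (abs_nonneg _) ((abs_nonneg _).trans (hw p hp))
    linarith
  set l : ℝ := √(L / V) with hl
  have hl0 : 0 ≤ l := Real.sqrt_nonneg _
  have hl2 : l ^ 2 = L / V := Real.sq_sqrt (by positivity)
  have hlV : l * √(V * L) = L := by
    rw [hl, ← Real.sqrt_mul (by positivity), show L / V * (V * L) = L ^ 2 by field_simp]
    exact Real.sqrt_sq hL.le
  have hlB : l * (2 * B) ≤ 1 := by
    by_contra hcon
    rw [not_le] at hcon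
    have h1 : 1 < (l * (2 * B)) ^ 2 := by nlinarith
    rw [mul_pow, hl2, div_mul_eq_mul_div, lt_div_iff₀ hVpos] at h1
    linarith
  have hint : ∀ p ∈ I, ∫ ω, X p ω ∂P = 0 := fun p hp => by
    have hi : ∀ t, Integrable (fun ω => stepInd (Y p ω) t - P.real {ω' | Y p ω' ≤ t}) P :=
      fun t => integrable_of_abs_le (B := 1)
        (((measurable_stepInd t).comp (hYm p hp)).sub_const _)
        fun ω => abs_stepInd_sub_prob_le _ _ _
    have h0 : ∀ t, ∫ ω, (stepInd (Y p ω) t - P.real {ω' | Y p ω' ≤ t}) ∂P = 0 := fun t => by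
      have hi1 : Integrable (fun ω => stepInd (Y p ω) t) P :=
        integrable_of_abs_le (B := 1) ((measurable_stepInd t).comp (hYm p hp)) fun ω => by
          rw [abs_of_nonneg (stepInd_nonneg _ _)]; exact stepInd_le_one _ _
      rw [integral_sub hi1 (integrable_const _), integral_stepInd (hYm p hp)]
      simp
    rw [hX]
    dsimp only
    rw [integral_const_mul, integral_sub (hi θ') ((hi θ).const_mul c), integral_const_mul, h0, h0]
    simp
  have hvar : ∑ p ∈ I, ∫ ω, X p ω ^ 2 ∂P ≤ V := by
    refine le_trans (Finset.sum_le_sum fun p hp => ?_) hV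
    rw [hX]
    simp only [mul_pow]
    rw [integral_const_mul]
    exact mul_le_mul_of_nonneg_left (integral_sq_stepInd_le (hYm p hp) hc0 hc1 θ θ') (sq_nonneg _)
  have hmeas : ∀ p ∈ I, Measurable[windowSigma ε (lagWindow k p)] (X p) := fun p hp => by
    have h1 : ∀ t, Measurable[windowSigma ε (lagWindow k p)] fun ω => stepInd (Y p ω) t :=
      fun t => (measurable_stepInd t).comp (hY p hp)
    exact (((h1 θ').sub_const _).sub (((h1 θ).sub_const _).const_mul c)).const_mul (w p)
  have := prob_abs_sum_ge_of_lagWindow hε hind k hmeas hB0 hint hl0 hlB hvar (9 * √(V * L))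
  simp only [hsum]
  refine this.trans (le_of_eq ?_)
  congr 3
  rw [hl2, show -l * (9 * √(V * L)) = -9 * (l * √(V * L)) by ring, hlV]
  field_simp
  ring

/-- Upper bracket: replacing the variables by nearby ones, and moving the two thresholds outwards
accordingly, increases an increment of the weighted empirical process up to a small error. -/
lemma empDev_increment_le {I : Finset (ℕ × ℕ)} {w : ℕ × ℕ → ℝ} {B : ℝ}
    (hw0 : ∀ p ∈ I, 0 ≤ w p) (hwB : ∀ p ∈ I, w p ≤ B) {Y Z : ℕ × ℕ → Ω → ℝ} {ω : Ω} {r : ℝ}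
    (hYZ : ∀ p ∈ I, |Y p ω - Z p ω| ≤ r) {c : ℝ} (hc0 : 0 ≤ c) (hc1 : c ≤ 1)
    {θ θ' θl θu : ℝ} (hl : θl + r ≤ θ) (hu : θ' + r ≤ θu) {e : ℝ}
    (he1 : ∀ p ∈ I, |P.real {ω' | Z p ω' ≤ θu} - P.real {ω' | Y p ω' ≤ θ'}| ≤ e)
    (he2 : ∀ p ∈ I, |P.real {ω' | Z p ω' ≤ θl} - P.real {ω' | Y p ω' ≤ θ}| ≤ e) :
    empDev P I w Y θ' ω - c * empDev P I w Y θ ω ≤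
      empDev P I w Z θu ω - c * empDev P I w Z θl ω + I.card * (2 * B * e) := by
  rw [empDev, empDev, empDev, empDev, Finset.mul_sum, Finset.mul_sum, ← Finset.sum_sub_distrib,
    ← Finset.sum_sub_distrib, ← nsmul_eq_mul, ← Finset.sum_const, ← Finset.sum_add_distrib]
  refine Finset.sum_le_sum fun p hp => ?_
  have h1 : stepInd (Y p ω) θ' ≤ stepInd (Z p ω) θu := by
    have := (abs_le.1 (hYZ p hp)).1
    unfold stepInd
    split_ifs with h h' <;> linarith
  have h2 : stepInd (Z p ω) θl ≤ stepInd (Y p ω) θ := by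
    have := (abs_le.1 (hYZ p hp)).2
    unfold stepInd
    split_ifs with h h' <;> linarith
  have e1 := abs_le.1 (he1 p hp)
  have e2 := abs_le.1 (he2 p hp)
  have e0 : 0 ≤ e := (abs_nonneg _).trans (he1 p hp)
  have h3 := mul_le_mul_of_nonneg_left h2 hc0
  have h4 : c * (P.real {ω' | Z p ω' ≤ θl} - P.real {ω' | Y p ω' ≤ θ}) ≥ -e := by
    nlinarith [e2.1]
  have h5 : (stepInd (Y p ω) θ' - P.real {ω' | Y p ω' ≤ θ'})
      - c * (stepInd (Y p ω) θ - P.real {ω' | Y p ω' ≤ θ}) ≤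
      (stepInd (Z p ω) θu - P.real {ω' | Z p ω' ≤ θu})
      - c * (stepInd (Z p ω) θl - P.real {ω' | Z p ω' ≤ θl}) + 2 * e := by
    nlinarith [e1.2]
  have h6 := mul_le_mul_of_nonneg_left h5 (hw0 p hp)
  have h7 : w p * (2 * e) ≤ B * (2 * e) := mul_le_mul_of_nonneg_right (hwB p hp) (by positivity)
  linarith

/-- The matching lower bracket, with the thresholds moved in the opposite directions. -/
lemma le_empDev_increment {I : Finset (ℕ × ℕ)} {w : ℕ × ℕ → ℝ} {B : ℝ}
    (hw0 : ∀ p ∈ I, 0 ≤ w p) (hwB : ∀ p ∈ I, w p ≤ B) {Y Z : ℕ × ℕ → Ω → ℝ} {ω : Ω} {r : ℝ}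
    (hYZ : ∀ p ∈ I, |Y p ω - Z p ω| ≤ r) {c : ℝ} (hc0 : 0 ≤ c) (hc1 : c ≤ 1)
    {θ θ' θl θu : ℝ} (hl : θl + r ≤ θ') (hu : θ + r ≤ θu) {e : ℝ}
    (he1 : ∀ p ∈ I, |P.real {ω' | Z p ω' ≤ θl} - P.real {ω' | Y p ω' ≤ θ'}| ≤ e)
    (he2 : ∀ p ∈ I, |P.real {ω' | Z p ω' ≤ θu} - P.real {ω' | Y p ω' ≤ θ}| ≤ e) :
    empDev P I w Z θl ω - c * empDev P I w Z θu ω - I.card * (2 * B * e) ≤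
      empDev P I w Y θ' ω - c * empDev P I w Y θ ω := by
  rw [empDev, empDev, empDev, empDev, Finset.mul_sum, Finset.mul_sum, ← Finset.sum_sub_distrib,
    ← Finset.sum_sub_distrib, ← nsmul_eq_mul, ← Finset.sum_const, ← Finset.sum_sub_distrib]
  refine Finset.sum_le_sum fun p hp => ?_
  have h1 : stepInd (Y p ω) θ ≤ stepInd (Z p ω) θu := by
    have := (abs_le.1 (hYZ p hp)).1
    unfold stepInd
    split_ifs with h h' <;> linarith
  have h2 : stepInd (Z p ω) θl ≤ stepInd (Y p ω) θ' := by
    have := (abs_le.1 (hYZ p hp)).2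
    unfold stepInd
    split_ifs with h h' <;> linarith
  have e1 := abs_le.1 (he1 p hp)
  have e2 := abs_le.1 (he2 p hp)
  have e0 : 0 ≤ e := (abs_nonneg _).trans (he1 p hp)
  have h3 := mul_le_mul_of_nonneg_left h1 hc0
  have h4 : c * (P.real {ω' | Z p ω' ≤ θu} - P.real {ω' | Y p ω' ≤ θ}) ≤ e := by
    nlinarith [e2.2]
  have h5 : (stepInd (Z p ω) θl - P.real {ω' | Z p ω' ≤ θl})
      - c * (stepInd (Z p ω) θu - P.real {ω' | Z p ω' ≤ θu}) - 2 * e ≤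
      (stepInd (Y p ω) θ' - P.real {ω' | Y p ω' ≤ θ'})
      - c * (stepInd (Y p ω) θ - P.real {ω' | Y p ω' ≤ θ}) := by
    nlinarith [e1.1]
  have h6 := mul_le_mul_of_nonneg_left h5 (hw0 p hp)
  have h7 : w p * (2 * e) ≤ B * (2 * e) := mul_le_mul_of_nonneg_right (hwB p hp) (by positivity)
  linarith

/-- Perturbing the weights changes an increment by at most twice the total perturbation. -/
lemma abs_empDev_increment_sub_le [IsProbabilityMeasure P] {I : Finset (ℕ × ℕ)}
    {w w' : ℕ × ℕ → ℝ} {r : ℝ}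
    (hww : ∀ p ∈ I, |w p - w' p| ≤ r) (Z : ℕ × ℕ → Ω → ℝ) (ω : Ω) {c : ℝ} (hc0 : 0 ≤ c)
    (hc1 : c ≤ 1) (θ θ' : ℝ) :
    |(empDev P I w Z θ' ω - c * empDev P I w Z θ ω)
      - (empDev P I w' Z θ' ω - c * empDev P I w' Z θ ω)| ≤ I.card * (r * 2) := by
  rw [empDev, empDev, empDev, empDev, Finset.mul_sum, Finset.mul_sum, ← Finset.sum_sub_distrib,
    ← Finset.sum_sub_distrib, ← Finset.sum_sub_distrib, ← nsmul_eq_mul, ← Finset.sum_const]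
  refine (Finset.abs_sum_le_sum_abs _ _).trans (Finset.sum_le_sum fun p hp => ?_)
  have h1 := abs_stepInd_sub_prob_le (P := P) (Z p ω) θ' {ω' | Z p ω' ≤ θ'}
  have h2 := abs_stepInd_sub_prob_le (P := P) (Z p ω) θ {ω' | Z p ω' ≤ θ}
  have h3 : |c * (stepInd (Z p ω) θ - P.real {ω' | Z p ω' ≤ θ})| ≤ 1 := by
    rw [abs_mul, abs_of_nonneg hc0]
    exact mul_le_one₀ hc1 (abs_nonneg _) h2
  have h4 : |(stepInd (Z p ω) θ' - P.real {ω' | Z p ω' ≤ θ'})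
      - c * (stepInd (Z p ω) θ - P.real {ω' | Z p ω' ≤ θ})| ≤ 2 :=
    ((abs_sub _ _).trans (add_le_add h1 h3)).trans (by norm_num)
  have := mul_le_mul (hww p hp) h4 (abs_nonneg _) ((abs_nonneg _).trans (hww p hp))
  rw [← abs_mul] at this
  refine le_trans (le_of_eq ?_) this
  congr 1
  ring

end EmpiricalProcess

/-! ### Discretisation of the empirical process -/

section UniformBound

variable {Ω S : Type*} [MeasurableSpace Ω] [MeasurableSpace S] {P : Measure Ω}
  [IsProbabilityMeasure P]

/-- Distribution functions of close variables at close thresholds. -/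
lemma abs_prob_le_sub_prob_le {Y Z : Ω → ℝ} {r e Λ : ℝ} (hr : 0 ≤ r)
    (hYZ : P.real {ω | r < |Y ω - Z ω|} ≤ e)
    (hΛ : ∀ t t', |P.real {ω | Y ω ≤ t} - P.real {ω | Y ω ≤ t'}| ≤ Λ * |t - t'|) (hΛ0 : 0 ≤ Λ)
    (t t' : ℝ) :
    |P.real {ω | Z ω ≤ t} - P.real {ω | Y ω ≤ t'}| ≤ Λ * (|t - t'| + r) + e := by
  have h1 : P.real {ω | Z ω ≤ t} ≤ P.real {ω | Y ω ≤ t + r} + e := by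
    refine le_trans (measureReal_mono (μ := P) (s₂ := {ω | Y ω ≤ t + r} ∪ {ω | r < |Y ω - Z ω|})
      (h₂ := measure_ne_top _ _) fun ω hω => ?_) ((measureReal_union_le _ _).trans (by linarith))
    rcases lt_or_ge r |Y ω - Z ω| with h | h
    · exact Or.inr h
    · refine Or.inl ?_
      have hz : Z ω ≤ t := hω
      have := (abs_le.1 h).2
      show Y ω ≤ t + r
      linarith
  have h2 : P.real {ω | Y ω ≤ t - r} ≤ P.real {ω | Z ω ≤ t} + e := by
    refine le_trans (measureReal_mono (μ := P) (s₂ := {ω | Z ω ≤ t} ∪ {ω | r < |Y ω - Z ω|})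
      (h₂ := measure_ne_top _ _) fun ω hω => ?_) ((measureReal_union_le _ _).trans (by linarith))
    rcases lt_or_ge r |Y ω - Z ω| with h | h
    · exact Or.inr h
    · refine Or.inl ?_
      have hz : Y ω ≤ t - r := hω
      have := (abs_le.1 h).1
      show Z ω ≤ t
      linarith
  have h3 := (abs_le.1 (hΛ (t + r) t')).2
  have h4 := (abs_le.1 (hΛ (t - r) t')).1
  have h5 : |t + r - t'| ≤ |t - t'| + r := by
    rw [show t + r - t' = (t - t') + r by ring]
    exact (abs_add_le _ _).trans_eq (by rw [abs_of_nonneg hr])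
  have h6 : |t - r - t'| ≤ |t - t'| + r := by
    rw [show t - r - t' = (t - t') - r by ring]
    exact (abs_sub _ _).trans_eq (by rw [abs_of_nonneg hr])
  have h7 := mul_le_mul_of_nonneg_left h5 hΛ0
  have h8 := mul_le_mul_of_nonneg_left h6 hΛ0
  rw [abs_le]; constructor <;> linarith

lemma floor_mul_bounds {τ : ℝ} (hτ : 0 < τ) (θ : ℝ) :
    (⌊θ / τ⌋ : ℝ) * τ ≤ θ ∧ θ < (⌊θ / τ⌋ : ℝ) * τ + τ := by
  have h1 := Int.floor_le (θ / τ)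
  have h2 := Int.lt_floor_add_one (θ / τ)
  rw [le_div_iff₀ hτ] at h1
  rw [div_lt_iff₀ hτ] at h2
  exact ⟨h1, by linarith⟩

lemma floor_mem_Icc {τ R θ : ℝ} {M κ : ℕ} (hτ : 0 < τ) (hM : R / τ + κ + 2 ≤ M) (hθ : |θ| ≤ R)
    {j : ℤ} (hj : |j| ≤ κ + 1) : ⌊θ / τ⌋ + j ∈ Finset.Icc (-(M : ℤ)) M := by
  have hb := floor_mul_bounds hτ θ
  have h1 : |θ / τ| ≤ R / τ := by
    rw [abs_div, abs_of_pos hτ]; exact div_le_div_of_nonneg_right hθ hτ.le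
  have h2 := Int.floor_le (θ / τ)
  have h3 := Int.lt_floor_add_one (θ / τ)
  rw [abs_le] at h1
  have hj' : |(j : ℝ)| ≤ κ + 1 := by exact_mod_cast hj
  rw [abs_le] at hj'
  rw [Finset.mem_Icc]
  constructor
  · have : (-(M : ℝ)) ≤ (⌊θ / τ⌋ : ℝ) + j := by linarith
    exact_mod_cast this
  · have : (⌊θ / τ⌋ : ℝ) + j ≤ M := by linarith
    exact_mod_cast this

lemma abs_grid_sub_le {τ θ θ' : ℝ} {i i' : ℤ} {κ : ℕ} (hκτ : 0 ≤ κ * τ)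
    (h : (i : ℝ) * τ ≤ θ ∧ θ < i * τ + τ) (h' : (i' : ℝ) * τ ≤ θ' ∧ θ' < i' * τ + τ) :
    |((i + -κ : ℤ) : ℝ) * τ - ((i' + (κ + 1) : ℤ) : ℝ) * τ| ≤ |θ - θ'| + (2 * κ + 2) * τ := by
  have hdif := abs_le.1 (le_refl |θ - θ'|)
  push_cast
  rw [abs_le]; constructor <;> linarith [hdif.1, hdif.2, h.1, h.2, h'.1, h'.2]

lemma abs_grid_lower_sub_le {τ t : ℝ} {i : ℤ} {κ : ℕ} (hκτ : 0 ≤ κ * τ)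
    (h : (i : ℝ) * τ ≤ t ∧ t < i * τ + τ) :
    |((i + -κ : ℤ) : ℝ) * τ - t| ≤ (κ + 1) * τ := by
  push_cast
  rw [abs_le]; constructor <;> linarith [h.1, h.2]

lemma abs_grid_upper_sub_le {τ t : ℝ} {i : ℤ} {κ : ℕ} (hκτ : 0 ≤ κ * τ)
    (h : (i : ℝ) * τ ≤ t ∧ t < i * τ + τ) :
    |((i + (κ + 1) : ℤ) : ℝ) * τ - t| ≤ (κ + 1) * τ := by
  push_cast
  rw [abs_le]; constructor <;> linarith [h.1, h.2]

/-- Uniform control, at a fixed sample size, of the increments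
`(S - E S)(u, θ') - c (S - E S)(u, θ)` of the kernel-weighted empirical process over a box of
locations and thresholds. The process of the finite-range variables `Z` is controlled on a grid of
mesh `τ`; monotonicity in the threshold and Lipschitz dependence on the location fill the gaps.
Since `Y` and `Z` are only within `κ τ` of each other, the bracketing thresholds are `κ` grid steps
further out. -/
lemma prob_sup_empDev_le {ε : ℕ × ℤ → Ω → S} (hε : ∀ q, Measurable (ε q))
    (hind : iIndepFun ε P) {k : ℕ} {I : Finset (ℕ × ℕ)} {xs : ℕ × ℕ → ℝ} {Y Z : ℕ × ℕ → Ω → ℝ}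
    (hZ : ∀ p ∈ I, Measurable[windowSigma ε (lagWindow k p)] (Z p))
    {K : ℝ → ℝ} {M₀ Λ B : ℝ} (hK : IsLipBump M₀ Λ B K) (hK0 : ∀ v, 0 ≤ K v)
    {β τ δ ΛF W v R L V : ℝ} {κ M : ℕ} (hβ : 0 < β) (hτ : 0 < τ) (hΛF : 0 ≤ ΛF)
    (hYZ : ∀ p ∈ I, P.real {ω | κ * τ < |Y p ω - Z p ω|} ≤ δ)
    (hF : ∀ p ∈ I, ∀ t t', |P.real {ω | Y p ω ≤ t} - P.real {ω | Y p ω ≤ t'}| ≤ ΛF * |t - t'|)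
    (hW : ∀ u : ℝ, ∑ p ∈ I, K ((xs p - u) / β) ^ 2 ≤ W)
    {c : ℝ} (hc0 : 0 ≤ c) (hc1 : c ≤ 1) (hδ : 0 ≤ δ) (hv : 0 ≤ v)
    (hM : R / τ + κ + 2 ≤ M) (hL : 0 < L) (hVpos : 0 < V) (hBV : (2 * B) ^ 2 * L ≤ V)
    (hV : W * ((v + (2 * κ + 2) * τ) + ΛF * (v + (4 * κ + 2) * τ) + 2 * δ) ≤ V) :
    P {ω | ∃ u θ θ' : ℝ, |u| ≤ R ∧ |θ| ≤ R ∧ |θ'| ≤ R ∧ (1 - c) + |θ - θ'| ≤ v ∧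
        (2 * k + 1 : ℕ) * (9 * √(V * L)) + I.card * (2 * B * (ΛF * ((2 * κ + 1) * τ) + δ))
          + I.card * (Λ / β * τ * 2) <
        |empDev P I (fun p => K ((xs p - u) / β)) Y θ' ω
          - c * empDev P I (fun p => K ((xs p - u) / β)) Y θ ω|} ≤
      ENNReal.ofReal (I.card * δ
        + (2 * M + 1 : ℕ) ^ 3 * ((2 * k + 1 : ℕ) * (2 * Real.exp (-8 * L)))) := by
  classical
  set w : ℝ → ℕ × ℕ → ℝ := fun u p => K ((xs p - u) / β) with hw
  have hκτ : 0 ≤ κ * τ := by positivity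
  set bad : Set Ω := ⋃ p ∈ I, {ω | κ * τ < |Y p ω - Z p ω|} with hbad
  set A : ℤ × ℤ × ℤ → Set Ω := fun g => {ω | (2 * k + 1 : ℕ) * (9 * √(V * L)) ≤
    |empDev P I (w (g.1 * τ)) Z (g.2.2 * τ) ω
      - c * empDev P I (w (g.1 * τ)) Z (g.2.1 * τ) ω|} with hA
  set J : Finset ℤ := Finset.Icc (-(M : ℤ)) M with hJ
  set grid : Finset (ℤ × ℤ × ℤ) := (J ×ˢ J ×ˢ J).filter fun g =>
    (1 - c) + |(g.2.1 : ℝ) * τ - g.2.2 * τ| ≤ v + (2 * κ + 2) * τ with hgrid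
  have hbadP : P.real bad ≤ I.card * δ := by
    refine (measureReal_biUnion_finset_le _ _).trans ((Finset.sum_le_sum hYZ).trans ?_)
    rw [Finset.sum_const, nsmul_eq_mul]
  have hZY : ∀ p ∈ I, ∀ t t', |P.real {ω | Z p ω ≤ t} - P.real {ω | Y p ω ≤ t'}| ≤
      ΛF * (|t - t'| + κ * τ) + δ := fun p hp t t' =>
    abs_prob_le_sub_prob_le hκτ (hYZ p hp) (hF p hp) hΛF t t'
  have hAP : ∀ g ∈ grid, P.real (A g) ≤ (2 * k + 1 : ℕ) * (2 * Real.exp (-8 * L)) := by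
    intro g hg
    have hgv := (Finset.mem_filter.1 hg).2
    refine prob_empDev_ge hε hind k hZ (B := B) (fun p _ => hK.bound _) hc0 hc1 hL ?_ hBV hVpos
    refine le_trans (Finset.sum_le_sum (g := fun p => w (g.1 * τ) p ^ 2 *
      ((v + (2 * κ + 2) * τ) + ΛF * (v + (4 * κ + 2) * τ) + 2 * δ)) fun p hp => ?_) ?_
    · refine mul_le_mul_of_nonneg_left ?_ (sq_nonneg _)
      have e1 := hZY p hp (g.2.2 * τ) (g.2.2 * τ)
      have e2 := hZY p hp (g.2.1 * τ) (g.2.1 * τ)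
      have e3 := hF p hp (g.2.2 * τ) (g.2.1 * τ)
      rw [sub_self, abs_zero, zero_add] at e1 e2
      have hle : |(g.2.2 : ℝ) * τ - g.2.1 * τ| ≤ v + (2 * κ + 2) * τ := by
        rw [abs_sub_comm]; linarith
      have e4 := mul_le_mul_of_nonneg_left hle hΛF
      have e5 : |P.real {ω' | Z p ω' ≤ g.2.2 * τ} - P.real {ω' | Z p ω' ≤ g.2.1 * τ}| ≤
          ΛF * (v + (2 * κ + 2) * τ) + 2 * (ΛF * (κ * τ) + δ) := by
        rw [abs_le] at e1 e2 e3 ⊢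
        constructor <;> linarith [e1.1, e1.2, e2.1, e2.2, e3.1, e3.2]
      have e6 : (1 - c) ≤ v + (2 * κ + 2) * τ := by
        linarith [abs_nonneg ((g.2.1 : ℝ) * τ - g.2.2 * τ)]
      linarith
    · rw [← Finset.sum_mul]
      exact (mul_le_mul_of_nonneg_right (hW _) (by positivity)).trans hV
  have hgcard : (grid.card : ℝ) ≤ ((2 * M + 1 : ℕ) : ℝ) ^ 3 := by
    have h1 : grid.card ≤ (J ×ˢ J ×ˢ J).card := Finset.card_filter_le _ _
    have h2 : J.card = 2 * M + 1 := by
      rw [hJ, Int.card_Icc]; omega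
    rw [Finset.card_product, Finset.card_product, h2] at h1
    calc (grid.card : ℝ) ≤ (((2 * M + 1) * ((2 * M + 1) * (2 * M + 1)) : ℕ) : ℝ) := by
          exact_mod_cast h1
      _ = _ := by push_cast; ring
  have htot : P.real (bad ∪ ⋃ g ∈ grid, A g) ≤ I.card * δ
        + (2 * M + 1 : ℕ) ^ 3 * ((2 * k + 1 : ℕ) * (2 * Real.exp (-8 * L))) := by
    refine (measureReal_union_le _ _).trans (add_le_add hbadP ?_)
    refine (measureReal_biUnion_finset_le _ _).trans ((Finset.sum_le_sum hAP).trans ?_)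
    rw [Finset.sum_const, nsmul_eq_mul]
    exact mul_le_mul_of_nonneg_right hgcard (by positivity)
  rw [← ofReal_measureReal (μ := P) (s := {ω | _})]
  refine ENNReal.ofReal_le_ofReal (le_trans (measureReal_mono ?_) htot)
  rintro ω ⟨u, θ, θ', hu, hθ, hθ', hdist, hlt⟩
  by_contra hω
  rw [mem_union, not_or] at hω
  obtain ⟨hω1, hω2⟩ := hω
  simp only [hbad, mem_iUnion, mem_ofPred_eq, not_exists, not_lt] at hω1
  simp only [hA, mem_iUnion, mem_ofPred_eq, not_exists, not_le] at hω2
  have bu := floor_mul_bounds hτ u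
  have bθ := floor_mul_bounds hτ θ
  have bθ' := floor_mul_bounds hτ θ'
  set iu := ⌊u / τ⌋
  set iθ := ⌊θ / τ⌋
  set iθ' := ⌊θ' / τ⌋
  have hκ0 : (0 : ℝ) ≤ κ := Nat.cast_nonneg κ
  have jl : |(-(κ : ℤ))| ≤ κ + 1 := by rw [abs_neg, Nat.abs_cast]; omega
  have ju : |((κ : ℤ) + 1)| ≤ κ + 1 := by rw [abs_of_nonneg (by positivity)]
  have mu : iu ∈ J := by
    have := floor_mem_Icc (κ := κ) hτ hM hu (j := 0) (by rw [abs_zero]; positivity)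
    rwa [add_zero] at this
  -- the two bracketing grid points
  have g1 : (iu, iθ + -κ, iθ' + (κ + 1)) ∈ grid := by
    refine Finset.mem_filter.2 ⟨Finset.mem_product.2 ⟨mu, Finset.mem_product.2
      ⟨floor_mem_Icc hτ hM hθ jl, floor_mem_Icc hτ hM hθ' ju⟩⟩, ?_⟩
    have := abs_grid_sub_le hκτ bθ bθ'
    linarith
  have g2 : (iu, iθ + (κ + 1), iθ' + -κ) ∈ grid := by
    refine Finset.mem_filter.2 ⟨Finset.mem_product.2 ⟨mu, Finset.mem_product.2
      ⟨floor_mem_Icc hτ hM hθ ju, floor_mem_Icc hτ hM hθ' jl⟩⟩, ?_⟩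
    have := abs_grid_sub_le hκτ bθ' bθ
    rw [abs_sub_comm, abs_sub_comm θ'] at this
    linarith
  have b1 := abs_lt.1 (hω2 _ g1)
  have b2 := abs_lt.1 (hω2 _ g2)
  have hww : ∀ p ∈ I, |w u p - w (iu * τ) p| ≤ Λ / β * τ := fun p _ => by
    refine (hK.lip _ _).trans ?_
    rw [← sub_div, show xs p - u - (xs p - iu * τ) = -(u - iu * τ) by ring, abs_div, abs_neg,
      abs_of_pos hβ, div_mul_eq_mul_div, ← mul_div_assoc]
    refine div_le_div_of_nonneg_right (mul_le_mul_of_nonneg_left ?_ hK.lip_nonneg) hβ.le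
    rw [abs_of_nonneg (by linarith [bu.1])]
    linarith [bu.2]
  have p1 := abs_le.1 (abs_empDev_increment_sub_le (P := P) hww Z ω hc0 hc1
    (((iθ + -κ : ℤ) : ℝ) * τ) (((iθ' + (κ + 1) : ℤ) : ℝ) * τ))
  have p2 := abs_le.1 (abs_empDev_increment_sub_le (P := P) hww Z ω hc0 hc1
    (((iθ + (κ + 1) : ℤ) : ℝ) * τ) (((iθ' + -κ : ℤ) : ℝ) * τ))
  have hnear : ∀ p ∈ I, ∀ t t', |t - t'| ≤ (κ + 1) * τ →
      |P.real {ω | Z p ω ≤ t} - P.real {ω | Y p ω ≤ t'}| ≤ ΛF * ((2 * κ + 1) * τ) + δ :=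
    fun p hp t t' htt => by
      refine (hZY p hp t t').trans ?_
      have := mul_le_mul_of_nonneg_left
        (by linarith : |t - t'| + κ * τ ≤ (2 * κ + 1) * τ) hΛF
      linarith
  have nl := fun {t : ℝ} {i : ℤ} => abs_grid_lower_sub_le (t := t) (i := i) hκτ
  have nu := fun {t : ℝ} {i : ℤ} => abs_grid_upper_sub_le (t := t) (i := i) hκτ
  have up := empDev_increment_le (P := P) (w := w u) (B := B) (fun p _ => hK0 _)
    (fun p _ => (le_abs_self _).trans (hK.bound _)) hω1 hc0 hc1
    (θ := θ) (θ' := θ') (θl := ((iθ + -κ : ℤ) : ℝ) * τ) (θu := ((iθ' + (κ + 1) : ℤ) : ℝ) * τ)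
    (by push_cast; linarith [bθ.1]) (by push_cast; linarith [bθ'.2])
    (fun p hp => hnear p hp _ _ (nu bθ')) (fun p hp => hnear p hp _ _ (nl bθ))
  have lo := le_empDev_increment (P := P) (w := w u) (B := B) (fun p _ => hK0 _)
    (fun p _ => (le_abs_self _).trans (hK.bound _)) hω1 hc0 hc1
    (θ := θ) (θ' := θ') (θl := ((iθ' + -κ : ℤ) : ℝ) * τ) (θu := ((iθ + (κ + 1) : ℤ) : ℝ) * τ)
    (by push_cast; linarith [bθ'.1]) (by push_cast; linarith [bθ.2])
    (fun p hp => hnear p hp _ _ (nl bθ')) (fun p hp => hnear p hp _ _ (nu bθ))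
  refine absurd hlt (not_lt.2 ?_)
  rw [abs_le]
  constructor
  · linarith [b2.1, p2.1]
  · linarith [b1.2, p1.2]

end UniformBound

/-! ### A maximal inequality for the empirical process -/

section Asymptotics

variable {Ω S : Type*} [MeasurableSpace Ω] [MeasurableSpace S] {P : Measure Ω}
  [IsProbabilityMeasure P] {ν : Measure S} [IsProbabilityMeasure ν]

/-- The distribution function of a response. -/
lemma prob_response_le {ε : ℕ → ℤ → Ω → S} (hε_meas : ∀ i j, Measurable (ε i j))
    (hε_law : ∀ i j, P.map (ε i j) = ν) (hε_indep : iIndepFun (fun p : ℕ × ℤ => ε p.1 p.2) P)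
    {G : (ℤ → S) → ℝ} (hG : Measurable G) (μ s : ℝ → ℝ) (x : ℕ → ℕ → ℕ → ℝ) (n i j : ℕ)
    (hs : 0 < s (x n i j)) (θ : ℝ) :
    P.real {ω | response μ s x (error G ε) n i j ω ≤ θ} =
      errorCDF ν G ((θ - μ (x n i j)) / s (x n i j)) := by
  rw [errorCDF, ← prob_shift hε_meas hε_law hε_indep i j
    (A := {w | G w ≤ (θ - μ (x n i j)) / s (x n i j)}) (hG measurableSet_Iic)]
  congr 1
  ext ω
  simp only [mem_ofPred_eq, response, error]
  rw [le_div_iff₀ hs]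
  constructor <;> intro h <;> linarith

lemma sum_sq_kernel_le {M Λ B D W β u : ℝ} {K : ℝ → ℝ} (hK : IsLipBump M Λ B K) (hβ : 0 < β)
    {I : Finset (ℕ × ℕ)} {xs : ℕ × ℕ → ℝ}
    (hD : ∑ p ∈ I, (if |xs p - u| ≤ M * β then (1 : ℝ) else 0) ≤ D * W) :
    ∑ p ∈ I, K ((xs p - u) / β) ^ 2 ≤ B ^ 2 * D * W := by
  rw [mul_assoc]
  refine le_trans ?_ (mul_le_mul_of_nonneg_left hD (sq_nonneg B))
  rw [Finset.mul_sum]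
  refine Finset.sum_le_sum fun p _ => ?_
  split_ifs with h
  · rw [mul_one, ← sq_abs]
    exact pow_le_pow_left₀ (abs_nonneg _) (hK.bound _) 2
  · rw [hK.zero]
    · simp
    · rw [abs_div, abs_of_pos hβ, le_div_iff₀ hβ]
      exact (not_le.1 h).le

/-- The probability budget of the grid argument is of order `1 / N`. -/
lemma grid_budget_le {N L C₁ C₂ C₃ : ℝ} {k M n : ℕ} (hn : (n : ℝ) = N) (hN : 1 ≤ N)
    (hL : L = Real.log N) (hC₂ : 0 ≤ C₂) (hk : (k : ℝ) ≤ C₂ * L)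
    (hC₃ : 0 ≤ C₃) (hM : (M : ℝ) ≤ C₃ * N ^ 2) :
    (n : ℝ) * (C₁ / N ^ 2) + (2 * M + 1 : ℕ) ^ 3 * ((2 * k + 1 : ℕ) * (2 * Real.exp (-8 * L))) ≤
      (C₁ + (2 * C₃ + 1) ^ 3 * ((2 * C₂ + 1) * 2)) / N := by
  have hN0 : 0 < N := by linarith
  have hexp : Real.exp (-8 * L) = (N ^ 8)⁻¹ := by
    rw [hL, show -8 * Real.log N = -(((8 : ℕ) : ℝ) * Real.log N) by push_cast; ring, Real.exp_neg,
      Real.exp_nat_mul, Real.exp_log hN0]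
  have hLN : L ≤ N := hL ▸ Real.log_le_self hN0.le
  have hN2 : 1 ≤ N ^ 2 := one_le_pow₀ hN
  have h1 : ((2 * M + 1 : ℕ) : ℝ) ≤ (2 * C₃ + 1) * N ^ 2 := by
    push_cast; linarith
  have h2 : ((2 * k + 1 : ℕ) : ℝ) ≤ (2 * C₂ + 1) * N := by
    push_cast
    have := mul_le_mul_of_nonneg_left hLN hC₂
    linarith
  have h3 : ((2 * M + 1 : ℕ) : ℝ) ^ 3 ≤ ((2 * C₃ + 1) * N ^ 2) ^ 3 :=
    pow_le_pow_left₀ (by positivity) h1 3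
  have h4 : ((2 * M + 1 : ℕ) : ℝ) ^ 3 * ((2 * k + 1 : ℕ) * (2 * Real.exp (-8 * L))) ≤
      ((2 * C₃ + 1) * N ^ 2) ^ 3 * (((2 * C₂ + 1) * N) * (2 * Real.exp (-8 * L))) :=
    mul_le_mul h3 (mul_le_mul_of_nonneg_right h2 (by positivity)) (by positivity) (by positivity)
  refine (add_le_add_right h4 _).trans (le_of_eq ?_)
  rw [hexp, hn]
  field_simp

lemma variance_budget_le {v τ ΛF C₁ : ℝ} (κ : ℕ) (hτv : τ ≤ v) (hΛF : 0 ≤ ΛF) (hC₁ : 0 ≤ C₁) :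
    (v + (2 * κ + 2) * τ) + ΛF * (v + (4 * κ + 2) * τ) + 2 * (C₁ * τ) ≤
      (1 + (2 * κ + 2) + ΛF * (1 + (4 * κ + 2)) + 2 * C₁) * v := by
  have q1 : (2 * (κ : ℝ) + 2) * τ ≤ (2 * κ + 2) * v :=
    mul_le_mul_of_nonneg_left hτv (by positivity)
  have q0 : (4 * (κ : ℝ) + 2) * τ ≤ (4 * κ + 2) * v :=
    mul_le_mul_of_nonneg_left hτv (by positivity)
  have q2 : ΛF * (v + (4 * κ + 2) * τ) ≤ ΛF * (v + (4 * κ + 2) * v) :=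
    mul_le_mul_of_nonneg_left (by linarith) hΛF
  have q3 : C₁ * τ ≤ C₁ * v := mul_le_mul_of_nonneg_left hτv hC₁
  linarith

/-- With mesh `N⁻²`, the stochastic term dominates the discretisation errors. -/
lemma threshold_le {N β v L Bk A₂ B ΛF C₁ Λ : ℝ} {k κ : ℕ} (hN1 : 1 ≤ N) (hβ : 0 < β)
    (hNβ : 1 ≤ N * β) (hk : (k : ℝ) ≤ Bk * L) (hL1 : 1 ≤ L)
    (hNv : 1 ≤ N * β * v) (hA₂ : 0 ≤ A₂) (hB : 0 ≤ B) (hΛF : 0 ≤ ΛF) (hC₁ : 0 ≤ C₁)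
    (hΛ : 0 ≤ Λ) :
    (2 * k + 1 : ℕ) * (9 * √(A₂ * (N * β * v) * L))
        + N * (2 * B * (ΛF * ((2 * κ + 1) * (N ^ 2)⁻¹) + C₁ / N ^ 2))
        + N * (Λ / β * (N ^ 2)⁻¹ * 2) ≤
      ((2 * Bk + 1) * (9 * √A₂) + 2 * B * (ΛF * (2 * κ + 1) + C₁) + 2 * Λ)
        * (L * √(N * β * v * L)) := by
  have hN0 : 0 < N := by linarith
  have hsq : √(A₂ * (N * β * v) * L) = √A₂ * √(N * β * v * L) := by
    rw [mul_assoc, Real.sqrt_mul hA₂]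
  have hQ1 : 1 ≤ √(N * β * v * L) := by
    rw [Real.one_le_sqrt]
    exact one_le_mul_of_one_le_of_one_le hNv hL1
  rw [hsq]
  generalize √(N * β * v * L) = Q at hQ1
  have hLQ : 1 ≤ L * Q := one_le_mul_of_one_le_of_one_le hL1 hQ1
  have t1 : ((2 * k + 1 : ℕ) : ℝ) * (9 * (√A₂ * Q)) ≤ (2 * Bk + 1) * (9 * √A₂) * (L * Q) := by
    have : ((2 * k + 1 : ℕ) : ℝ) ≤ (2 * Bk + 1) * L := by push_cast; linarith
    calc ((2 * k + 1 : ℕ) : ℝ) * (9 * (√A₂ * Q)) ≤ ((2 * Bk + 1) * L) * (9 * (√A₂ * Q)) :=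
          mul_le_mul_of_nonneg_right this (by positivity)
      _ = _ := by ring
  have hτN : N * (N ^ 2)⁻¹ ≤ 1 := by
    rw [← div_eq_mul_inv, div_le_one (by positivity)]
    nlinarith
  have t2 : N * (2 * B * (ΛF * ((2 * κ + 1) * (N ^ 2)⁻¹) + C₁ / N ^ 2)) ≤
      2 * B * (ΛF * (2 * κ + 1) + C₁) * (L * Q) := by
    calc N * (2 * B * (ΛF * ((2 * κ + 1) * (N ^ 2)⁻¹) + C₁ / N ^ 2))
        = 2 * B * (ΛF * (2 * κ + 1) + C₁) * (N * (N ^ 2)⁻¹) := by ring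
      _ ≤ _ := mul_le_mul_of_nonneg_left (hτN.trans hLQ) (by positivity)
  have t3 : N * (Λ / β * (N ^ 2)⁻¹ * 2) ≤ 2 * Λ * (L * Q) := by
    have h1 : N * (N ^ 2)⁻¹ / β ≤ 1 := by
      rw [div_le_one hβ, ← div_eq_mul_inv, div_le_iff₀ (by positivity)]
      nlinarith
    calc N * (Λ / β * (N ^ 2)⁻¹ * 2) = 2 * Λ * (N * (N ^ 2)⁻¹ / β) := by ring
      _ ≤ _ := mul_le_mul_of_nonneg_left (h1.trans hLQ) (by positivity)
  linarith

/-- Uniform bound for increments of the kernel-weighted empirical process: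
`O_p(log N · √(N β v log N))` over pairs of thresholds whose increments have variance of
order `v`. The case `c = 1` concerns increments proper, the case `c = 0` with `v = 1` the process
itself. -/
lemma tendsto_prob_sup_empDev {ε : ℕ → ℤ → Ω → S} (hε_meas : ∀ i j, Measurable (ε i j))
    (hε_law : ∀ i j, P.map (ε i j) = ν) (hε_indep : iIndepFun (fun p : ℕ × ℤ => ε p.1 p.2) P)
    {G : (ℤ → S) → ℝ} (hG : Measurable G) (hgmc : GeometricCouplingDecay ν G)
    {a b : ℝ} (hab : a < b) {m : ℕ → ℕ → ℕ} {x : ℕ → ℕ → ℕ → ℝ}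
    (hdesign : ApproxUniformDesign a b m x) (hN : Tendsto (totalObs m) atTop atTop)
    {K : ℝ → ℝ} (hK : IsKernel K) {μ s : ℝ → ℝ} {cs Cs LF : ℝ} (hcs : 0 < cs)
    (hs_pos : ∀ u ∈ Icc a b, cs ≤ s u) (hs_le : ∀ u ∈ Icc a b, |s u| ≤ Cs)
    (hLF : ∀ y z, |errorCDF ν G y - errorCDF ν G z| ≤ LF * |y - z|) (hLF0 : 0 ≤ LF)
    {β : ℕ → ℝ} (hβ_pos : ∀ n, 0 < β n) (hβ : Tendsto β atTop (𝓝 0))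
    (hNβ : ∀ᶠ n in atTop, 1 ≤ (totalObs m n : ℝ) * β n)
    {R : ℝ} {c : ℝ} (hc0 : 0 ≤ c) (hc1 : c ≤ 1) {v : ℕ → ℝ}
    (hv : ∀ᶠ n in atTop, Real.log (totalObs m n) ≤ (totalObs m n : ℝ) * β n * v n) :
    ∃ C : ℝ, 0 ≤ C ∧ Tendsto (fun n => P {ω | ∃ u θ θ' : ℝ, |u| ≤ R ∧ |θ| ≤ R ∧ |θ'| ≤ R ∧
        (1 - c) + |θ - θ'| ≤ v n ∧
        C * (Real.log (totalObs m n)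
          * √((totalObs m n : ℝ) * β n * v n * Real.log (totalObs m n))) <
        |empDev P (obsFinset m n) (fun p => K ((x n p.1 p.2 - u) / β n))
            (fun p => response μ s x (error G ε) n p.1 p.2) θ' ω
          - c * empDev P (obsFinset m n) (fun p => K ((x n p.1 p.2 - u) / β n))
            (fun p => response μ s x (error G ε) n p.1 p.2) θ ω|}) atTop (𝓝 0) := by
  obtain ⟨M₀, Λ, B, hL0⟩ := hK.isLipBump
  obtain ⟨Bk, hBk, C₁, hC₁, htrunc⟩ := exists_frozen_tail_log hG hgmc
  obtain ⟨D, hD, hcard⟩ := hdesign.card_near_le hab hN hβ_pos hNβ hL0.radius_pos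
  obtain ⟨C', -, hdes⟩ := hdesign.exists_ordered hN
  have hΛ := hL0.lip_nonneg
  have hB := hL0.bound_nonneg
  set κ : ℕ := ⌈Cs⌉₊ with hκ
  set ΛF : ℝ := LF / cs with hΛFdef
  have hΛF : 0 ≤ ΛF := by positivity
  -- `A₁ v` bounds the variance of one term, and `A₂ N β v` that of the kernel-weighted sum
  set A₁ : ℝ := 1 + (2 * κ + 2) + ΛF * (1 + (4 * κ + 2)) + 2 * C₁ with hA₁
  set A₂ : ℝ := B ^ 2 * D * A₁ + (2 * B) ^ 2 + 1 with hA₂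
  have hA₁0 : 0 ≤ A₁ := by positivity
  have hA₂0 : 0 < A₂ := by positivity
  set C₃ : ℝ := ⌈R⌉₊ + κ + 2 with hC₃
  refine ⟨(2 * Bk + 1) * (9 * √A₂) + 2 * B * (ΛF * (2 * κ + 1) + C₁) + 2 * Λ, by positivity, ?_⟩
  have hN' : Tendsto (fun n => (totalObs m n : ℝ)) atTop atTop :=
    tendsto_natCast_atTop_atTop.comp hN
  have hlog : Tendsto (fun n => Real.log (totalObs m n)) atTop atTop :=
    Real.tendsto_log_atTop.comp hN'
  have hlim : Tendsto (fun n => ENNReal.ofReal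
      ((C₁ + (2 * C₃ + 1) ^ 3 * ((2 * Bk + 1) * 2)) / (totalObs m n : ℝ))) atTop (𝓝 0) := by
    have := (tendsto_const_nhds (x := C₁ + (2 * C₃ + 1) ^ 3 * ((2 * Bk + 1) * 2))).div_atTop hN'
    simpa [Function.comp_def] using (ENNReal.continuous_ofReal.tendsto 0).comp this
  refine tendsto_of_tendsto_of_tendsto_of_le_of_le' tendsto_const_nhds hlim
    (Eventually.of_forall fun _ => zero_le) ?_
  filter_upwards [hN.eventually htrunc, hcard, hdes, hNβ, hv, hlog.eventually_ge_atTop 1,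
    hN'.eventually_ge_atTop 1, hβ.eventually_le_const one_pos]
    with n htr hcardn hdesn hNβn hvn hL1 hN1 hβ1
  obtain ⟨k, w', hk, hw'⟩ := htr
  have hxin := hdesn.2.1
  have hβn := hβ_pos n
  set N : ℝ := (totalObs m n : ℝ) with hNdef
  set L : ℝ := Real.log N with hLdef
  have hN0 : 0 < N := by linarith
  set I := obsFinset m n with hI
  have hIcard : (I.card : ℝ) = N := by rw [hI, card_obsFinset]
  set τ : ℝ := (N ^ 2)⁻¹ with hτdef
  have hτ : 0 < τ := by positivity
  set Y : ℕ × ℕ → Ω → ℝ := fun p => response μ s x (error G ε) n p.1 p.2 with hY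
  set Z : ℕ × ℕ → Ω → ℝ := fun p ω =>
    μ (x n p.1 p.2) + s (x n p.1 p.2) * error (fun w => G (coupled k w w')) ε p.1 p.2 ω with hZ
  have hspos : ∀ p ∈ I, 0 < s (x n p.1 p.2) := fun p hp => hcs.trans_le (hs_pos _ (hxin p hp))
  -- `N⁻²` is below the variance scale `v`
  have hτv : τ ≤ v n := by
    have h1 : 1 ≤ N * β n * v n := hL1.trans hvn
    have hvpos : 0 < v n := by
      by_contra hcon
      have : N * β n * v n ≤ 0 := mul_nonpos_of_nonneg_of_nonpos (by positivity) (not_lt.1 hcon)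
      linarith
    have h2 : N * β n * v n ≤ N * v n :=
      mul_le_mul_of_nonneg_right (mul_le_of_le_one_right hN0.le hβ1) hvpos.le
    have h3 : N * v n ≤ N ^ 2 * v n :=
      mul_le_mul_of_nonneg_right (by nlinarith) hvpos.le
    rw [hτdef, inv_le_iff_one_le_mul₀ (by positivity)]
    linarith
  have hv0 : 0 ≤ v n := hτ.le.trans hτv
  have hδτ : C₁ / N ^ 2 = C₁ * τ := div_eq_mul_inv _ _
  set V : ℝ := A₂ * (N * β n * v n) with hVdef
  have hNv : 1 ≤ N * β n * v n := hL1.trans hvn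
  have main := prob_sup_empDev_le (P := P) (ε := fun q : ℕ × ℤ => ε q.1 q.2)
    (fun q => hε_meas q.1 q.2) hε_indep (k := k) (I := I) (xs := fun p => x n p.1 p.2)
    (Y := Y) (Z := Z)
    (fun p _ => ((measurable_error_coupled hG ε k w' p).const_mul _).const_add _)
    hL0 hK.nonneg (β := β n) (τ := τ) (δ := C₁ / N ^ 2) (ΛF := ΛF) (W := B ^ 2 * D * (N * β n))
    (v := v n) (R := R) (L := L) (V := V) (κ := κ) (M := (⌈R⌉₊ + κ + 2) * totalObs m n ^ 2)
    hβn hτ hΛF ?_ ?_ ?_ hc0 hc1 (by positivity) hv0 ?_ (by linarith) (by positivity) ?_ ?_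
  · refine le_trans (measure_mono ?_) (main.trans (ENNReal.ofReal_le_ofReal ?_))
    · rintro ω ⟨u, θ, θ', hu, hθ, hθ', hd, hlt⟩
      refine ⟨u, θ, θ', hu, hθ, hθ', hd, lt_of_le_of_lt ?_ hlt⟩
      rw [hIcard]
      exact threshold_le hN1 hβn hNβn hk hL1 hNv hA₂0.le hB hΛF hC₁.le hΛ
    · rw [show (I.card : ℝ) = ((totalObs m n : ℕ) : ℝ) from hIcard]
      refine grid_budget_le rfl hN1 rfl hBk.le hk (by positivity) ?_
      push_cast
      exact le_of_eq rfl
  · intro p hp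
    have hms : MeasurableSet {w | τ ≤ |G w - G (coupled k w w')|} :=
      measurableSet_le measurable_const (hG.sub (hG.comp (measurable_coupled_left k w'))).abs
    rw [← prob_shift hε_meas hε_law hε_indep p.1 p.2 hms] at hw'
    refine le_trans (measureReal_mono fun ω hω => ?_) hw'
    rw [mem_ofPred_eq] at hω
    by_contra hcon
    have hlt : |error G ε p.1 p.2 ω - error (fun w => G (coupled k w w')) ε p.1 p.2 ω| < τ :=
      not_le.1 hcon
    refine absurd hω (not_lt.2 ?_)
    have e : Y p ω - Z p ω = s (x n p.1 p.2) *
        (error G ε p.1 p.2 ω - error (fun w => G (coupled k w w')) ε p.1 p.2 ω) := by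
      simp only [hY, hZ, response]; ring
    rw [e, abs_mul]
    have hκs : |s (x n p.1 p.2)| ≤ κ := (hs_le _ (hxin p hp)).trans (Nat.le_ceil _)
    exact mul_le_mul hκs hlt.le (abs_nonneg _) (by positivity)
  · intro p hp t t'
    rw [hY]
    dsimp only
    rw [prob_response_le hε_meas hε_law hε_indep hG μ s x n _ _ (hspos p hp),
      prob_response_le hε_meas hε_law hε_indep hG μ s x n _ _ (hspos p hp)]
    refine (hLF _ _).trans ?_
    rw [← sub_div, sub_sub_sub_cancel_right, abs_div, abs_of_pos (hspos p hp), hΛFdef,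
      div_mul_eq_mul_div, ← mul_div_assoc]
    exact div_le_div_of_nonneg_left (by positivity) hcs (hs_pos _ (hxin p hp))
  · intro u
    exact sum_sq_kernel_le hL0 hβn (hcardn u)
  · push_cast
    rw [hτdef, div_inv_eq_mul]
    have hR1 := Nat.le_ceil R
    have hN2 : 1 ≤ N ^ 2 := one_le_pow₀ hN1
    have hκ0 : (0 : ℝ) ≤ κ := Nat.cast_nonneg κ
    have h1 := mul_le_mul_of_nonneg_right hR1 (by positivity : 0 ≤ N ^ 2)
    have h2 : ((κ : ℝ) + 2) * 1 ≤ (κ + 2) * N ^ 2 :=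
      mul_le_mul_of_nonneg_left hN2 (by positivity)
    linarith
  · have h1 : (2 * B) ^ 2 * L ≤ (2 * B) ^ 2 * (N * β n * v n) :=
      mul_le_mul_of_nonneg_left hvn (sq_nonneg _)
    have h2 : 0 ≤ (B ^ 2 * D * A₁ + 1) * (N * β n * v n) := by positivity
    rw [hVdef, hA₂]
    linarith
  · have h1 := variance_budget_le κ hτv hΛF hC₁.le
    rw [← hA₁, ← hδτ] at h1
    have h2 := mul_le_mul_of_nonneg_left h1 (by positivity : 0 ≤ B ^ 2 * D * (N * β n))
    have h3 : 0 ≤ ((2 * B) ^ 2 + 1) * (N * β n * v n) := by positivity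
    rw [hVdef, hA₂]
    linarith

end Asymptotics

/-! ### The convergence rates -/

section Rates

/-- The stochastic part `(log N)^{3/2} / (N β)^{1/2}` of the consistency rate. -/
noncomputable def stochRate (N : ℕ) (β : ℝ) : ℝ := √(Real.log N ^ 3 / (N * β))

lemma consistencyRate_eq (N : ℕ) (β : ℝ) :
    consistencyRate N β = β ^ 2 + stochRate N β := by
  have hL : 0 ≤ Real.log N := Real.log_natCast_nonneg N
  have h3 : √(Real.log N ^ 3) = Real.log N ^ (3 / 2 : ℝ) := by
    rw [Real.sqrt_eq_rpow, ← Real.rpow_natCast, ← Real.rpow_mul hL]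
    norm_num
  rw [consistencyRate, stochRate, Real.sqrt_div (by positivity), h3, Real.sqrt_eq_rpow]

lemma bahadurRate_eq (N : ℕ) {β : ℝ} (hβ : 0 < β) :
    bahadurRate N β = β ^ 4 + β * stochRate N β + stochRate N β * √(stochRate N β) := by
  have hL : 0 ≤ Real.log N := Real.log_natCast_nonneg N
  have hN : (0 : ℝ) ≤ N := Nat.cast_nonneg N
  have hq : stochRate N β = Real.log N ^ (3 / 2 : ℝ) / ((N : ℝ) * β) ^ (1 / 2 : ℝ) := by
    have := consistencyRate_eq N β
    rw [consistencyRate] at this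
    linarith
  have h1 : β ^ (1 / 2 : ℝ) * Real.log N ^ (3 / 2 : ℝ) / (N : ℝ) ^ (1 / 2 : ℝ) =
      β * stochRate N β := by
    have hββ : β = β ^ (1 / 2 : ℝ) * β ^ (1 / 2 : ℝ) := by
      rw [← Real.rpow_add hβ]; norm_num
    have hpos : 0 < β ^ (1 / 2 : ℝ) := Real.rpow_pos_of_pos hβ _
    rw [hq, Real.mul_rpow hN hβ.le]
    rcases hN.eq_or_lt with h0 | h0
    · rw [← h0]; norm_num
    · have := Real.rpow_pos_of_pos h0 (1 / 2 : ℝ)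
      field_simp
      rw [sq, ← hββ, mul_comm]
  have h2 : Real.log N ^ (9 / 4 : ℝ) / ((N : ℝ) * β) ^ (3 / 4 : ℝ) =
      stochRate N β * √(stochRate N β) := by
    have hA : 0 ≤ (N : ℝ) * β := by positivity
    rw [hq, Real.sqrt_div (by positivity), div_mul_div_comm, Real.sqrt_eq_rpow, Real.sqrt_eq_rpow,
      ← Real.rpow_mul hL, ← Real.rpow_mul hA, ← Real.rpow_add_of_nonneg hL (by norm_num)
        (by norm_num), ← Real.rpow_add_of_nonneg hA (by norm_num) (by norm_num)]
    norm_num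
  rw [bahadurRate, h1, h2]

lemma stochRate_nonneg (N : ℕ) (β : ℝ) : 0 ≤ stochRate N β := Real.sqrt_nonneg _

lemma mul_sq_stochRate {N : ℕ} {β : ℝ} (hNβ : 0 < N * β) :
    N * β * stochRate N β ^ 2 = Real.log N ^ 3 := by
  have hL : 0 ≤ Real.log N := Real.log_natCast_nonneg N
  rw [stochRate, Real.sq_sqrt (by positivity), mul_div_cancel₀ _ hNβ.ne']

lemma mul_stochRate_mul_sqrt {N : ℕ} {β v : ℝ} (hNβ : 0 < N * β) (hv : 0 ≤ v) :
    Real.log N * √(N * β * v * Real.log N) = N * β * stochRate N β * √v := by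
  have hL : 0 ≤ Real.log N := Real.log_natCast_nonneg N
  have h := mul_sq_stochRate hNβ
  have hq := stochRate_nonneg N β
  rw [← pow_left_inj₀ (by positivity) (by positivity) two_ne_zero, mul_pow, mul_pow,
    Real.sq_sqrt (by positivity), Real.sq_sqrt hv]
  linear_combination (-(N * β * v)) * h

/-- The product of the stochastic rate with the standard deviation of an increment over a distance
of the order of the consistency rate is of the order of the Bahadur rate. -/
lemma mul_sqrt_le {β q : ℝ} (hβ : 0 ≤ β) (hq : 0 ≤ q) :
    q * √(β ^ 2 + q) ≤ β ^ 4 + β * q + q * √q := by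
  have h1 : √(β ^ 2 + q) ≤ β + √q := by
    rw [Real.sqrt_le_left (by positivity)]
    nlinarith [Real.sq_sqrt hq, mul_nonneg hβ (Real.sqrt_nonneg q)]
  have h2 := mul_le_mul_of_nonneg_left h1 hq
  have h3 : 0 ≤ β ^ 4 := by positivity
  linarith

/-- The deterministic errors of the expected score are of the order of the Bahadur rate. -/
lemma one_add_mul_le {β q V C d : ℝ} (hβ : 0 ≤ β) (hq : 0 ≤ q) (hq1 : q ≤ 1) (hV : 0 ≤ V)
    (hVq : 1 ≤ V * q ^ 2) (hd : |d| ≤ C * (β ^ 2 + q)) :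
    1 + V * (β ^ 4 + d ^ 2) ≤ (2 + 2 * C ^ 2) * (V * (β ^ 4 + β * q + q * √q)) := by
  have hqq : q ≤ √q := Real.le_sqrt_of_sq_le (by nlinarith)
  have h1 : q ^ 2 ≤ q * √q := by
    rw [sq]
    exact mul_le_mul_of_nonneg_left hqq hq
  have h2 : 0 ≤ β * q := mul_nonneg hβ hq
  have h4 : 0 ≤ β ^ 4 := by positivity
  have hd2 : d ^ 2 ≤ C ^ 2 * (β ^ 2 + q) ^ 2 := by
    rw [← sq_abs d, ← mul_pow]
    exact pow_le_pow_left₀ (abs_nonneg d) hd 2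
  have hρ : (β ^ 2 + q) ^ 2 ≤ 2 * (β ^ 4 + q ^ 2) := by nlinarith [sq_nonneg (β ^ 2 - q)]
  have hd3 : d ^ 2 ≤ 2 * C ^ 2 * (β ^ 4 + β * q + q * √q) := by
    have := mul_le_mul_of_nonneg_left
      (hρ.trans (by linarith : _ ≤ 2 * (β ^ 4 + β * q + q * √q))) (sq_nonneg C)
    linarith
  have h6 : 0 ≤ q * √q := by positivity
  have h5 := mul_le_mul_of_nonneg_left
    (by linarith : q ^ 2 + (β ^ 4 + d ^ 2) ≤ (2 + 2 * C ^ 2) * (β ^ 4 + β * q + q * √q)) hV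
  linarith

/-- The Bahadur rate is negligible with respect to the consistency rate. -/
lemma bahadurRate_le_mul {β q : ℝ} (hβ : 0 ≤ β) (hq : 0 ≤ q) :
    β ^ 4 + β * q + q * √q ≤ (β ^ 2 + β + √q) * (β ^ 2 + q) := by
  have h1 : 0 ≤ β ^ 2 * (q + β + √q) := by positivity
  linarith

end Rates

/-! ### From the score to its sign change -/

section Score

/-- A weighted median is within `t` of the zero `b₀ + Q / g` of the linearised score
`d ↦ g (d - b₀) - Q`, if the deviation from linearity is below the slope times `t`. -/
lemma abs_minimiser_sub_le {I : Finset (ℕ × ℕ)} {w y : ℕ × ℕ → ℝ} {F : ℕ × ℕ → ℝ → ℝ}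
    (hw : ∀ p ∈ I, 0 ≤ w p) {θ₀ μ₀ b₀ Q g t D₁ D₂ : ℝ}
    (hmin : ∀ θ, ∑ p ∈ I, |y p - θ₀| * w p ≤ ∑ p ∈ I, |y p - θ| * w p) (hg : 0 < g)
    (hQ : ∑ p ∈ I, w p * (stepInd (y p) μ₀ - F p μ₀) = -Q)
    (hinc : ∀ d, |d - (b₀ + Q / g)| ≤ t →
      |∑ p ∈ I, w p * (stepInd (y p) (μ₀ + d) - F p (μ₀ + d))
        - ∑ p ∈ I, w p * (stepInd (y p) μ₀ - F p μ₀)| ≤ D₁)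
    (hJ : ∀ d, |d - (b₀ + Q / g)| ≤ t →
      |∑ p ∈ I, (F p (μ₀ + d) - 1 / 2) * w p - g * (d - b₀)| ≤ D₂)
    (ht : 0 ≤ t) (hlt : D₁ + D₂ < g * t) :
    |θ₀ - μ₀ - (b₀ + Q / g)| ≤ t := by
  have hscore : ∀ d, ∑ p ∈ I, (stepInd (y p) (μ₀ + d) - 1 / 2) * w p =
      ∑ p ∈ I, w p * (stepInd (y p) (μ₀ + d) - F p (μ₀ + d))
        + ∑ p ∈ I, (F p (μ₀ + d) - 1 / 2) * w p := fun d => by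
    rw [← Finset.sum_add_distrib]
    exact Finset.sum_congr rfl fun p _ => by ring
  have hgQ : g * (Q / g) = Q := by field_simp
  rw [hQ] at hinc
  have hup : θ₀ ≤ μ₀ + (b₀ + Q / g + t) := by
    have hd : |b₀ + Q / g + t - (b₀ + Q / g)| ≤ t := by
      rw [add_sub_cancel_left, abs_of_nonneg ht]
    refine minimiser_le hw (hmin _) ?_
    rw [hscore]
    have h1 := (abs_le.1 (hinc _ hd)).1
    have h2 := (abs_le.1 (hJ _ hd)).1
    linarith
  have hlo : μ₀ + (b₀ + Q / g - t) ≤ θ₀ := by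
    have hd : |b₀ + Q / g - t - (b₀ + Q / g)| ≤ t := by
      rw [sub_sub_cancel_left, abs_neg, abs_of_nonneg ht]
    refine le_minimiser hw (hmin _) ?_
    rw [hscore]
    have h1 := (abs_le.1 (hinc _ hd)).2
    have h2 := (abs_le.1 (hJ _ hd)).2
    linarith
  rw [abs_le]; constructor <;> linarith

/-- Consistency and the Bahadur representation at one location, from uniform bounds on the centred
empirical process, on its increments, and on the error of the expected score. -/
lemma bahadur_of_bounds {I : Finset (ℕ × ℕ)} {w y : ℕ × ℕ → ℝ} {F : ℕ × ℕ → ℝ → ℝ}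
    (hw : ∀ p ∈ I, 0 ≤ w p) {θ₀ μ₀ b₀ Q g β q V κ Cb C₁ C₃ C₄ D C : ℝ}
    (hmin : ∀ θ, ∑ p ∈ I, |y p - θ₀| * w p ≤ ∑ p ∈ I, |y p - θ| * w p)
    (hβ : 0 ≤ β) (hq : 0 < q) (hq1 : q ≤ 1) (hV : 0 < V) (hVq : 1 ≤ V * q ^ 2) (hκ : 0 < κ)
    (hg : κ * V ≤ g) (hb₀ : |b₀| ≤ Cb * β ^ 2) (hCb : 0 ≤ Cb) (hC₁ : 0 ≤ C₁) (hC₃ : 0 ≤ C₃)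
    (hD : 0 ≤ D)
    (hQ : ∑ p ∈ I, w p * (stepInd (y p) μ₀ - F p μ₀) = -Q) (hQle : |Q| ≤ C₁ * (V * q))
    (hC₄ : C₄ = Cb + C₁ / κ + 1) (hC : C = (C₃ + D * (2 + 2 * C₄ ^ 2) + 1) / κ)
    (hinc : ∀ d, |d| ≤ C₄ * (β ^ 2 + q) →
      |∑ p ∈ I, w p * (stepInd (y p) (μ₀ + d) - F p (μ₀ + d))
        - ∑ p ∈ I, w p * (stepInd (y p) μ₀ - F p μ₀)| ≤ C₃ * (V * (q * √(β ^ 2 + q))))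
    (hJ : ∀ d, |d| ≤ C₄ * (β ^ 2 + q) →
      |∑ p ∈ I, (F p (μ₀ + d) - 1 / 2) * w p - g * (d - b₀)| ≤ D * (1 + V * (β ^ 4 + d ^ 2)))
    (hsmall : C * (β ^ 4 + β * q + q * √q) ≤ β ^ 2 + q) :
    |θ₀ - μ₀| ≤ C₄ * (β ^ 2 + q) ∧
      |θ₀ - μ₀ - (b₀ + Q / g)| ≤ C * (β ^ 4 + β * q + q * √q) := by
  set r := β ^ 4 + β * q + q * √q with hr
  have hgpos : 0 < g := (mul_pos hκ hV).trans_le hg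
  have hr0 : 0 < r := by
    have := mul_pos hq (Real.sqrt_pos.2 hq)
    positivity
  have hC0 : 0 ≤ C := by rw [hC]; positivity
  have hQg : |Q / g| ≤ C₁ / κ * q := by
    rw [abs_div, abs_of_pos hgpos, div_le_iff₀ hgpos]
    have h1 : C₁ / κ * q * (κ * V) ≤ C₁ / κ * q * g :=
      mul_le_mul_of_nonneg_left hg (by positivity)
    have h2 : C₁ / κ * q * (κ * V) = C₁ * (V * q) := by field_simp
    linarith
  have hlead : |b₀ + Q / g| ≤ (Cb + C₁ / κ) * (β ^ 2 + q) := by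
    have h1 : 0 ≤ C₁ / κ * β ^ 2 := by positivity
    have h2 : 0 ≤ Cb * q := by positivity
    linarith [abs_add_le b₀ (Q / g)]
  have hnear : ∀ d, |d - (b₀ + Q / g)| ≤ C * r → |d| ≤ C₄ * (β ^ 2 + q) := fun d hd => by
    have h1 := abs_add_le (d - (b₀ + Q / g)) (b₀ + Q / g)
    rw [sub_add_cancel] at h1
    rw [hC₄]
    linarith
  have hmain := abs_minimiser_sub_le (D₁ := C₃ * (V * r))
    (D₂ := D * ((2 + 2 * C₄ ^ 2) * (V * r))) hw hmin hgpos hQ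
    (fun d hd => (hinc d (hnear d hd)).trans
      (mul_le_mul_of_nonneg_left (mul_le_mul_of_nonneg_left (mul_sqrt_le hβ hq.le) hV.le) hC₃))
    (fun d hd => (hJ d (hnear d hd)).trans
      (mul_le_mul_of_nonneg_left (one_add_mul_le hβ hq.le hq1 hV.le hVq (hnear d hd)) hD))
    (by positivity : 0 ≤ C * r) ?_
  · exact ⟨hnear _ hmain, hmain⟩
  · have h1 : κ * V * (C * r) ≤ g * (C * r) := mul_le_mul_of_nonneg_right hg (by positivity)
    have h2 : κ * V * (C * r) = (C₃ + D * (2 + 2 * C₄ ^ 2) + 1) * (V * r) := by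
      rw [hC]; field_simp
    have h3 : 0 < V * r := by positivity
    linarith

end Score

/-! ### Consistency and the Bahadur representation -/

section Conclusion

variable {Ω S : Type*} [MeasurableSpace Ω] [MeasurableSpace S] {P : Measure Ω}
  {ν : Measure S} [IsProbabilityMeasure ν]

lemma BoundedDerivs.exists_abs_le {r : ℕ} {f : ℝ → ℝ} {T : Set ℝ} (h : BoundedDerivs r f T) :
    ∃ C : ℝ, 0 ≤ C ∧ ∀ u ∈ T, |f u| ≤ C := by
  obtain ⟨C, hC⟩ := h.2 0 (Nat.zero_le r)
  refine ⟨|C|, abs_nonneg C, fun u hu => ?_⟩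
  have := hC u hu
  rw [iteratedDerivWithin_zero] at this
  exact this.trans (le_abs_self C)

/-- A bounded density makes the distribution function Lipschitz. -/
lemma abs_sub_le_of_hasDerivAt {F f : ℝ → ℝ} {L : ℝ} (hF : ∀ y, HasDerivAt F (f y) y)
    (hf : ∀ y, |f y| ≤ L) (y z : ℝ) : |F y - F z| ≤ L * |y - z| := by
  have := convex_univ.norm_image_sub_le_of_norm_hasDerivWithin_le (f := F) (f' := f) (C := L)
    (x := z) (y := y) (fun x _ => (hF x).hasDerivWithinAt) (fun x _ => hf x) (mem_univ _)
    (mem_univ _)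
  simpa using this

lemma exists_abs_rhoMu_le {a b : ℝ} {μ s fe F : ℝ → ℝ}
    (hμ : BoundedDerivs 4 μ (Icc a b)) (hs : BoundedDerivs 4 s (Icc a b))
    (hs_pos : ∃ c : ℝ, 0 < c ∧ ∀ u ∈ Icc a b, c ≤ s u)
    (hF : ∀ y, HasDerivAt F (fe y) y) (hfe : BoundedDerivs 4 fe univ)
    (hF0 : F 0 = 1 / 2) (hfe0 : 0 < fe 0) :
    ∃ C : ℝ, 0 ≤ C ∧ ∀ u ∈ Ioo a b, |rhoMu μ s fe u| ≤ C := by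
  obtain ⟨C, hC, c1, c2, c3, e1, h⟩ := exists_expansion hμ hs hs_pos hF hfe hF0 hfe0
  obtain ⟨Cs, hCs, hsle⟩ := hs.exists_abs_le
  obtain ⟨cs, hcs, hsge⟩ := hs_pos
  refine ⟨2 * Cs / fe 0 * C, by positivity, fun u hu => ?_⟩
  obtain ⟨-, h2, -, -, -, heq, -⟩ := h u hu
  have hsu : 0 < s u := hcs.trans_le (hsge u (Ioo_subset_Icc_self hu))
  have hρ : rhoMu μ s fe u = -(2 * s u / fe 0) * c2 u := by
    rw [heq]; field_simp
  rw [hρ, abs_mul, abs_neg, abs_div, abs_mul, abs_two, abs_of_pos hfe0]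
  have := hsle u (Ioo_subset_Icc_self hu)
  gcongr

lemma ladLoss_eq {Ω : Type*} (m : ℕ → ℕ → ℕ) (x : ℕ → ℕ → ℕ → ℝ) (Y : ℕ → ℕ → ℕ → Ω → ℝ)
    (K : ℝ → ℝ) (β : ℝ) (n : ℕ) (ω : Ω) (u θ : ℝ) :
    ladLoss m x Y K β n ω u θ =
      ∑ p ∈ obsFinset m n, |Y n p.1 p.2 ω - θ| * K ((x n p.1 p.2 - u) / β) :=
  sum_obs m n fun i j => |Y n i j ω - θ| * K ((x n i j - u) / β)

lemma bahadurQ_eq (m : ℕ → ℕ → ℕ) (x : ℕ → ℕ → ℕ → ℝ) {Y : ℕ → ℕ → ℕ → Ω → ℝ}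
    (hY : ∀ n i j, Measurable (Y n i j)) (μ K : ℝ → ℝ) (β : ℝ) (n : ℕ) (ω : Ω) (u : ℝ) :
    bahadurQ P m x Y μ K β n ω u =
      -empDev P (obsFinset m n) (fun p => K ((x n p.1 p.2 - u) / β)) (fun p => Y n p.1 p.2)
        (μ u) ω := by
  have hind : ∀ i j (ω : Ω), {ω' | Y n i j ω' ≤ μ u}.indicator (fun _ => (1 : ℝ)) ω =
      stepInd (Y n i j ω) (μ u) := fun i j ω => by
    simp only [indicator_apply, stepInd, mem_ofPred_eq]
  rw [bahadurQ, empDev, sum_obs m n fun i j =>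
    ({ω' | Y n i j ω' ≤ μ u}.indicator (fun _ => (1 : ℝ)) ω
      - ∫ ω'', {ω' | Y n i j ω' ≤ μ u}.indicator (fun _ => (1 : ℝ)) ω'' ∂P)
      * K ((x n i j - u) / β)]
  refine congrArg Neg.neg (Finset.sum_congr rfl fun p _ => ?_)
  simp only [hind]
  rw [integral_stepInd (hY n p.1 p.2), mul_comm]

/-- Bounds valid off events of vanishing probability are `O_p` bounds. -/
lemma uniformOp_of_bad {T : Set ℝ} {Z : ℕ → Ω → ℝ → ℝ} {r : ℕ → ℝ} {C : ℝ} {bad : ℕ → Set Ω}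
    (hbad : Tendsto (fun n => P (bad n)) atTop (𝓝 0))
    (h : ∀ᶠ n in atTop, ∀ ω ∉ bad n, ∀ u ∈ T, |Z n ω u| ≤ C * r n) : UniformOp P T Z r := by
  intro η hη
  refine ⟨C, ?_⟩
  filter_upwards [h, hbad.eventually_lt_const (ENNReal.ofReal_pos.2 hη)] with n hn hP
  refine (measure_mono fun ω hω => ?_).trans hP.le
  obtain ⟨u, hu, hlt⟩ := hω
  by_contra hnot
  exact (hn ω hnot u hu).not_gt hlt

/-- The stochastic rate is eventually small, while the effective number of observations
dominates the logarithmic factors. -/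
lemma eventually_rates {N : ℕ → ℕ} (hN : Tendsto N atTop atTop) {β : ℕ → ℝ}
    (hβ_pos : ∀ n, 0 < β n)
    (hβN : Tendsto (fun n => Real.log (N n) ^ 3 / ((N n : ℝ) * β n)) atTop (𝓝 0)) :
    Tendsto (fun n => stochRate (N n) (β n)) atTop (𝓝 0) ∧
      ∀ᶠ n in atTop, 1 ≤ Real.log (N n) ∧ Real.log (N n) ^ 3 ≤ (N n : ℝ) * β n := by
  refine ⟨by simpa [stochRate] using hβN.sqrt, ?_⟩
  have hlog : Tendsto (fun n => Real.log (N n)) atTop atTop :=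
    Real.tendsto_log_atTop.comp (tendsto_natCast_atTop_atTop.comp hN)
  filter_upwards [hlog.eventually_ge_atTop 1, hβN.eventually_lt_const one_pos,
    hN.eventually_ge_atTop 1] with n h1 h2 h3
  have hpos : 0 < (N n : ℝ) * β n := mul_pos (by exact_mod_cast h3) (hβ_pos n)
  exact ⟨h1, ((div_lt_one hpos).1 h2).le⟩

end Conclusion

end LocScale

open LocScale

theorem theorem4p1
    {Ω S : Type*} [MeasurableSpace Ω] [MeasurableSpace S]
    (P : Measure Ω) [IsProbabilityMeasure P]
    -- i.i.d. innovations with common law `ν`, and the filter generating the errors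
    (ν : Measure S) [IsProbabilityMeasure ν]
    (ε : ℕ → ℤ → Ω → S)
    (hε_meas : ∀ i j, Measurable (ε i j))
    (hε_law : ∀ i j, P.map (ε i j) = ν)
    (hε_indep : iIndepFun (fun p : ℕ × ℤ => ε p.1 p.2) P)
    (G : (ℤ → S) → ℝ) (hG : Measurable G)
    -- geometric coupling decay
    (hgmc : GeometricCouplingDecay ν G)
    -- identifiability: the error has median `0` and its absolute value has median `1`
    (hmed : median (innovLaw ν) G = 0)
    (hmed_abs : median (innovLaw ν) (fun w => |G w|) = 1)
    -- approximately uniform design, with a number of observations tending to infinity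
    (a b : ℝ) (hab : a < b)
    (m : ℕ → ℕ → ℕ) (x : ℕ → ℕ → ℕ → ℝ)
    (hdesign : ApproxUniformDesign a b m x)
    (hN : Tendsto (totalObs m) atTop atTop)
    -- kernel
    (K : ℝ → ℝ) (hK : IsKernel K)
    -- smoothness of location, scale and error density
    (μ s fe : ℝ → ℝ)
    (hμ : BoundedDerivs 4 μ (Icc a b))
    (hs : BoundedDerivs 4 s (Icc a b))
    (hs_pos : ∃ c : ℝ, 0 < c ∧ ∀ u ∈ Icc a b, c ≤ s u)
    (hfe : ∀ y, HasDerivAt (errorCDF ν G) (fe y) y)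
    (hfe_smooth : BoundedDerivs 4 fe univ)
    (hfe_zero : 0 < fe 0)
    (hfe_one : 0 < fe 1 + fe (-1))
    -- bandwidths
    (β : ℕ → ℝ) (hβ_pos : ∀ n, 0 < β n)
    (hβ : Tendsto β atTop (𝓝 0))
    (hβN : Tendsto (fun n => Real.log (totalObs m n) ^ 3 / ((totalObs m n : ℝ) * β n))
      atTop (𝓝 0))
    -- the kernel least-absolute-deviation estimator
    (muHat : ℕ → Ω → ℝ → ℝ)
    (hmuHat : IsKernelLAD a b m x (response μ s x (error G ε)) K β muHat)
    -- the margin at the end points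
    (δ : ℝ) (hδ : 0 < δ) :
    UniformOp P (Icc (a + δ) (b - δ))
        (fun n ω u => muHat n ω u - μ u)
        (fun n => consistencyRate (totalObs m n) (β n)) ∧
      UniformOp P (Icc (a + δ) (b - δ))
        (fun n ω u => muHat n ω u - μ u
          - (psiK K * rhoMu μ s fe u * β n ^ 2
            + (b - a) * s u / fe 0
              * (bahadurQ P m x (response μ s x (error G ε)) μ K (β n) n ω u
                / ((totalObs m n : ℝ) * β n))))
        (fun n => bahadurRate (totalObs m n) (β n)) := by
  obtain ⟨hq, hLV⟩ := eventually_rates hN hβ_pos hβN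
  have hNβ : ∀ᶠ n in atTop, 1 ≤ (totalObs m n : ℝ) * β n := by
    filter_upwards [hLV] with n hn
    exact (one_le_pow₀ hn.1).trans hn.2
  have hF0 : errorCDF ν G 0 = 1 / 2 := errorCDF_zero hG hmed
    (continuous_iff_continuousAt.2 fun y => (hfe y).continuousAt)
  obtain ⟨LF, hLF0, hLF⟩ := hfe_smooth.exists_abs_le
  have hLip := abs_sub_le_of_hasDerivAt hfe fun y => hLF y (mem_univ y)
  obtain ⟨Cμ, hCμ, hμle⟩ := hμ.exists_abs_le
  obtain ⟨Cs, hCs, hsle⟩ := hs.exists_abs_le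
  obtain ⟨Cρ, hCρ, hρle⟩ := exists_abs_rhoMu_le hμ hs hs_pos hfe hfe_smooth hF0 hfe_zero
  obtain ⟨D, hD, hJ⟩ := hdesign.exists_score_expansion hab hN hβ_pos hβ hNβ hδ hK hμ hs hs_pos
    hfe hfe_smooth hF0 hfe_zero
  obtain ⟨cs, hcs, hsge⟩ := hs_pos
  obtain ⟨_, -, hdes⟩ := hdesign.exists_ordered hN
  have hCs_pos : 0 < Cs := by
    have ha : a ∈ Icc a b := left_mem_Icc.2 hab.le
    exact hcs.trans_le ((hsge a ha).trans ((le_abs_self _).trans (hsle a ha)))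
  have hba : 0 < b - a := sub_pos.2 hab
  have hY : ∀ n i j, Measurable (response μ s x (error G ε) n i j) := fun n i j =>
    ((measurable_error hG hε_meas i j).const_mul _).const_add _
  -- a box containing the locations, the medians and all thresholds at distance at most one
  set R : ℝ := |a| + |b| + Cμ + 1 with hRdef
  -- the first maximal inequality bounds the empirical process at the true medians
  obtain ⟨C₁, hC₁, hbad₁⟩ := tendsto_prob_sup_empDev hε_meas hε_law hε_indep hG hgmc hab hdesign hN
    hK hcs hsge hsle hLip hLF0 hβ_pos hβ hNβ (R := R) le_rfl zero_le_one (v := fun _ => 1) (by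
      filter_upwards [hLV] with n hn
      rw [mul_one]
      exact (le_self_pow₀ hn.1 three_ne_zero).trans hn.2)
  set κ : ℝ := fe 0 / ((b - a) * Cs) with hκdef
  have hκ : 0 < κ := by positivity
  set Cb : ℝ := |psiK K| * Cρ with hCbdef
  set C₄ : ℝ := Cb + C₁ / κ + 1 with hC₄
  have hC₄1 : 1 ≤ C₄ := le_add_of_nonneg_left (by positivity)
  -- the second one bounds the increments over distances of the order of the consistency rate
  obtain ⟨C₂, hC₂, hbad₂⟩ := tendsto_prob_sup_empDev hε_meas hε_law hε_indep hG hgmc hab hdesign hN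
    hK hcs hsge hsle hLip hLF0 hβ_pos hβ hNβ (R := R) zero_le_one le_rfl
    (v := fun n => C₄ * (β n ^ 2 + stochRate (totalObs m n) (β n))) (by
      filter_upwards [hLV] with n hn
      have hL0 : 0 ≤ Real.log (totalObs m n) := zero_le_one.trans hn.1
      have hV : 0 < (totalObs m n : ℝ) * β n := (pow_pos (one_pos.trans_le hn.1) 3).trans_le hn.2
      have hq0 := stochRate_nonneg (totalObs m n) (β n)
      have h1 : Real.log (totalObs m n) ≤
          totalObs m n * β n * stochRate (totalObs m n) (β n) := by
        rw [← pow_le_pow_iff_left₀ hL0 (by positivity) two_ne_zero, mul_pow,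
          sq (totalObs m n * β n), mul_assoc (totalObs m n * β n), mul_sq_stochRate hV]
        have h3 := one_le_pow₀ hn.1 (n := 3)
        have h2 : 1 * Real.log (totalObs m n) ^ 2 ≤
            Real.log (totalObs m n) ^ 3 * Real.log (totalObs m n) ^ 3 :=
          mul_le_mul h3 (pow_le_pow_right₀ hn.1 (by norm_num)) (sq_nonneg _) (by positivity)
        rw [one_mul] at h2
        exact h2.trans (mul_le_mul_of_nonneg_right hn.2 (by positivity))
      refine h1.trans (mul_le_mul_of_nonneg_left ?_ hV.le)
      have h2 : 1 * (β n ^ 2 + stochRate (totalObs m n) (β n)) ≤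
          C₄ * (β n ^ 2 + stochRate (totalObs m n) (β n)) :=
        mul_le_mul_of_nonneg_right hC₄1 (by positivity)
      rw [one_mul] at h2
      exact (le_add_of_nonneg_left (sq_nonneg (β n))).trans h2)
  set C₃ : ℝ := C₂ * √C₄ with hC₃
  set C : ℝ := (C₃ + D * (2 + 2 * C₄ ^ 2) + 1) / κ with hC
  have hC0 : 0 ≤ C := by positivity
  have hbad := (hbad₁.add hbad₂)
  rw [add_zero] at hbad
  have hbadU := tendsto_of_tendsto_of_tendsto_of_le_of_le tendsto_const_nhds hbad
    (fun _ => bot_le) fun n => measure_union_le _ _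
  have hρ0 : Tendsto (fun n => C₄ * (β n ^ 2 + stochRate (totalObs m n) (β n))) atTop (𝓝 0) := by
    simpa using ((hβ.pow 2).add hq).const_mul C₄
  have hsm : Tendsto (fun n => C * (β n ^ 2 + β n + √(stochRate (totalObs m n) (β n)))) atTop
      (𝓝 0) := by
    simpa using (((hβ.pow 2).add hβ).add hq.sqrt).const_mul C
  -- off the two exceptional events, both bounds hold at all locations simultaneously
  obtain ⟨bad, hbad0, hgood⟩ : ∃ bad : ℕ → Set Ω, Tendsto (fun n => P (bad n)) atTop (𝓝 0) ∧
      ∀ᶠ n in atTop, ∀ ω ∉ bad n, ∀ u ∈ Icc (a + δ) (b - δ),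
        |muHat n ω u - μ u| ≤ C₄ * (β n ^ 2 + stochRate (totalObs m n) (β n)) ∧
        |muHat n ω u - μ u - (psiK K * rhoMu μ s fe u * β n ^ 2
            + bahadurQ P m x (response μ s x (error G ε)) μ K (β n) n ω u
              / (totalObs m n * β n / (b - a) * (fe 0 / s u)))| ≤
          C * (β n ^ 4 + β n * stochRate (totalObs m n) (β n)
            + stochRate (totalObs m n) (β n) * √(stochRate (totalObs m n) (β n))) := by
    refine ⟨_, hbadU, ?_⟩
    filter_upwards [hLV, hJ, hdes, hρ0.eventually_le_const one_pos, hsm.eventually_le_const one_pos,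
      hq.eventually_le_const one_pos] with n hLVn hJn hdesn hρn hsmn hqn ω hω u hu
    have huI : u ∈ Ioo a b := ⟨by linarith [hu.1], by linarith [hu.2]⟩
    have huI' := Ioo_subset_Icc_self huI
    have hsu : 0 < s u := hcs.trans_le (hsge u huI')
    have hL3 : 1 ≤ Real.log (totalObs m n) ^ 3 := one_le_pow₀ hLVn.1
    have hV : 0 < (totalObs m n : ℝ) * β n := one_pos.trans_le (hL3.trans hLVn.2)
    have hVq := mul_sq_stochRate hV
    have hVsqrt {v : ℝ} (hv : 0 ≤ v) := mul_stochRate_mul_sqrt hV hv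
    have hβn := hβ_pos n
    have hq0 : 0 < stochRate (totalObs m n) (β n) :=
      Real.sqrt_pos.2 (div_pos (one_pos.trans_le hL3) hV)
    set q := stochRate (totalObs m n) (β n) with hqdef
    have huR : |u| ≤ R := by
      have h1 := neg_abs_le a
      have h2 := le_abs_self b
      have h3 := abs_nonneg a
      have h4 := abs_nonneg b
      rw [abs_le]; constructor <;> linarith [huI.1, huI.2]
    have hμR : |μ u| ≤ Cμ := hμle u huI'
    have hdR : ∀ d, |d| ≤ 1 → |μ u + d| ≤ R := fun d hd => by
      have h3 := abs_nonneg a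
      have h4 := abs_nonneg b
      linarith [abs_add_le (μ u) d]
    have hμR' : |μ u| ≤ R := by simpa using hdR 0 (by simp)
    rw [mem_union, not_or] at hω
    have hE₁ : |bahadurQ P m x (response μ s x (error G ε)) μ K (β n) n ω u| ≤
        C₁ * (totalObs m n * β n * q) := by
      have h := hω.1
      simp only [mem_ofPred_eq, not_exists, not_and, not_lt] at h
      have h := h u (μ u) (μ u) huR hμR' hμR' (by simp)
      rw [hVsqrt zero_le_one] at h
      rw [bahadurQ_eq m x hY, abs_neg]
      simpa using h
    have hE₂ : ∀ d, |d| ≤ C₄ * (β n ^ 2 + q) →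
        |empDev P (obsFinset m n) (fun p => K ((x n p.1 p.2 - u) / β n))
            (fun p => response μ s x (error G ε) n p.1 p.2) (μ u + d) ω
          - empDev P (obsFinset m n) (fun p => K ((x n p.1 p.2 - u) / β n))
            (fun p => response μ s x (error G ε) n p.1 p.2) (μ u) ω| ≤
        C₃ * (totalObs m n * β n * (q * √(β n ^ 2 + q))) := fun d hd => by
      have h := hω.2
      simp only [mem_ofPred_eq, not_exists, not_and, not_lt] at h
      have h := h u (μ u) (μ u + d) huR hμR' (hdR d (hd.trans hρn)) (by simpa using hd)
      rw [hVsqrt (by positivity), one_mul, Real.sqrt_mul (by positivity)] at h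
      refine h.trans (le_of_eq ?_)
      rw [hC₃]
      ring
    have hprob : ∀ p ∈ obsFinset m n, ∀ θ,
        P.real {ω' | response μ s x (error G ε) n p.1 p.2 ω' ≤ θ} =
          errorCDF ν G ((θ - μ (x n p.1 p.2)) / s (x n p.1 p.2)) := fun p hp θ =>
      prob_response_le hε_meas hε_law hε_indep hG μ s x n _ _
        (hcs.trans_le (hsge _ (hdesn.2.1 p hp))) θ
    refine bahadur_of_bounds (F := fun p θ =>
        P.real {ω' | response μ s x (error G ε) n p.1 p.2 ω' ≤ θ})
      (fun p _ => hK.nonneg _) (fun θ => ?_) hβn.le hq0 hqn hV (hL3.trans hVq.ge) hκ ?_ ?_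
      (by positivity) hC₁ (by positivity) hD ?_ hE₁ hC₄ hC hE₂ (fun d hd => ?_) ?_
    · rw [← ladLoss_eq, ← ladLoss_eq]
      exact hmuHat n ω u huI' θ
    · have h1 : s u ≤ Cs := (le_abs_self _).trans (hsle u huI')
      have h2 : fe 0 / Cs ≤ fe 0 / s u := div_le_div_of_nonneg_left hfe_zero.le hsu h1
      calc κ * (totalObs m n * β n) = totalObs m n * β n / (b - a) * (fe 0 / Cs) := by
            rw [hκdef]; field_simp
        _ ≤ _ := mul_le_mul_of_nonneg_left h2 (by positivity)
    · rw [abs_mul, abs_mul, abs_of_nonneg (sq_nonneg (β n))]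
      exact mul_le_mul_of_nonneg_right
        (mul_le_mul_of_nonneg_left (hρle u huI) (abs_nonneg _)) (sq_nonneg _)
    · rw [bahadurQ_eq m x hY, neg_neg]
      rfl
    · have h := hJn u hu d (hd.trans hρn)
      rw [Finset.sum_congr rfl fun p hp => by rw [hprob p hp]]
      exact h
    · have h1 := mul_le_mul_of_nonneg_left (bahadurRate_le_mul hβn.le hq0.le) hC0
      have h2 := mul_le_mul_of_nonneg_right hsmn (by positivity : 0 ≤ β n ^ 2 + q)
      linarith
  constructor
  · refine uniformOp_of_bad hbad0 (C := C₄) ?_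
    filter_upwards [hgood] with n hn ω hω u hu
    rw [consistencyRate_eq]
    exact (hn ω hω u hu).1
  · refine uniformOp_of_bad hbad0 (C := C) ?_
    filter_upwards [hgood] with n hn ω hω u hu
    rw [bahadurRate_eq _ (hβ_pos n)]
    convert (hn ω hω u hu).2 using 4
    have hsu : s u ≠ 0 :=
      (hcs.trans_le (hsge u ⟨by linarith [hu.1], by linarith [hu.2]⟩)).ne'
    field_simp
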